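/- Fix integers $n\ge 1$, $N'>n$ and $N\ge N'+n$; balls $B(x,r)\subset\mathbb R^N$ are open. *Cones.* For a set $X$ of $k$ unit vectors in $\mathbb R^{N'}$ with $\{0\}\cup X$ affinely independent, $C(X)=\{tp: t\ge 0,\ p\in \mathrm{conv}(X)\}$ (with $C(\emptyset)=\{0\}$) is a simple cone of dimension $k$. A complex cone of dimension $k$ is a finite non-empty union $T=\bigcup_i C(X_i)$ of simple cones of dimension $k$ such that $C(X)\cap C(Y)=C(X\cap Y)$ for all $X,Y\in\Omega_T=\{Y: Y\subset X_i \text{ for some } i\}$. It is non-flat if $\sup\angle(Z_1,Z_2)<\pi$ whenever $Z_1,Z_2\in\Omega_T$, $\#Z_1=\#Z_2=t+1$, $\#(Z_1\cap Z_2)=t$, $0\le t<k$, where, with $Z=Z_1\cap Z_2$, $\angle(Z_1,Z_2)$ is the set of angles $\angle f_1zf_2$ with $z\in C(Z)$, $f_j\in C(Z_j)\setminus C(Z)$ and $\mathrm{dist}(f_j,C(Z))=|f_j-z|$. For $0\le m\le n$, a set of type $m$ is a set $W=R(T\times\mathbb R^m\times\{0\})\subset\mathbb R^N$ with $R$ an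 isometry of $\mathbb R^N$ and $T\subset\mathbb R^{N'}$ a non-flat complex cone of dimension $n-m$. Its $(m+t)$-spine is $L^{m+t}(W)=R\big(\bigcup_{Y\in\Omega_T,\#Y=t}C(Y)\times\mathbb R^m\times\{0\}\big)$, $0\le t\le n-m$, and $L^s(W)=\emptyset$ for $s<m$. *Blow-ups.* Let $\mathscr B$ be a family of sets of types $0,\dots,n$ that is finite modulo isometries of $\mathbb R^N$. Let $\mathscr A$ be the family of all isometric images of the blow-up limits $\{cy: c\ge 0,\ y\in (W\cap B(x,r))-x\}$ ($r$ small) with $W\in\mathscr B$, $x\in W$, and let $\mathscr A(m)$ be the sets of type $m$ in $\mathscr A$. For closed sets $F_1,F_2$ that meet $B(x,r)$ put $$d_{x,r}(F_1,F_2)=\tfrac1r\max\Big\{\sup_{z\in F_2\cap B(x,r)}\mathrm{dist}(z,F_1),\ \sup_{z\in F_1\cap B(x,r)}\mathrm{dist}(z,F_2)\Big\}.$$ *Constants.* Call $\delta_0\in(0,1/10)$ admissible if $d_{x,r}(V,W)>\delta_0$ whenever $0\le m\le t<n$, $V\in\mathscr A(m)$, $x\in L^t(V)$, $W\in\bigcup_{k=t+1}^n\mathscr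 A(k)$, $r>0$ and $W$ meets $B(x,r)$. Call $n_0>10$ admissible if for all $0\le m\le t<n$, $W\in\mathscr A(m)$ and all balls $B$ (with $n_0B$ the concentric ball of $n_0$ times the radius): (i) if $B\cap W\ne\emptyset$ and $n_0B\cap L^t(W)=\emptyset$, then $W\cap B=Y\cap B$ for some $Y\in\bigcup_{u=t+1}^n\mathscr A(u)$; (ii) if $W\cap B\neq Y\cap B$ for every $Y\in\mathscr A(t+1)$, then $n_0B\cap L^t(W)\ne\emptyset$. **Proposition.** Admissible $\delta_0$ and $n_0$ exist. For all admissible $\delta_0,n_0$ there is $\varepsilon_0>0$, depending only on $n,N',N,\mathscr B,\delta_0,n_0$, with the following property. Let $N_0=n_0/\delta_0$ and $C_0=10^8(n_0+n)^{3n}N_0$. Let $\varepsilon<\varepsilon_0$ and let $E\subset\mathbb R^N$ be a closed set with $0\in E$ such that for every $x\in E$ and $r>0$ there is $Z(x,r)\in\mathscr A$ with $x\in Z(x,r)$ and $d_{x,r}(E,Z(x,r))<\varepsilon$. For $0\le m\le n$ put $$a_m(x,r)=\inf\{d_{x,r}(E,W): W\in\mathscr A(m),\ x\in L^m(W)\}\qquad(\inf\emptyset=+\infty)$$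 and let $E_m$ be the set of $x\in E\cap B(0,2)$ for which there is $r_x>0$ with $a_m(x,r)<C_0\varepsilon$ for all $0<r<r_x$. Then $E_0,\dots,E_n$ are pairwise disjoint and $$E\cap B(0,1.99)=\Big(\bigcup_{m=0}^nE_m\Big)\cap B(0,1.99).$$ -/

import Mathlib

namespace ConeStrata

open Set Metric

/-- `ℝ^d` with the Euclidean norm. -/
abbrev Euc (d : ℕ) : Type := EuclideanSpace ℝ (Fin d)

/-- The cone `C(X) = {t p : t ≥ 0, p ∈ conv X}`, with the convention `C(∅) = {0}`
(for nonempty `X` the point `0` belongs to it anyway). -/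
def coneOver {d : ℕ} (X : Set (Euc d)) : Set (Euc d) :=
  insert 0 {y | ∃ t : ℝ, 0 ≤ t ∧ ∃ p ∈ convexHull ℝ X, y = t • p}

/-- `X` generates a simple cone of dimension `k`: it consists of `k` unit vectors and
`{0} ∪ X` is affinely independent. -/
def IsSimpleGen {d : ℕ} (k : ℕ) (X : Set (Euc d)) : Prop :=
  X ⊆ sphere (0 : Euc d) 1 ∧ X.encard = (k : ℕ∞) ∧
    AffineIndependent ℝ (fun p : ↥(insert (0 : Euc d) X) => (p : Euc d))

/-- The family `Ω_T` of all subsets of the generating sets `X_i`. -/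
def faces {d : ℕ} (𝒳 : Set (Set (Euc d))) : Set (Set (Euc d)) :=
  {Y | ∃ X ∈ 𝒳, Y ⊆ X}

/-- The finite nonempty family `𝒳 = {X_1, …, X_k}` presents the complex cone `⋃ C(X_i)` of
dimension `k`. -/
def IsComplexCone {d : ℕ} (k : ℕ) (𝒳 : Set (Set (Euc d))) : Prop :=
  𝒳.Finite ∧ 𝒳.Nonempty ∧ (∀ X ∈ 𝒳, IsSimpleGen k X) ∧
    ∀ X ∈ faces 𝒳, ∀ Y ∈ faces 𝒳, coneOver X ∩ coneOver Y = coneOver (X ∩ Y)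

/-- The union of the cones `C(Y)` over the members `Y` of `Ω_T` with `t` elements. -/
def skeleton {d : ℕ} (𝒳 : Set (Set (Euc d))) (t : ℕ) : Set (Euc d) :=
  {y | ∃ Y ∈ faces 𝒳, Y.encard = (t : ℕ∞) ∧ y ∈ coneOver Y}

/-- The set `∠(F₁, F₂)` of angles between `C(F₁)` and `C(F₂)` along `C(F₁ ∩ F₂)`. -/
def angleSet {d : ℕ} (F₁ F₂ : Set (Euc d)) : Set ℝ :=
  {θ | ∃ z ∈ coneOver (F₁ ∩ F₂),
    ∃ f₁ ∈ coneOver F₁ \ coneOver (F₁ ∩ F₂), ∃ f₂ ∈ coneOver F₂ \ coneOver (F₁ ∩ F₂),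
      infDist f₁ (coneOver (F₁ ∩ F₂)) = dist f₁ z ∧
      infDist f₂ (coneOver (F₁ ∩ F₂)) = dist f₂ z ∧
      θ = EuclideanGeometry.angle f₁ z f₂}

/-- The non-flat condition for a complex cone of dimension `k`. -/
def NonFlat {d : ℕ} (k : ℕ) (𝒳 : Set (Set (Euc d))) : Prop :=
  ∀ t : ℕ, t < k → ∀ Z₁ ∈ faces 𝒳, ∀ Z₂ ∈ faces 𝒳,
    (Z₁ ∩ Z₂).encard = (t : ℕ∞) → Z₁.encard = ((t + 1 : ℕ) : ℕ∞) →
    Z₂.encard = ((t + 1 : ℕ) : ℕ∞) → sSup (angleSet Z₁ Z₂) < Real.pi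

/-- The set `S × ℝ^m × {0}` in `ℝ^N`, where `S` lies in `ℝ^{N'}` (used for `N' + m ≤ N`). -/
def cylinder {N' : ℕ} (N m : ℕ) (S : Set (Euc N')) : Set (Euc N) :=
  {x | ∃ y ∈ S, (∀ (i : Fin N) (h : i.1 < N'), x i = y ⟨i.1, h⟩) ∧
    ∀ i : Fin N, N' + m ≤ i.1 → x i = 0}

/-- `W = R(T × ℝ^m × {0})`, where `T` is the complex cone of dimension `n - m` in `ℝ^{N'}`
presented by `𝒳`, `T` satisfies the non-flat condition, and `R` is an isometry of `ℝ^N`. -/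
def Presents {N' N : ℕ} (n m : ℕ) (𝒳 : Set (Set (Euc N'))) (R : Euc N ≃ᵢ Euc N)
    (W : Set (Euc N)) : Prop :=
  m ≤ n ∧ IsComplexCone (n - m) 𝒳 ∧ NonFlat (n - m) 𝒳 ∧
    W = R '' cylinder N m (⋃ X ∈ 𝒳, coneOver X)

/-- `W` is a set of type `m`. -/
def IsType (n N' : ℕ) {N : ℕ} (m : ℕ) (W : Set (Euc N)) : Prop :=
  ∃ (𝒳 : Set (Set (Euc N'))) (R : Euc N ≃ᵢ Euc N), Presents n m 𝒳 R W

/-- The collection of all sets of type `m`, `0 ≤ m ≤ n`. -/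
def allTypes (n N' N : ℕ) : Set (Set (Euc N)) :=
  {W | ∃ m : ℕ, m ≤ n ∧ IsType n N' m W}

/-- The `s`-spine `L^s(W)`: for `W = R(T × ℝ^m × {0})` of type `m` and `s = m + t` it is the image
of `(⋃_{#Y = t} C(Y)) × ℝ^m × {0}`; it is empty for `s < m`.
Under the non-flat condition neither `m` nor this image depends on the presentation of `W`. -/
def spine (n N' : ℕ) {N : ℕ} (s : ℕ) (W : Set (Euc N)) : Set (Euc N) :=
  {x | ∃ (m t : ℕ) (𝒳 : Set (Set (Euc N'))) (R : Euc N ≃ᵢ Euc N),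
    Presents n m 𝒳 R W ∧ s = m + t ∧ x ∈ R '' cylinder N m (skeleton 𝒳 t)}

/-- Two sets are equivalent when an isometry of `ℝ^N` maps one onto the other. -/
def isometrySetoid (N : ℕ) : Setoid (Set (Euc N)) where
  r W₁ W₂ := ∃ R : Euc N ≃ᵢ Euc N, W₁ = R '' W₂
  iseqv :=
    { refl := fun W => ⟨IsometryEquiv.refl _, (image_id W).symm⟩
      symm := by
        rintro W₁ W₂ ⟨R, rfl⟩
        exact ⟨R.symm, by ext x; simp⟩
      trans := by
        rintro W₁ W₂ W₃ ⟨R, rfl⟩ ⟨S, rfl⟩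
        exact ⟨S.trans R, by simp only [image_image]; rfl⟩ }

/-- The cone `{c y : y ∈ (W ∩ B(x,r)) - x, c ≥ 0}`. -/
def localCone {N : ℕ} (W : Set (Euc N)) (x : Euc N) (r : ℝ) : Set (Euc N) :=
  {v | ∃ c : ℝ, 0 ≤ c ∧ ∃ y ∈ W ∩ ball x r, v = c • (y - x)}

/-- `𝒜(ℬ)`: all isometric images of blow-up limits of members `W` of `ℬ` at points of `W`.
The local cone of `W` at a point does not depend on the radius once this is small enough, and the
blow-up limit is this cone. -/
def blowUps {N : ℕ} (ℬ : Set (Set (Euc N))) : Set (Set (Euc N)) :=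
  {V | ∃ W ∈ ℬ, ∃ x ∈ W, ∃ R : Euc N ≃ᵢ Euc N, ∃ r₀ : ℝ, 0 < r₀ ∧
    ∀ r : ℝ, 0 < r → r < r₀ → V = R '' localCone W x r}

/-- `𝒜(m)`: the members of `𝒜(ℬ)` of type `m`. -/
def blowUpsOfType (n N' : ℕ) {N : ℕ} (ℬ : Set (Set (Euc N))) (m : ℕ) : Set (Set (Euc N)) :=
  {V | V ∈ blowUps ℬ ∧ IsType n N' m V}

/-- The normalized local Hausdorff distance `d_{x,r}(F₁, F₂)`, for closed sets that meet
`B(x,r)`. -/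
noncomputable def relDist {N : ℕ} (x : Euc N) (r : ℝ) (F₁ F₂ : Set (Euc N)) : ℝ :=
  (1 / r) * max (sSup ((fun z => infDist z F₁) '' (F₂ ∩ ball x r)))
    (sSup ((fun z => infDist z F₂) '' (F₁ ∩ ball x r)))

/-- `δ₀ ∈ (0, 1/10)` is a constant separating the types in `𝒜(ℬ)`: if the `t`-spine of a member
of type at most `t` passes through `x`, then this member is at `d_{x,r}`-distance greater than
`δ₀` from all members of type greater than `t`. -/
def IsSeparationConstant (n N' : ℕ) {N : ℕ} (ℬ : Set (Set (Euc N))) (δ₀ : ℝ) : Prop :=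
  0 < δ₀ ∧ δ₀ < 1 / 10 ∧
    ∀ m t : ℕ, m ≤ t → t < n → ∀ V ∈ blowUpsOfType n N' ℬ m, ∀ x ∈ spine n N' t V,
      ∀ k : ℕ, t < k → k ≤ n → ∀ W ∈ blowUpsOfType n N' ℬ k,
        ∀ r : ℝ, 0 < r → (W ∩ ball x r).Nonempty → δ₀ < relDist x r V W

/-- `n₀ > 10` is a constant for replacing members of `𝒜(ℬ)` by members of higher type in balls
`B` such that `n₀ B` does not meet a spine. -/
def IsReplacementConstant (n N' : ℕ) {N : ℕ} (ℬ : Set (Set (Euc N))) (n₀ : ℝ) : Prop :=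
  10 < n₀ ∧
    ∀ m t : ℕ, m ≤ t → t < n → ∀ W ∈ blowUpsOfType n N' ℬ m, ∀ (c : Euc N) (ρ : ℝ), 0 < ρ →
      ((W ∩ ball c ρ).Nonempty → ball c (n₀ * ρ) ∩ spine n N' t W = ∅ →
        ∃ u : ℕ, t < u ∧ u ≤ n ∧ ∃ Y ∈ blowUpsOfType n N' ℬ u, W ∩ ball c ρ = Y ∩ ball c ρ) ∧
      ((∀ Y ∈ blowUpsOfType n N' ℬ (t + 1), W ∩ ball c ρ ≠ Y ∩ ball c ρ) →
        (ball c (n₀ * ρ) ∩ spine n N' t W).Nonempty)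

/-- `a_m(x,r) = inf {d_{x,r}(E,W) : W ∈ 𝒜(m), x ∈ L^m(W)}`, with `inf ∅ = +∞`. -/
noncomputable def approxNumber (n N' : ℕ) {N : ℕ} (ℬ : Set (Set (Euc N))) (E : Set (Euc N))
    (m : ℕ) (x : Euc N) (r : ℝ) : EReal :=
  sInf ((fun W => ((relDist x r E W : ℝ) : EReal)) ''
    {W | W ∈ blowUpsOfType n N' ℬ m ∧ x ∈ spine n N' m W})

/-- `C₀ = 10^8 (n₀ + n)^{3n} N₀` with `N₀ = n₀ / δ₀`. -/
noncomputable def constC (n : ℕ) (n₀ δ₀ : ℝ) : ℝ :=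
  10 ^ 8 * (n₀ + n) ^ (3 * n) * (n₀ / δ₀)

/-- The stratum `E_m` (with `κ = C₀ ε`): the points `x ∈ E ∩ B(0,2)` such that
`a_m(x,r) < κ` for all sufficiently small `r > 0`. -/
def stratum (n N' : ℕ) {N : ℕ} (ℬ : Set (Set (Euc N))) (E : Set (Euc N)) (κ : ℝ) (m : ℕ) :
    Set (Euc N) :=
  {x | x ∈ E ∩ ball (0 : Euc N) 2 ∧ ∃ rₓ : ℝ, 0 < rₓ ∧
    ∀ r : ℝ, 0 < r → r < rₓ → approxNumber n N' ℬ E m x r < (κ : EReal)}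

end ConeStrata

/-! A set of type `m` is, up to an isometry, a simplicial fan taken modulo a subspace `P` of
dimension `m`. Working modulo `P`, rather than with orthogonal products, makes the class stable
under blow-up: near a point whose positive coefficients are indexed by `Y`, the fan coincides with
the star of `Y`, a fan modulo `P + span Y`. So all blow-ups are stars, and finiteness modulo
isometries leaves finitely many fans.

The non-flat condition is exploited through one fact: a non-flat fan is translation invariant only
along `P` (`IsFan.lineality_eq`). Hence the number of directions of local invariance at a point is
`dim P` plus the number of positive coefficients (`IsFan.localRank_eq`), and the `s`-spine consists
of the points of local rank at most `s` (`mem_spine`). Type and spines thus become intrinsic.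

Both constants come from compactness. If `V` has local rank at most `t` at `x` and `W` is invariant
in more than `t` directions, some direction of `W` is orthogonal to the space of the star seen near
`x`; moving along it leaves `V` by a definite amount, so `V` and `W` are not close
(`IsFan.exists_separation`). If a ball meeting a fan is far from its points of rank at most `t`, a
point of the ball has many large coefficients, and the fan is a star there (`IsFan.exists_star_eq`).

For `x ∈ E` let `t` be the largest number such that, at some scale, `E` is `δ₀ / 8`-close to a
member of type at least `t`. Separation and replacement carry this closeness to all sufficiently
smaller scales (`closeToType_of_le`). There the approximating set agrees near `x` with a member of
type exactly `t` whose `t`-spine passes very close to `x`; otherwise replacement would yield a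
larger type at a smaller scale. A translation puts `x` on the spine (`exists_near_spine`), so `x ∈
E_t`. Disjointness is separation applied to two approximations at one scale. -/

namespace ConeStrata
open Set Metric Function
set_option linter.unusedSectionVars false

/-! ### Simplicial fans modulo a subspace, and their stars -/

section Fan
variable {ι F : Type*} [Fintype ι] [NormedAddCommGroup F] [InnerProductSpace ℝ F]

/-- The linear combination of the vectors `u i` with coefficients `a i`. -/
abbrev comb (u : ι → F) : (ι → ℝ) →ₗ[ℝ] F := Fintype.linearCombination ℝ u

/-- Nonnegative combinations of the vectors `u i`, `i ∈ X`, `X ∈ 𝒳`, plus a vector of `P`. -/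
def fanSet (P : Submodule ℝ F) (u : ι → F) (𝒳 : Set (Set ι)) : Set F :=
  {x | ∃ X ∈ 𝒳, ∃ a : ι → ℝ, (∀ i, 0 ≤ a i) ∧ (∀ i, i ∉ X → a i = 0) ∧ x - comb u a ∈ P}

/-- A pure non-flat simplicial fan with `k`-dimensional cones in the quotient by `P`. -/
structure IsFan (P : Submodule ℝ F) (u : ι → F) (𝒳 : Set (Set ι)) (k : ℕ) : Prop where
  nonempty : 𝒳.Nonempty
  card : ∀ X ∈ 𝒳, X.ncard = k
  -- The positive part of `a` lives on `X`, the negative part on `X'`: a point common to two cones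
  -- has the same coefficients in both. This combines linear independence modulo `P` with `C(X) ∩
  -- C(X') = C(X ∩ X')`.
  indep : ∀ X ∈ 𝒳, ∀ X' ∈ 𝒳, ∀ a : ι → ℝ, (∀ i, i ∉ X' → 0 ≤ a i) → (∀ i, i ∉ X → a i ≤ 0) →
    comb u a ∈ P → a = 0
  -- The faces `Z ∪ {i}` and `Z ∪ {j}` do not point in opposite directions modulo `P + span Z`;
  -- coefficients on `Z` are free.
  nonflat : ∀ X ∈ 𝒳, ∀ X' ∈ 𝒳, ∀ Z : Set ι, Z ⊆ X → Z ⊆ X' → ∀ i ∈ X, ∀ j ∈ X', i ∉ Z → j ∉ Z →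
    i ≠ j → ∀ a : ι → ℝ, (∀ l, l ∉ Z → l ≠ i → l ≠ j → a l = 0) → 0 < a i → 0 < a j →
    comb u a ∉ P

/-- The star of the face `Y`, with `Y` removed from its members. -/
def star (𝒳 : Set (Set ι)) (Y : Set ι) : Set (Set ι) := {Z | ∃ X ∈ 𝒳, Y ⊆ X ∧ Z = X \ Y}

/-- The linear space parallel to the face `Y` of a fan. -/
def starSpace (P : Submodule ℝ F) (u : ι → F) (Y : Set ι) : Submodule ℝ F :=
  P ⊔ Submodule.span ℝ (u '' Y)

theorem mem_span_image_iff_comb {u : ι → F} {Y : Set ι} {x : F} :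
    x ∈ Submodule.span ℝ (u '' Y) ↔ ∃ b : ι → ℝ, (∀ i, i ∉ Y → b i = 0) ∧ comb u b = x := by
  classical
  constructor
  · intro hx
    induction hx using Submodule.span_induction with
    | mem x hx =>
      obtain ⟨i, hi, rfl⟩ := hx
      refine ⟨Pi.single i 1, ?_, by simp⟩
      intro j hj
      have : j ≠ i := by rintro rfl; exact hj hi
      simp [this]
    | zero => exact ⟨0, by simp, by simp⟩
    | add x y _ _ h1 h2 =>
      obtain ⟨b, hb, rfl⟩ := h1
      obtain ⟨c, hc, rfl⟩ := h2
      exact ⟨b + c, fun i hi => by simp [hb i hi, hc i hi], by rw [map_add]⟩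
    | smul t x _ h =>
      obtain ⟨b, hb, rfl⟩ := h
      exact ⟨t • b, fun i hi => by simp [hb i hi], by rw [map_smul]⟩
  · rintro ⟨b, hb, rfl⟩
    rw [Fintype.linearCombination_apply]
    refine Submodule.sum_mem _ fun i _ => ?_
    by_cases hi : i ∈ Y
    · exact Submodule.smul_mem _ _ (Submodule.subset_span ⟨i, hi, rfl⟩)
    · simp [hb i hi]

theorem mem_starSpace {P : Submodule ℝ F} {u : ι → F} {Y : Set ι} {x : F} :
    x ∈ starSpace P u Y ↔ ∃ b : ι → ℝ, (∀ i, i ∉ Y → b i = 0) ∧ x - comb u b ∈ P := by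
  rw [starSpace, Submodule.mem_sup]
  constructor
  · rintro ⟨p, hp, z, hz, rfl⟩
    obtain ⟨b, hb, rfl⟩ := mem_span_image_iff_comb.1 hz
    exact ⟨b, hb, by simpa using hp⟩
  · rintro ⟨b, hb, h⟩
    exact ⟨_, h, _, mem_span_image_iff_comb.2 ⟨b, hb, rfl⟩, by simp⟩

/-- Since the star is taken modulo the span of `Y`, coefficients on `Y` lose their sign restriction.
-/
theorem mem_fanSet_star {P : Submodule ℝ F} {u : ι → F} {𝒳 : Set (Set ι)} {Y : Set ι} {x : F} :
    x ∈ fanSet (starSpace P u Y) u (star 𝒳 Y) ↔ ∃ X ∈ 𝒳, Y ⊆ X ∧ ∃ a : ι → ℝ,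
      (∀ i, i ∉ Y → 0 ≤ a i) ∧ (∀ i, i ∉ X → a i = 0) ∧ x - comb u a ∈ P := by
  classical
  constructor
  · rintro ⟨_, ⟨X, hX, hY, rfl⟩, a, ha, ha', h⟩
    obtain ⟨b, hb, hb'⟩ := mem_starSpace.1 h
    refine ⟨X, hX, hY, a + b, ?_, ?_, ?_⟩
    · intro i hi
      simp [hb i hi, ha i]
    · intro i hi
      simp [hb i (fun h => hi (hY h)), ha' i (fun h => hi h.1)]
    · rwa [map_add, ← sub_sub]
  · rintro ⟨X, hX, hY, a, ha, ha', h⟩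
    refine ⟨_, ⟨X, hX, hY, rfl⟩, fun i => if i ∈ Y then 0 else a i, ?_, ?_, ?_⟩
    · intro i
      by_cases hi : i ∈ Y <;> simp [hi, ha]
    · intro i hi
      by_cases hi' : i ∈ Y
      · simp [hi']
      · simp only [hi', if_false]
        exact ha' i (fun h => hi ⟨h, hi'⟩)
    · refine mem_starSpace.2 ⟨fun i => if i ∈ Y then a i else 0, ?_, ?_⟩
      · intro i hi; simp [hi]
      · rw [sub_sub, ← map_add]
        convert h using 3
        ext i
        by_cases hi : i ∈ Y <;> simp [hi]

theorem fanSet_smul_mem {P : Submodule ℝ F} {u : ι → F} {𝒳 : Set (Set ι)} {x : F} {t : ℝ}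
    (ht : 0 ≤ t) (hx : x ∈ fanSet P u 𝒳) : t • x ∈ fanSet P u 𝒳 := by
  obtain ⟨X, hX, a, ha, ha', h⟩ := hx
  refine ⟨X, hX, t • a, fun i => mul_nonneg ht (ha i), fun i hi => by simp [ha' i hi], ?_⟩
  rw [map_smul, ← smul_sub]
  exact P.smul_mem _ h

theorem fanSet_add_mem {P : Submodule ℝ F} {u : ι → F} {𝒳 : Set (Set ι)} {x p : F}
    (hx : x ∈ fanSet P u 𝒳) (hp : p ∈ P) : x + p ∈ fanSet P u 𝒳 := by
  obtain ⟨X, hX, a, ha, ha', h⟩ := hx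
  refine ⟨X, hX, a, ha, ha', ?_⟩
  rw [add_sub_right_comm]
  exact P.add_mem h hp

theorem fanSet_add_mem_iff {P : Submodule ℝ F} {u : ι → F} {𝒳 : Set (Set ι)} {x p : F}
    (hp : p ∈ P) : x + p ∈ fanSet P u 𝒳 ↔ x ∈ fanSet P u 𝒳 := by
  refine ⟨fun h => ?_, fun h => fanSet_add_mem h hp⟩
  simpa using fanSet_add_mem h (P.neg_mem hp)

theorem zero_mem_fanSet {P : Submodule ℝ F} {u : ι → F} {𝒳 : Set (Set ι)} (h : 𝒳.Nonempty) :
    (0 : F) ∈ fanSet P u 𝒳 := by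
  obtain ⟨X, hX⟩ := h
  exact ⟨X, hX, 0, by simp, by simp, by simp⟩

theorem subset_starSpace {P : Submodule ℝ F} {u : ι → F} {Y : Set ι} : P ≤ starSpace P u Y :=
  le_sup_left

theorem vec_mem_starSpace {P : Submodule ℝ F} {u : ι → F} {Y : Set ι} {i : ι} (hi : i ∈ Y) :
    u i ∈ starSpace P u Y :=
  Submodule.mem_sup_right (Submodule.subset_span ⟨i, hi, rfl⟩)

theorem star_star (𝒳 : Set (Set ι)) {Y Y' : Set ι} (h : Disjoint Y' Y) :
    star (star 𝒳 Y) Y' = star 𝒳 (Y ∪ Y') := by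
  ext Z
  constructor
  · rintro ⟨_, ⟨X, hX, hY, rfl⟩, hY', rfl⟩
    exact ⟨X, hX, union_subset hY (hY'.trans sdiff_subset), by rw [sdiff_sdiff]⟩
  · rintro ⟨X, hX, hY, rfl⟩
    refine ⟨X \ Y, ⟨X, hX, subset_union_left.trans hY, rfl⟩, ?_, by rw [sdiff_sdiff]⟩
    exact subset_sdiff.2 ⟨subset_union_right.trans hY, h⟩

theorem starSpace_starSpace (P : Submodule ℝ F) (u : ι → F) (Y Y' : Set ι) :
    starSpace (starSpace P u Y) u Y' = starSpace P u (Y ∪ Y') := by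
  simp only [starSpace, image_union, Submodule.span_union, sup_assoc]

namespace IsFan
variable {P : Submodule ℝ F} {u : ι → F} {𝒳 : Set (Set ι)} {k : ℕ}

theorem star (h : IsFan P u 𝒳 k) {X Y : Set ι} (hX : X ∈ 𝒳) (hY : Y ⊆ X) :
    IsFan (starSpace P u Y) u (ConeStrata.star 𝒳 Y) (k - Y.ncard) where
  nonempty := ⟨_, X, hX, hY, rfl⟩
  card := by
    rintro _ ⟨X, hX, hY, rfl⟩
    rw [ncard_sdiff hY, h.card X hX]
  indep := by
    rintro _ ⟨X, hX, hY, rfl⟩ _ ⟨X', hX', hY', rfl⟩ a ha ha' hP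
    obtain ⟨b, hb, hb'⟩ := mem_starSpace.1 hP
    rw [← map_sub] at hb'
    have := h.indep X hX X' hX' (a - b) ?_ ?_ hb'
    · have hab : a = b := sub_eq_zero.1 this
      ext i
      by_cases hi : i ∈ Y
      · exact le_antisymm (ha' i fun h => h.2 hi) (ha i fun h => h.2 hi)
      · rw [hab, hb i hi]; rfl
    · intro i hi
      simpa [hb i fun h => hi (hY' h)] using ha i fun h => hi h.1
    · intro i hi
      simpa [hb i fun h => hi (hY h)] using ha' i fun h => hi h.1
  nonflat := by
    rintro _ ⟨X, hX, hY, rfl⟩ _ ⟨X', hX', hY', rfl⟩ Z hZ hZ' i hi j hj hiZ hjZ hij a ha hai haj hP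
    obtain ⟨b, hb, hb'⟩ := mem_starSpace.1 hP
    rw [← map_sub] at hb'
    refine h.nonflat X hX X' hX' (Z ∪ Y) (union_subset (hZ.trans sdiff_subset) hY)
      (union_subset (hZ'.trans sdiff_subset) hY') i hi.1 j hj.1 ?_ ?_ hij (a - b) ?_ ?_ ?_ hb'
    · rintro (h | h)
      exacts [hiZ h, hi.2 h]
    · rintro (h | h)
      exacts [hjZ h, hj.2 h]
    · intro l hl hli hlj
      simp [ha l (fun h => hl (Or.inl h)) hli hlj, hb l (fun h => hl (Or.inr h))]
    · simpa [hb i hi.2] using hai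
    · simpa [hb j hj.2] using haj

theorem coeff_zero (h : IsFan P u 𝒳 k) {X : Set ι} (hX : X ∈ 𝒳) {a : ι → ℝ}
    (ha : ∀ i, i ∉ X → a i = 0) (hP : comb u a ∈ P) : a = 0 :=
  h.indep X hX X hX a (fun i hi => (ha i hi).ge) (fun i hi => (ha i hi).le) hP

variable [FiniteDimensional ℝ F]

/-- The allowed coefficient vectors form finitely many closed cones on which `comb u a` avoids `P`
unless `a = 0`. Compactness of the unit sphere and homogeneity turn uniqueness of coefficients into
a Lipschitz bound. -/
theorem exists_bound (h : IsFan P u 𝒳 k) : ∃ K : ℝ, 0 < K ∧ ∀ X ∈ 𝒳, ∀ X' ∈ 𝒳, ∀ a : ι → ℝ,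
    (∀ i, i ∉ X' → 0 ≤ a i) → (∀ i, i ∉ X → a i ≤ 0) → ∀ q ∈ P, ‖a‖ ≤ K * ‖comb u a - q‖ := by
  let S : Set (ι → ℝ) := (⋃ X ∈ 𝒳, ⋃ X' ∈ 𝒳,
    {a | (∀ i, i ∉ X' → 0 ≤ a i) ∧ (∀ i, i ∉ X → a i ≤ 0)}) ∩ sphere 0 1
  have hS : IsCompact S := by
    refine (isCompact_sphere 0 1).inter_left ?_
    refine (toFinite 𝒳).isClosed_biUnion fun X _ => (toFinite 𝒳).isClosed_biUnion fun X' _ => ?_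
    simp only [ofPred_and, ofPred_forall]
    refine IsClosed.inter ?_ ?_
    · exact isClosed_iInter fun i => isClosed_iInter fun _ =>
        isClosed_le continuous_const (continuous_apply i)
    · exact isClosed_iInter fun i => isClosed_iInter fun _ =>
        isClosed_le (continuous_apply i) continuous_const
  have hc : Continuous (comb u) := LinearMap.continuous_of_finiteDimensional _
  obtain ⟨c, hc0, hcS⟩ : ∃ c : ℝ, 0 < c ∧ ∀ a ∈ S, c ≤ infDist (comb u a) P := by
    rcases S.eq_empty_or_nonempty with he | hne
    · exact ⟨1, one_pos, by simp [he]⟩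
    · obtain ⟨a, ha, hmin⟩ := hS.exists_isMinOn hne
        ((continuous_infDist_pt (P : Set F)).comp hc).continuousOn
      refine ⟨infDist (comb u a) P, ?_, fun b hb => hmin hb⟩
      refine lt_of_le_of_ne infDist_nonneg fun h0 => ?_
      have hmem : comb u a ∈ P := by
        have := (P.closed_of_finiteDimensional.mem_iff_infDist_zero ⟨0, P.zero_mem⟩).2 h0.symm
        exact this
      obtain ⟨ha1, ha2⟩ := ha
      simp only [mem_iUnion] at ha1
      obtain ⟨X, hX, X', hX', h1, h2⟩ := ha1
      have := h.indep X hX X' hX' a h1 h2 hmem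
      simp [this] at ha2
  refine ⟨c⁻¹, inv_pos.2 hc0, ?_⟩
  intro X hX X' hX' a h1 h2 q hq
  rcases eq_or_ne a 0 with rfl | ha
  · simp only [norm_zero]
    positivity
  have hn : 0 < ‖a‖ := norm_pos_iff.2 ha
  have hmem : ‖a‖⁻¹ • a ∈ S := by
    refine ⟨?_, by simp [norm_smul, hn.ne']⟩
    simp only [mem_iUnion]
    refine ⟨X, hX, X', hX', fun i hi => ?_, fun i hi => ?_⟩
    · exact mul_nonneg (by positivity) (h1 i hi)
    · exact mul_nonpos_of_nonneg_of_nonpos (by positivity) (h2 i hi)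
  have h3 := hcS _ hmem
  have h4 : infDist (comb u (‖a‖⁻¹ • a)) P ≤ dist (comb u (‖a‖⁻¹ • a)) (‖a‖⁻¹ • q) :=
    infDist_le_dist_of_mem (P.smul_mem _ hq)
  have h5 := h3.trans h4
  rw [map_smul, dist_smul₀, dist_eq_norm, norm_inv, norm_norm] at h5
  rw [inv_mul_eq_div, le_div_iff₀ hc0]
  rw [inv_mul_eq_div, le_div_iff₀ hn] at h5
  linarith

/-- Coefficients are Lipschitz in the point, so those that are at least `K * ρ` at `x` stay positive
throughout the ball. There the sign condition on `Y` and the inclusion of `Y` in the cone are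
automatic, and only these distinguish the fan from the star. -/
theorem inter_ball_eq {K : ℝ} (hK : ∀ X ∈ 𝒳, ∀ X' ∈ 𝒳, ∀ a : ι → ℝ,
    (∀ i, i ∉ X' → 0 ≤ a i) → (∀ i, i ∉ X → a i ≤ 0) → ∀ q ∈ P, ‖a‖ ≤ K * ‖comb u a - q‖)
    (hK0 : 0 < K) {X Y : Set ι} (hX : X ∈ 𝒳) (hY : Y ⊆ X) {s : ι → ℝ} (hs : ∀ i, 0 ≤ s i)
    (hs' : ∀ i, i ∉ X → s i = 0) {x : F} (hx : x - comb u s ∈ P) {ρ : ℝ}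
    (hsY : ∀ i ∈ Y, K * ρ ≤ s i) :
    fanSet P u 𝒳 ∩ ball x ρ = fanSet (starSpace P u Y) u (ConeStrata.star 𝒳 Y) ∩ ball x ρ := by
  have key : ∀ z ∈ ball x ρ, ∀ X' ∈ 𝒳, ∀ a : ι → ℝ, (∀ i, i ∉ X' → a i = 0) →
      (∀ i, i ∉ X → 0 ≤ a i) → z - comb u a ∈ P → ∀ i ∈ Y, 0 < a i := by
    intro z hz X' hX' a ha ha' hza i hi
    have h1 := hK X hX X' hX' (s - a) ?_ ?_ ((z - comb u a) - (x - comb u s)) (P.sub_mem hza hx)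
    · have h2 : comb u (s - a) - ((z - comb u a) - (x - comb u s)) = x - z := by
        rw [map_sub]; abel
      rw [h2, ← dist_eq_norm x, dist_comm x] at h1
      have h3 : |s i - a i| ≤ ‖s - a‖ := norm_le_pi_norm (s - a) i
      have h4 := mul_lt_mul_of_pos_left (mem_ball.1 hz) hK0
      have := hsY i hi
      have := le_abs_self (s i - a i)
      linarith
    · intro i hi
      simpa [ha i hi] using hs i
    · intro i hi
      simpa [hs' i hi] using ha' i hi
  ext z
  simp only [mem_inter_iff, and_congr_left_iff]
  intro hz
  rw [mem_fanSet_star]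
  constructor
  · rintro ⟨X', hX', a, ha, ha', h⟩
    refine ⟨X', hX', fun i hi => ?_, a, fun i _ => ha i, ha', h⟩
    by_contra hi'
    exact (key z hz X' hX' a ha' (fun i _ => ha i) h i hi).ne' (ha' i hi')
  · rintro ⟨X', hX', hY', a, ha, ha', h⟩
    refine ⟨X', hX', a, fun i => ?_, ha', h⟩
    by_cases hi : i ∈ Y
    · exact (key z hz X' hX' a ha' (fun i hi => ha i fun h => hi (hY h)) h i hi).le
    · exact ha i hi

/-- Near a point the fan agrees with the star of the face that carries the point. -/
theorem exists_ball (h : IsFan P u 𝒳 k) {X Y : Set ι} (hX : X ∈ 𝒳) (hY : Y ⊆ X) {s : ι → ℝ}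
    (hs : ∀ i, 0 ≤ s i) (hs' : ∀ i, i ∉ X → s i = 0) (hsY : ∀ i ∈ Y, 0 < s i) {x : F}
    (hx : x - comb u s ∈ P) : ∃ r : ℝ, 0 < r ∧
    fanSet P u 𝒳 ∩ ball x r = fanSet (starSpace P u Y) u (ConeStrata.star 𝒳 Y) ∩ ball x r := by
  obtain ⟨K, hK0, hK⟩ := h.exists_bound
  obtain ⟨c, hc, hcY⟩ : ∃ c : ℝ, 0 < c ∧ ∀ i ∈ Y, c ≤ s i := by
    rcases Y.eq_empty_or_nonempty with rfl | hne
    · exact ⟨1, one_pos, by simp⟩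
    · obtain ⟨i, hi, hmin⟩ := (toFinite Y).exists_minimalFor s Y hne
      refine ⟨s i, hsY i hi, fun j hj => ?_⟩
      rcases le_total (s i) (s j) with h | h
      exacts [h, hmin hj h]
  refine ⟨c / K, by positivity, inter_ball_eq hK hK0 hX hY hs hs' hx fun i hi => ?_⟩
  rw [mul_div_cancel₀ _ hK0.ne']
  exact hcY i hi

theorem isClosed_fanSet (h : IsFan P u 𝒳 k) : IsClosed (fanSet P u 𝒳) := by
  have heq : fanSet P u 𝒳 = ⋃ X ∈ 𝒳, {x | ∃ a : ι → ℝ, (∀ i, 0 ≤ a i) ∧ (∀ i, i ∉ X → a i = 0) ∧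
      x - comb u a ∈ P} := by
    ext x
    simp only [mem_iUnion, exists_prop]
    rfl
  rw [heq]
  refine (toFinite 𝒳).isClosed_biUnion fun X hX => ?_
  let A : Submodule ℝ (ι → ℝ) :=
    { carrier := {a | ∀ i, i ∉ X → a i = 0}
      add_mem' := fun {a b} ha hb i hi => by simp [ha i hi, hb i hi]
      zero_mem' := by simp
      smul_mem' := fun c a ha i hi => by simp [ha i hi] }
  let f : (A × P) →ₗ[ℝ] F := ((comb u).comp A.subtype).coprod P.subtype
  have hf : LinearMap.ker f = ⊥ := by
    rw [LinearMap.ker_eq_bot']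
    rintro ⟨⟨a, ha⟩, p, hp⟩ hap
    have h1 : comb u a + p = 0 := hap
    have h2 : a = 0 := h.coeff_zero hX ha (by
      rw [eq_neg_of_add_eq_zero_left h1]; exact P.neg_mem hp)
    subst h2
    have h3 : p = 0 := by simpa using h1
    subst h3
    rfl
  have hcl := (LinearMap.isClosedEmbedding_of_injective hf).isClosedMap
    {x : A × P | ∀ i, 0 ≤ (x.1 : ι → ℝ) i} (by
      simp only [ofPred_forall]
      exact isClosed_iInter fun i => isClosed_le continuous_const
        ((continuous_apply i).comp (continuous_subtype_val.comp continuous_fst)))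
  convert hcl using 1
  ext x
  constructor
  · rintro ⟨a, ha, ha', hx⟩
    exact ⟨(⟨a, ha'⟩, ⟨_, hx⟩), ha, by simp [f]⟩
  · rintro ⟨⟨⟨a, ha'⟩, p, hp⟩, ha, rfl⟩
    exact ⟨a, ha, ha', by simpa [f] using hp⟩

end IsFan
end Fan

/-! ### Global and local translation invariance -/

section Lineality
variable {F : Type*} [NormedAddCommGroup F] [InnerProductSpace ℝ F]

/-- The vectors along which a set is invariant under translations. -/
def lineality (A : Set F) : Submodule ℝ F where
  carrier := {v | ∀ x ∈ A, ∀ s : ℝ, x + s • v ∈ A}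
  add_mem' := fun {v w} hv hw x hx s => by
    rw [smul_add, ← add_assoc]; exact hw _ (hv x hx s) s
  zero_mem' := fun x hx s => by simpa using hx
  smul_mem' := fun c v hv x hx s => by rw [smul_smul]; exact hv x hx _

/-- The vectors along which a set is invariant near a point. -/
def localLineality (A : Set F) (x : F) : Submodule ℝ F where
  carrier := {v | ∃ r : ℝ, 0 < r ∧ ∀ y ∈ A ∩ ball x r, ∀ s : ℝ, |s| < r → y + s • v ∈ A}
  add_mem' := by
    rintro v w ⟨r, hr, hv⟩ ⟨q, hq, hw⟩
    have h0 : 0 < 1 + ‖v‖ := by positivity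
    -- Small enough that the displacement along `v` ends in the ball of radius `q` where `w` acts.
    refine ⟨min r (q / (1 + ‖v‖)), by positivity, fun y hy s hs => ?_⟩
    have hy1 : dist y x < r := (mem_ball.1 hy.2).trans_le (min_le_left _ _)
    have hy2 : dist y x < q / (1 + ‖v‖) := (mem_ball.1 hy.2).trans_le (min_le_right _ _)
    have hs1 := hs.trans_le (min_le_left _ _)
    have hs2 := hs.trans_le (min_le_right _ _)
    rw [smul_add, ← add_assoc]
    refine hw _ ⟨hv y ⟨hy.1, hy1⟩ s hs1, ?_⟩ s (hs2.trans_le (div_le_self hq.le ?_))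
    · rw [mem_ball]
      calc dist (y + s • v) x ≤ dist y x + ‖s • v‖ := by
            rw [dist_eq_norm, dist_eq_norm, add_sub_right_comm]; exact norm_add_le _ _
        _ = dist y x + |s| * ‖v‖ := by rw [norm_smul, Real.norm_eq_abs]
        _ < q / (1 + ‖v‖) + q / (1 + ‖v‖) * ‖v‖ :=
            add_lt_add_of_lt_of_le hy2 (mul_le_mul_of_nonneg_right hs2.le (norm_nonneg _))
        _ = q := by field_simp
    · linarith [norm_nonneg v]
  zero_mem' := ⟨1, one_pos, fun y hy s _ => by simpa using hy.1⟩
  smul_mem' := by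
    rintro c v ⟨r, hr, hv⟩
    have h0 : 0 < 1 + |c| := by positivity
    refine ⟨r / (1 + |c|), by positivity, fun y hy s hs => ?_⟩
    rw [smul_smul]
    refine hv y ⟨hy.1, (mem_ball.1 hy.2).trans_le (div_le_self hr.le ?_)⟩ _ ?_
    · linarith [abs_nonneg c]
    · rw [abs_mul]
      rw [lt_div_iff₀ h0] at hs
      nlinarith [abs_nonneg c, abs_nonneg s]

/-- The dimension of the space of local translation invariance. -/
noncomputable def localRank (A : Set F) (x : F) : ℕ := Module.finrank ℝ (localLineality A x)

theorem localLineality_le_of_inter_ball {A B : Set F} {x : F} {r : ℝ} (hr : 0 < r)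
    (h : A ∩ ball x r = B ∩ ball x r) : localLineality A x ≤ localLineality B x := by
  rintro v ⟨q, hq, hv⟩
  have h0 : 0 < 1 + ‖v‖ := by positivity
  refine ⟨min q (r / (1 + ‖v‖)), by positivity, fun y hy s hs => ?_⟩
  have hy1 : dist y x < q := (mem_ball.1 hy.2).trans_le (min_le_left _ _)
  have hy2 : dist y x < r / (1 + ‖v‖) := (mem_ball.1 hy.2).trans_le (min_le_right _ _)
  have hs1 := hs.trans_le (min_le_left _ _)
  have hs2 := hs.trans_le (min_le_right _ _)
  have hyr : y ∈ ball x r := hy2.trans_le (div_le_self hr.le (by linarith [norm_nonneg v]))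
  have hyA : y ∈ A := (h.symm.subset ⟨hy.1, hyr⟩).1
  refine (h.subset ⟨hv y ⟨hyA, hy1⟩ s hs1, ?_⟩).1
  rw [mem_ball]
  calc dist (y + s • v) x ≤ dist y x + ‖s • v‖ := by
        rw [dist_eq_norm, dist_eq_norm, add_sub_right_comm]; exact norm_add_le _ _
    _ = dist y x + |s| * ‖v‖ := by rw [norm_smul, Real.norm_eq_abs]
    _ < r / (1 + ‖v‖) + r / (1 + ‖v‖) * ‖v‖ :=
        add_lt_add_of_lt_of_le hy2 (mul_le_mul_of_nonneg_right hs2.le (norm_nonneg _))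
    _ = r := by field_simp

theorem localLineality_congr {A B : Set F} {x : F} {r : ℝ} (hr : 0 < r)
    (h : A ∩ ball x r = B ∩ ball x r) : localLineality A x = localLineality B x :=
  le_antisymm (localLineality_le_of_inter_ball hr h) (localLineality_le_of_inter_ball hr h.symm)

theorem localRank_congr {A B : Set F} {x : F} {r : ℝ} (hr : 0 < r)
    (h : A ∩ ball x r = B ∩ ball x r) : localRank A x = localRank B x := by
  rw [localRank, localRank, localLineality_congr hr h]

/-- The linear part of an isometry. -/
noncomputable def linPart (R : F ≃ᵢ F) : F ≃ₗᵢ[ℝ] F :=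
  R.toRealAffineIsometryEquiv.linearIsometryEquiv

theorem isometry_add (R : F ≃ᵢ F) (x v : F) : R (x + v) = R x + linPart R v := by
  have := R.toRealAffineIsometryEquiv.map_vadd x v
  simp only [vadd_eq_add, IsometryEquiv.coeFn_toRealAffineIsometryEquiv] at this
  rw [add_comm x, this, add_comm]
  rfl

theorem isometry_sub (R : F ≃ᵢ F) (x y : F) : R x - R y = linPart R (x - y) := by
  rw [sub_eq_iff_eq_add', ← isometry_add]; simp

theorem map_linPart_localLineality_le (R : F ≃ᵢ F) (A : Set F) (x : F) :
    (localLineality A x).map (linPart R).toLinearEquiv.toLinearMap ≤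
      localLineality (R '' A) (R x) := by
  rintro _ ⟨v, ⟨r, hr, hv⟩, rfl⟩
  refine ⟨r, hr, ?_⟩
  rintro _ ⟨⟨y, hy, rfl⟩, hyx⟩ s hs
  rw [mem_ball, R.dist_eq] at hyx
  refine ⟨y + s • v, hv y ⟨hy, hyx⟩ s hs, ?_⟩
  rw [isometry_add, map_smul]
  rfl

theorem localRank_le_image [FiniteDimensional ℝ F] (R : F ≃ᵢ F) (A : Set F) (x : F) :
    localRank A x ≤ localRank (R '' A) (R x) := by
  have h := Submodule.finrank_mono (map_linPart_localLineality_le R A x)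
  rw [LinearEquiv.finrank_map_eq] at h
  exact h

theorem localRank_image [FiniteDimensional ℝ F] (R : F ≃ᵢ F) (A : Set F) (x : F) :
    localRank (R '' A) (R x) = localRank A x := by
  refine le_antisymm ?_ (localRank_le_image R A x)
  have := localRank_le_image R.symm (R '' A) (R x)
  rwa [R.symm_apply_apply, ← image_comp, R.symm_comp_self, image_id] at this

end Lineality

/-! ### Lineality space and local rank of a non-flat fan -/

section Fan
variable {ι F : Type*} [Fintype ι] [NormedAddCommGroup F] [InnerProductSpace ℝ F]
  [FiniteDimensional ℝ F]

namespace IsFan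
variable {P : Submodule ℝ F} {u : ι → F} {𝒳 : Set (Set ι)} {k : ℕ}

/-- Adding `v` to a small multiple of a point leads into the ball around `v` where the fan is the
star of the carrier of `v`. As the fan is invariant along `v`, it is globally equal to that star. -/
theorem starSpace_le_lineality (h : IsFan P u 𝒳 k) {X : Set ι} (hX : X ∈ 𝒳) {a : ι → ℝ}
    (ha : ∀ i, 0 ≤ a i) (ha' : ∀ i, i ∉ X → a i = 0) {v : F} (hva : v - comb u a ∈ P)
    (hv : v ∈ lineality (fanSet P u 𝒳)) :
    starSpace P u {i | 0 < a i} ≤ lineality (fanSet P u 𝒳) := by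
  have hY : {i | 0 < a i} ⊆ X := fun i hi => by
    by_contra hi'
    exact (ha' i hi').not_gt hi
  obtain ⟨r, hr, hball⟩ := h.exists_ball hX hY ha ha' (fun i hi => hi) hva
  have hvS : v ∈ starSpace P u {i | 0 < a i} := by
    refine mem_starSpace.2 ⟨a, fun i hi => le_antisymm (not_lt.1 hi) (ha i), hva⟩
  have hscale : ∀ x : F, ∃ t : ℝ, 0 < t ∧ t • x + v ∈ ball v r := by
    intro x
    refine ⟨r / (1 + ‖x‖), by positivity, ?_⟩
    rw [mem_ball, dist_eq_norm, add_sub_cancel_right, norm_smul, Real.norm_of_nonneg (by positivity),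
      div_mul_eq_mul_div, div_lt_iff₀ (by positivity)]
    nlinarith
  have heq : fanSet P u 𝒳 =
      fanSet (starSpace P u {i | 0 < a i}) u (ConeStrata.star 𝒳 {i | 0 < a i}) := by
    ext x
    obtain ⟨t, ht, htx⟩ := hscale x
    constructor
    · intro hx
      have h1 : t • x + v ∈ fanSet P u 𝒳 := by
        simpa using hv _ (fanSet_smul_mem ht.le hx) 1
      have h2 := (fanSet_add_mem_iff hvS).1 (hball.subset ⟨h1, htx⟩).1
      simpa [smul_smul, inv_mul_cancel₀ ht.ne'] using fanSet_smul_mem (inv_nonneg.2 ht.le) h2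
    · intro hx
      have h1 := (hball.symm.subset ⟨fanSet_add_mem (fanSet_smul_mem ht.le hx) hvS, htx⟩).1
      have h2 : t • x ∈ fanSet P u 𝒳 := by
        simpa using hv _ h1 (-1)
      simpa [smul_smul, inv_mul_cancel₀ ht.ne'] using fanSet_smul_mem (inv_nonneg.2 ht.le) h2
  intro w hw x hx s
  rw [heq] at hx ⊢
  exact fanSet_add_mem hx (Submodule.smul_mem _ _ hw)

/-- A non-flat fan is invariant only under translations along its lineality space `P`. -/
theorem lineality_eq (h : IsFan P u 𝒳 k) : lineality (fanSet P u 𝒳) = P := by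
  classical
  refine le_antisymm ?_ fun p hp x hx s => fanSet_add_mem hx (P.smul_mem _ hp)
  intro v hv
  by_contra hvP
  set L := lineality (fanSet P u 𝒳) with hL
  have hLfan : ∀ w ∈ L, w ∈ fanSet P u 𝒳 := fun w hw => by
    simpa using hw 0 (zero_mem_fanSet h.nonempty) 1
  -- Faces whose generators all lie in the lineality space; a largest one will exhibit a flat pair
  -- of faces.
  let 𝒴 : Set (Set ι) := {Y | Y.Nonempty ∧ (∃ X ∈ 𝒳, Y ⊆ X) ∧ ∀ i ∈ Y, u i ∈ L}
  have h𝒴 : 𝒴.Nonempty := by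
    obtain ⟨X, hX, a, ha, ha', hva⟩ := hLfan v hv
    have hY := h.starSpace_le_lineality hX ha ha' hva hv
    refine ⟨{i | 0 < a i}, ?_, ⟨X, hX, fun i hi => ?_⟩, fun i hi => hY (vec_mem_starSpace hi)⟩
    · by_contra hne
      have ha0 : a = 0 := by
        ext i
        by_contra hi
        exact hne ⟨i, lt_of_le_of_ne (ha i) (Ne.symm hi)⟩
      rw [ha0] at hva
      exact hvP (by simpa using hva)
    · by_contra hi'
      exact (ha' i hi').not_gt hi
  obtain ⟨Y, ⟨⟨e, he⟩, ⟨X, hX, hYX⟩, hYL⟩, hmax⟩ := (toFinite 𝒴).exists_maximalFor ncard 𝒴 h𝒴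
  -- Remove one generator `e` and step from the middle of `Z` in the direction `-u e`. The result is
  -- still in `L`, hence in the fan, so the fan continues on the other side of `Z`.
  set Z := Y \ {e} with hZ
  have heZ : e ∉ Z := fun h => h.2 rfl
  have hZY : Z ⊆ Y := sdiff_subset
  let oneZ : ι → ℝ := fun i => if i ∈ Z then 1 else 0
  have hone : ∀ i, i ∉ Z → oneZ i = 0 := fun i hi => by simp [oneZ, hi]
  have hone1 : ∀ i, i ∈ Z → oneZ i = 1 := fun i hi => by simp [oneZ, hi]
  have hzL : comb u oneZ ∈ L := by
    rw [Fintype.linearCombination_apply]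
    refine L.sum_mem fun i _ => ?_
    by_cases hi : i ∈ Z
    · exact L.smul_mem _ (hYL i (hZY hi))
    · simp [hone i hi]
  obtain ⟨r, hr, hball⟩ := h.exists_ball (s := oneZ) (x := comb u oneZ) hX (hZY.trans hYX)
    (fun i => by simp only [oneZ]; split_ifs <;> norm_num)
    (fun i hi => hone i fun h => hi (hYX (hZY h))) (fun i hi => by simp [hone1 i hi]) (by simp)
  obtain ⟨s, hs, hsr⟩ : ∃ s : ℝ, 0 < s ∧ s * ‖u e‖ < r := by
    refine ⟨r / (1 + ‖u e‖), by positivity, ?_⟩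
    rw [div_mul_eq_mul_div, div_lt_iff₀ (by positivity)]
    nlinarith
  have hw : comb u oneZ - s • u e ∈ L := L.sub_mem hzL (L.smul_mem _ (hYL e he))
  have hwb : comb u oneZ - s • u e ∈ ball (comb u oneZ) r := by
    rw [mem_ball, dist_eq_norm, sub_sub_cancel_left, norm_neg, norm_smul,
      Real.norm_of_nonneg hs.le]
    exact hsr
  obtain ⟨X', hX', hZX', b, hb, hb', hbP⟩ := mem_fanSet_star.1 (hball.subset ⟨hLfan _ hw, hwb⟩).1
  -- Adding `M` times the vector `comb u oneZ` makes the coefficients on `Z` positive without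
  -- leaving `L`.
  set M : ℝ := 1 + ‖b‖ with hM
  have hM0 : 0 < M := by positivity
  set c : ι → ℝ := b + M • oneZ with hc
  have hcZ : ∀ i ∈ Z, 0 < c i := by
    intro i hi
    have h1 : |b i| ≤ ‖b‖ := norm_le_pi_norm b i
    have h2 := neg_abs_le (b i)
    simp only [hc, Pi.add_apply, Pi.smul_apply, hone1 i hi, smul_eq_mul, mul_one, hM]
    linarith
  have hc0 : ∀ i, 0 ≤ c i := by
    intro i
    by_cases hi : i ∈ Z
    · exact (hcZ i hi).le
    · simpa [hc, hone i hi] using hb i hi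
  have hcX' : ∀ i, i ∉ X' → c i = 0 := by
    intro i hi
    simp [hc, hb' i hi, hone i fun h => hi (hZX' h)]
  have hwL : comb u oneZ - s • u e + M • comb u oneZ ∈ L := L.add_mem hw (L.smul_mem _ hzL)
  have hwc : comb u oneZ - s • u e + M • comb u oneZ - comb u c ∈ P := by
    rw [hc, map_add, map_smul]
    convert hbP using 1
    abel
  have hcL := h.starSpace_le_lineality hX' hc0 hcX' hwc hwL
  let d : ι → ℝ := c - (1 + M) • oneZ + s • Pi.single e 1
  have hdP : comb u d ∈ P := by
    rw [← P.neg_mem_iff]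
    convert hwc using 1
    simp only [d, map_add, map_sub, map_smul, Fintype.linearCombination_apply_single, add_smul,
      one_smul]
    abel
  have hd : ∀ i, i ∉ Z → i ≠ e → d i = c i := fun i hi hie => by
    simp [d, hone i hi, hie]
  have hde : d e = c e + s := by simp [d, hone e heZ]
  -- Without such an `f`, `d` would be a relation inside the single cone `X` with `d e > 0`.
  obtain ⟨f, hfc, hfZ, hfe⟩ : ∃ f, 0 < c f ∧ f ∉ Z ∧ f ≠ e := by
    by_contra! hcon
    have hd0 := h.coeff_zero hX (a := d) (fun i hi => ?_) hdP
    · have : d e = 0 := by rw [hd0]; rfl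
      rw [hde] at this
      linarith [hc0 e]
    · have hie : i ≠ e := by rintro rfl; exact hi (hYX he)
      have hiZ : i ∉ Z := fun h => hi (hYX (hZY h))
      rw [hd i hiZ hie]
      refine le_antisymm (not_lt.1 fun hci => hie (hcon i hci hiZ)) (hc0 i)
  have hfX' : f ∈ X' := by
    by_contra hf
    exact hfc.ne' (hcX' f hf)
  have hsub : insert f Z ⊆ {i | 0 < c i} := insert_subset hfc hcZ
  have hcard : (insert f Z).ncard = Y.ncard := by
    rw [ncard_insert_of_notMem hfZ, hZ, ncard_sdiff_singleton_add_one he]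
  -- Maximality of `Y` forces the carrier of `c` to be `Z ∪ {f}`, so `d` is a relation excluded by
  -- `nonflat`.
  have hle : ({i | 0 < c i} : Set ι).ncard ≤ Y.ncard := by
    by_contra! hlt
    have := hmax (j := {i | 0 < c i}) ⟨⟨f, hfc⟩, ⟨X', hX', fun i hi => by
      by_contra hi'
      exact (hcX' i hi').not_gt hi⟩, fun i hi => hcL (vec_mem_starSpace hi)⟩ hlt.le
    exact this.not_gt hlt
  have hceq : insert f Z = {i | 0 < c i} :=
    eq_of_subset_of_ncard_le hsub (by rw [hcard]; exact hle) (toFinite _)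
  have hoff : ∀ i, i ∉ Z → i ≠ f → c i = 0 := by
    intro i hi hif
    have : i ∉ insert f Z := by simp [hi, hif]
    rw [hceq] at this
    exact le_antisymm (not_lt.1 this) (hc0 i)
  refine h.nonflat X hX X' hX' Z (hZY.trans hYX) hZX' e (hYX he) f hfX' heZ hfZ hfe.symm d
    (fun l hl hle hlf => ?_) ?_ ?_ hdP
  · rw [hd l hl hle, hoff l hl hlf]
  · rw [hde]
    linarith [hc0 e]
  · rwa [hd f hfZ hfe]

/-- The fan is a cone invariant under translation by `x`, so dilation makes local invariance at `x`
global, and `lineality_eq` applies. -/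
theorem localLineality_of_mem (h : IsFan P u 𝒳 k) {x : F} (hx : x ∈ P) :
    localLineality (fanSet P u 𝒳) x = P := by
  refine le_antisymm ?_ fun p hp => ⟨1, one_pos, fun y hy s _ => fanSet_add_mem hy.1
    (P.smul_mem _ hp)⟩
  rintro v ⟨r, hr, hv⟩
  rw [← h.lineality_eq]
  intro y hy s
  set t : ℝ := r / (1 + ‖y‖ + |s|) with ht
  have ht0 : 0 < t := by positivity
  have htr : t * (1 + ‖y‖ + |s|) = r := by rw [ht]; field_simp
  have h1 : t • y + x ∈ fanSet P u 𝒳 ∩ ball x r := by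
    refine ⟨fanSet_add_mem (fanSet_smul_mem ht0.le hy) hx, ?_⟩
    rw [mem_ball, dist_eq_norm, add_sub_cancel_right, norm_smul, Real.norm_of_nonneg ht0.le, ← htr]
    nlinarith [abs_nonneg s, norm_nonneg y]
  have h2 := hv _ h1 (t * s) (by
    rw [abs_mul, abs_of_pos ht0, ← htr]
    nlinarith [abs_nonneg s, norm_nonneg y])
  have h3 : t • (y + s • v) ∈ fanSet P u 𝒳 := by
    rw [← fanSet_add_mem_iff hx]
    convert h2 using 1
    rw [smul_add, smul_smul]; abel
  have h4 := fanSet_smul_mem (inv_nonneg.2 ht0.le) h3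
  rwa [smul_smul, inv_mul_cancel₀ ht0.ne', one_smul] at h4

theorem finrank_starSpace (h : IsFan P u 𝒳 k) {X Y : Set ι} (hX : X ∈ 𝒳) (hY : Y ⊆ X) :
    Module.finrank ℝ (starSpace P u Y) = Module.finrank ℝ P + Y.ncard := by
  classical
  have hinf : P ⊓ Submodule.span ℝ (u '' Y) = ⊥ := by
    rw [Submodule.eq_bot_iff]
    rintro x ⟨hxP, hx⟩
    obtain ⟨b, hb, rfl⟩ := mem_span_image_iff_comb.1 hx
    rw [h.coeff_zero hX (fun i hi => hb i fun h => hi (hY h)) hxP, map_zero]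
  have hli : LinearIndependent ℝ (fun i : Y => u i) := by
    rw [Fintype.linearIndependent_iff]
    intro g hg i
    have := h.coeff_zero hX (a := fun i => if hi : i ∈ Y then g ⟨i, hi⟩ else 0)
      (fun i hi => dif_neg fun h => hi (hY h)) (by
        rw [Fintype.linearCombination_apply]
        have : ∑ i, (if hi : i ∈ Y then g ⟨i, hi⟩ else 0) • u i = ∑ i : Y, g i • u i := by
          rw [← Finset.sum_subset (Finset.subset_univ Y.toFinset)]
          · rw [← Finset.sum_coe_sort]
            refine Fintype.sum_equiv (Equiv.subtypeEquivRight fun i => by simp) _ _ ?_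
            rintro ⟨i, hi⟩
            have hi' : i ∈ Y := by simpa using hi
            simp only [hi', dif_pos]
            rfl
          · intro i _ hi
            have hi' : i ∉ Y := by simpa using hi
            simp [hi']
        rw [this, hg]
        exact P.zero_mem)
    have := congrFun this i
    simpa using this
  have hfin := Submodule.finrank_sup_add_finrank_inf_eq P (Submodule.span ℝ (u '' Y))
  rw [hinf, finrank_bot, add_zero] at hfin
  rw [starSpace, hfin, image_eq_range, finrank_span_eq_card hli, Nat.card_coe_set_eq Y |>.symm,
    Nat.card_eq_fintype_card]

/-- Near `x` the fan is the star of the carrier of `x`, and `x` lies in the lineality space of this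
star. -/
theorem localRank_eq (h : IsFan P u 𝒳 k) {X : Set ι} (hX : X ∈ 𝒳) {a : ι → ℝ}
    (ha : ∀ i, 0 ≤ a i) (ha' : ∀ i, i ∉ X → a i = 0) {x : F} (hx : x - comb u a ∈ P) :
    localRank (fanSet P u 𝒳) x = Module.finrank ℝ P + ({i | 0 < a i} : Set ι).ncard := by
  have hY : {i | 0 < a i} ⊆ X := fun i hi => by
    by_contra hi'
    exact (ha' i hi').not_gt hi
  obtain ⟨r, hr, hball⟩ := h.exists_ball hX hY ha ha' (fun i hi => hi) hx
  rw [localRank, localLineality_congr hr hball, (h.star hX hY).localLineality_of_mem,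
    h.finrank_starSpace hX hY]
  exact mem_starSpace.2 ⟨a, fun i hi => le_antisymm (not_lt.1 hi) (ha i), hx⟩

theorem le_localRank (h : IsFan P u 𝒳 k) {x : F} (hx : x ∈ fanSet P u 𝒳) :
    Module.finrank ℝ P ≤ localRank (fanSet P u 𝒳) x := by
  obtain ⟨X, hX, a, ha, ha', hx⟩ := hx
  rw [h.localRank_eq hX ha ha' hx]
  exact Nat.le_add_right _ _

theorem localRank_zero (h : IsFan P u 𝒳 k) :
    localRank (fanSet P u 𝒳) 0 = Module.finrank ℝ P := by
  rw [localRank, h.localLineality_of_mem P.zero_mem]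

end IsFan
end Fan

/-! ### Fans versus complex cones -/

section Bridge
variable {ι : Type*} [Fintype ι] {d : ℕ}

theorem linearIndepOn_iff_comb {F : Type*} [NormedAddCommGroup F] [InnerProductSpace ℝ F]
    {v : ι → F} {Z : Set ι} :
    LinearIndepOn ℝ v Z ↔ ∀ a : ι → ℝ, (∀ i, i ∉ Z → a i = 0) → comb v a = 0 → a = 0 := by
  have hcomb : ∀ l : ι →₀ ℝ, Finsupp.linearCombination ℝ v l = comb v l := fun l => by
    rw [Finsupp.linearCombination_apply, Finsupp.sum_fintype _ _ (by simp),
      Fintype.linearCombination_apply]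
  rw [linearIndepOn_iff]
  constructor
  · intro h a ha h0
    have := h (Finsupp.equivFunOnFinite.symm a) (by
      rw [Finsupp.mem_supported']
      exact ha) (by
      rw [← h0, hcomb]
      rfl)
    ext i
    simpa using DFunLike.congr_fun this i
  · intro h l hl h0
    rw [Finsupp.mem_supported'] at hl
    have := h l hl (by
      rw [← h0, hcomb])
    ext i
    simpa using congrFun this i

theorem mem_coneOver_image {v : ι → Euc d} {Z : Set ι} {y : Euc d} :
    y ∈ coneOver (v '' Z) ↔
      ∃ a : ι → ℝ, (∀ i, 0 ≤ a i) ∧ (∀ i, i ∉ Z → a i = 0) ∧ y = comb v a := by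
  classical
  constructor
  · rintro (rfl | ⟨t, ht, p, hp, rfl⟩)
    · exact ⟨0, by simp, by simp, by simp⟩
    · have hsub : convexHull ℝ (v '' Z) ⊆ {y | ∃ a : ι → ℝ, (∀ i, 0 ≤ a i) ∧
          (∀ i, i ∉ Z → a i = 0) ∧ y = comb v a} := by
        refine convexHull_min ?_ ?_
        · rintro _ ⟨i, hi, rfl⟩
          refine ⟨Pi.single i 1, fun j => ?_, fun j hj => ?_, by simp⟩
          · by_cases h : j = i
            · subst h; simp
            · simp [h]
          · have : j ≠ i := by rintro rfl; exact hj hi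
            simp [this]
        · rintro _ ⟨a, ha, ha', rfl⟩ _ ⟨b, hb, hb', rfl⟩ s t hs ht _
          refine ⟨s • a + t • b, fun i => ?_, fun i hi => by simp [ha' i hi, hb' i hi], ?_⟩
          · exact add_nonneg (mul_nonneg hs (ha i)) (mul_nonneg ht (hb i))
          · rw [map_add, map_smul, map_smul]
      obtain ⟨a, ha, ha', rfl⟩ := hsub hp
      exact ⟨t • a, fun i => mul_nonneg ht (ha i), fun i hi => by simp [ha' i hi],
        by rw [map_smul]⟩
  · rintro ⟨a, ha, ha', rfl⟩
    rcases (Finset.sum_nonneg fun i (_ : i ∈ Finset.univ) => ha i).eq_or_lt with h0 | hpos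
    · have : a = 0 := by
        ext i
        exact (Finset.sum_eq_zero_iff_of_nonneg fun i _ => ha i).1 h0.symm i (Finset.mem_univ i)
      rw [this, map_zero]
      exact Or.inl rfl
    · refine Or.inr ⟨∑ i, a i, hpos.le, ∑ i ∈ Z.toFinset, (a i / ∑ i, a i) • v i, ?_, ?_⟩
      · refine (convex_convexHull ℝ _).sum_mem (fun i _ => div_nonneg (ha i) hpos.le) ?_
          fun i hi => subset_convexHull ℝ _ ⟨i, by simpa using hi, rfl⟩
        rw [← Finset.sum_div, div_eq_one_iff_eq hpos.ne']
        exact Finset.sum_subset (Finset.subset_univ _) fun i _ hi => ha' i (by simpa using hi)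
      · rw [Finset.smul_sum, Fintype.linearCombination_apply]
        rw [← Finset.sum_subset (Finset.subset_univ Z.toFinset)]
        · refine Finset.sum_congr rfl fun i _ => ?_
          rw [smul_smul, mul_div_cancel₀ _ hpos.ne']
        · intro i _ hi
          rw [ha' i (by simpa using hi), zero_smul]

theorem coneOver_subset_span {v : ι → Euc d} {Z : Set ι} :
    coneOver (v '' Z) ⊆ Submodule.span ℝ (v '' Z) := by
  intro y hy
  obtain ⟨a, _, ha, rfl⟩ := mem_coneOver_image.1 hy
  exact mem_span_image_iff_comb.2 ⟨a, ha, rfl⟩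

theorem isSimpleGen_image {v : ι → Euc d} {Z : Set ι} {k : ℕ} (hv : InjOn v Z) :
    IsSimpleGen k (v '' Z) ↔ (∀ i ∈ Z, ‖v i‖ = 1) ∧ Z.ncard = k ∧
      ∀ a : ι → ℝ, (∀ i, i ∉ Z → a i = 0) → comb v a = 0 → a = 0 := by
  rw [← linearIndepOn_iff_comb, linearIndepOn_iff_image hv, IsSimpleGen, hv.encard_image]
  have h1 : v '' Z ⊆ sphere 0 1 ↔ ∀ i ∈ Z, ‖v i‖ = 1 := by
    rw [image_subset_iff]
    simp [subset_def]
  have h2 : Z.encard = (k : ℕ∞) ↔ Z.ncard = k := by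
    rw [← (toFinite Z).cast_ncard_eq]
    exact Nat.cast_inj
  rw [h1, h2]
  refine and_congr_right fun hn => and_congr_right fun _ => ?_
  have h0 : ∀ w ∈ v '' Z, w ≠ 0 := by
    rintro _ ⟨i, hi, rfl⟩ h
    have := hn i hi
    simp [h] at this
  have h3 := linearIndependent_set_iff_affineIndependent_vadd_union_singleton ℝ h0 (0 : Euc d)
  have h4 : (fun w : Euc d => w +ᵥ (0 : Euc d)) '' (v '' Z) = v '' Z := by simp
  rw [h4, singleton_union] at h3
  exact h3.symm

/-- The foot point `z` can be moved within the cone along `v g`, but possibly not along `-v g`;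
hence an inequality instead of orthogonality. -/
theorem inner_sub_nonpos {v : ι → Euc d} {Z : Set ι} {f z : Euc d}
    (hz : z ∈ coneOver (v '' Z)) (hd : infDist f (coneOver (v '' Z)) = dist f z) {g : ι}
    (hg : g ∈ Z) : inner ℝ (f - z) (v g) ≤ 0 := by
  obtain ⟨c, hc, hc', hzc⟩ := mem_coneOver_image.1 hz
  by_contra! hin
  obtain ⟨s, hs, hs2⟩ : ∃ s : ℝ, 0 < s ∧ s * ‖v g‖ ^ 2 < 2 * inner ℝ (f - z) (v g) := by
    refine ⟨inner ℝ (f - z) (v g) / (1 + ‖v g‖ ^ 2), by positivity, ?_⟩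
    rw [div_mul_eq_mul_div, div_lt_iff₀ (by positivity)]
    nlinarith [sq_nonneg ‖v g‖]
  have hmem : z + s • v g ∈ coneOver (v '' Z) := by
    classical
    refine mem_coneOver_image.2 ⟨c + s • Pi.single g 1, fun l => ?_, fun l hl => ?_, ?_⟩
    · refine add_nonneg (hc l) (mul_nonneg hs.le ?_)
      by_cases h : l = g
      · subst h; simp
      · simp [h]
    · have : l ≠ g := by rintro rfl; exact hl hg
      simp [hc' l hl, this]
    · rw [map_add, map_smul, ← hzc, Fintype.linearCombination_apply_single, one_smul]
  have h1 := infDist_le_dist_of_mem (x := f) hmem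
  rw [hd, dist_eq_norm, dist_eq_norm, ← sub_sub] at h1
  have h2 := pow_le_pow_left₀ (norm_nonneg _) h1 2
  rw [norm_sub_sq_real (f - z) (s • v g), real_inner_smul_right, norm_smul,
    Real.norm_of_nonneg hs.le] at h2
  nlinarith

namespace IsFan

/-- Serves to change the ambient space and the lengths of the generators: relations only have to be
pulled back, and positive weights preserve signs. -/
theorem transfer {F F' : Type*} [NormedAddCommGroup F] [InnerProductSpace ℝ F]
    [NormedAddCommGroup F'] [InnerProductSpace ℝ F'] {P : Submodule ℝ F} {P' : Submodule ℝ F'}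
    {u : ι → F} {u' : ι → F'} {𝒳 : Set (Set ι)} {k : ℕ} (h : IsFan P u 𝒳 k) (c : ι → ℝ)
    (hc : ∀ i, 0 < c i) (hu : ∀ a : ι → ℝ, (∀ i, i ∉ ⋃₀ 𝒳 → a i = 0) → comb u' a ∈ P' →
      comb u (c * a) ∈ P) : IsFan P' u' 𝒳 k where
  nonempty := h.nonempty
  card := h.card
  indep := by
    intro X hX X' hX' a ha ha' hP
    have h1 := h.indep X hX X' hX' (c * a) (fun i hi => mul_nonneg (hc i).le (ha i hi))
      (fun i hi => mul_nonpos_of_nonneg_of_nonpos (hc i).le (ha' i hi)) (hu a (fun i hi => ?_) hP)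
    · ext i
      have := congrFun h1 i
      simpa [(hc i).ne'] using this
    · exact le_antisymm (ha' i fun h => hi ⟨X, hX, h⟩) (ha i fun h => hi ⟨X', hX', h⟩)
  nonflat := by
    intro X hX X' hX' Z hZ hZ' i hi j hj hiZ hjZ hij a ha hai haj hP
    refine h.nonflat X hX X' hX' Z hZ hZ' i hi j hj hiZ hjZ hij (c * a) (fun l hl hli hlj => ?_)
      (mul_pos (hc i) hai) (mul_pos (hc j) haj) (hu a (fun l hl => ?_) hP)
    · simp [ha l hl hli hlj]
    · refine ha l (fun h => hl ⟨X, hX, hZ h⟩) ?_ ?_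
      · rintro rfl; exact hl ⟨X, hX, hi⟩
      · rintro rfl; exact hl ⟨X', hX', hj⟩

theorem injOn {F : Type*} [NormedAddCommGroup F] [InnerProductSpace ℝ F] {P : Submodule ℝ F}
    {u : ι → F} {𝒳 : Set (Set ι)} {k : ℕ} (h : IsFan P u 𝒳 k) : InjOn u (⋃₀ 𝒳) := by
  classical
  rintro i ⟨X, hX, hi⟩ j ⟨X', hX', hj⟩ hij
  by_contra hne
  have := h.indep X hX X' hX' (Pi.single i 1 - Pi.single j 1) (fun l hl => ?_) (fun l hl => ?_)
    (by simp [map_sub, hij])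
  · have := congrFun this i
    simp [hne] at this
  · have : l ≠ j := by rintro rfl; exact hl hj
    by_cases h : l = i
    · subst h; simp [this]
    · simp [this, h]
  · have : l ≠ i := by rintro rfl; exact hl hi
    by_cases h : l = j
    · subst h; simp [this]
    · simp [this, h]

/-- One cone regarded as a fan; `nonFlat` takes its star to obtain closedness. -/
theorem face {F : Type*} [NormedAddCommGroup F] [InnerProductSpace ℝ F] {P : Submodule ℝ F}
    {u : ι → F} {𝒳 : Set (Set ι)} {k : ℕ} (h : IsFan P u 𝒳 k) {X A : Set ι} (hX : X ∈ 𝒳)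
    (hA : A ⊆ X) : IsFan P u {A} A.ncard where
  nonempty := singleton_nonempty A
  card := by rintro _ rfl; rfl
  indep := by
    rintro _ rfl _ rfl a ha ha' hP
    exact h.indep X hX X hX a (fun i hi => ha i fun h => hi (hA h))
      (fun i hi => ha' i fun h => hi (hA h)) hP
  nonflat := by
    rintro _ rfl _ rfl Z hZ _ i hi j hj
    exact h.nonflat X hX X hX Z (hZ.trans hA) (hZ.trans hA) i (hA hi) j (hA hj)

theorem isComplexCone {v : ι → Euc d} {𝒳 : Set (Set ι)} {k : ℕ} (h : IsFan ⊥ v 𝒳 k)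
    (hv : ∀ i ∈ ⋃₀ 𝒳, ‖v i‖ = 1) : IsComplexCone k (image v '' 𝒳) := by
  refine ⟨(toFinite 𝒳).image _, h.nonempty.image _, ?_, ?_⟩
  · rintro _ ⟨X, hX, rfl⟩
    rw [isSimpleGen_image (h.injOn.mono (subset_sUnion_of_mem hX))]
    exact ⟨fun i hi => hv i ⟨X, hX, hi⟩, h.card X hX, fun a ha h0 => h.coeff_zero hX ha h0⟩
  · rintro _ ⟨_, ⟨X, hX, rfl⟩, hA⟩ _ ⟨_, ⟨X', hX', rfl⟩, hB⟩
    obtain ⟨A, hAX, rfl⟩ := subset_image_iff.1 hA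
    obtain ⟨B, hBX, rfl⟩ := subset_image_iff.1 hB
    rw [← h.injOn.image_inter (hAX.trans (subset_sUnion_of_mem hX))
      (hBX.trans (subset_sUnion_of_mem hX'))]
    ext y
    simp only [mem_inter_iff, mem_coneOver_image]
    constructor
    · rintro ⟨⟨a, ha, ha', rfl⟩, b, hb, hb', hab⟩
      have h0 := h.indep X hX X' hX' (a - b) (fun i hi => ?_) (fun i hi => ?_)
        (by rw [map_sub, hab, sub_self]; exact Submodule.zero_mem _)
      · have : a = b := sub_eq_zero.1 h0
        refine ⟨a, ha, fun i hi => ?_, rfl⟩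
        by_cases hiA : i ∈ A
        · rw [this]; exact hb' i fun h => hi ⟨hiA, h⟩
        · exact ha' i hiA
      · simpa [hb' i fun h => hi (hBX h)] using ha i
      · simpa [ha' i fun h => hi (hAX h)] using hb i
    · rintro ⟨a, ha, ha', rfl⟩
      exact ⟨⟨a, ha, fun i hi => ha' i fun h => hi h.1, rfl⟩,
        ⟨a, ha, fun i hi => ha' i fun h => hi h.2, rfl⟩⟩

-- The angle bound must be uniform over all foot points. The normalized differences `f - z` lie in
-- compact sets `T`, so a maximal angle bounds the supremum. Angle `π` would make both vectors
-- orthogonal to the common face and give a relation excluded by `nonflat`.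
set_option maxHeartbeats 400000 in
open InnerProductGeometry in
theorem nonFlat {v : ι → Euc d} {𝒳 : Set (Set ι)} {k : ℕ} (h : IsFan ⊥ v 𝒳 k) :
    NonFlat k (image v '' 𝒳) := by
  rintro t ht _ ⟨_, ⟨X, hX, rfl⟩, hA⟩ _ ⟨_, ⟨X', hX', rfl⟩, hB⟩
  obtain ⟨A, hAX, rfl⟩ := subset_image_iff.1 hA
  obtain ⟨B, hBX, rfl⟩ := subset_image_iff.1 hB
  have hAU := hAX.trans (subset_sUnion_of_mem hX)
  have hBU := hBX.trans (subset_sUnion_of_mem hX')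
  intro hC hAc hBc
  rw [← h.injOn.image_inter hAU hBU, (h.injOn.mono (inter_subset_left.trans hAU)).encard_image,
    ← (toFinite _).cast_ncard_eq, Nat.cast_inj] at hC
  rw [(h.injOn.mono hAU).encard_image, ← (toFinite _).cast_ncard_eq, Nat.cast_inj] at hAc
  rw [(h.injOn.mono hBU).encard_image, ← (toFinite _).cast_ncard_eq, Nat.cast_inj] at hBc
  rw [angleSet, ← h.injOn.image_inter hAU hBU]
  set C := A ∩ B with hCdef
  have hex : ∀ A' : Set ι, C ⊆ A' → A'.ncard = t + 1 → ∃ i, i ∉ C ∧ A' = insert i C := by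
    intro A' hCA hcard
    obtain ⟨i, hi⟩ : ∃ i, A' \ C = {i} := by
      rw [← ncard_eq_one, ncard_sdiff hCA, hcard, hC]; simp
    have hi' : i ∈ A' \ C := by rw [hi]; rfl
    refine ⟨i, hi'.2, ?_⟩
    rw [insert_eq, ← hi, sdiff_union_of_subset hCA]
  obtain ⟨i, hiC, hAi⟩ := hex A inter_subset_left hAc
  obtain ⟨j, hjC, hBj⟩ := hex B inter_subset_right hBc
  have hiA : i ∈ A := by rw [hAi]; exact mem_insert _ _
  have hjB : j ∈ B := by rw [hBj]; exact mem_insert _ _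
  have hij : i ≠ j := by
    rintro rfl
    exact hiC ⟨hiA, hjB⟩
  let T : Set ι → Set (Euc d) := fun A' =>
    fanSet (starSpace ⊥ v C) v (ConeStrata.star {A'} C) ∩
      {p | ∀ g ∈ C, inner ℝ p (v g) ≤ 0} ∩ sphere 0 1
  have hmemT : ∀ A' : Set ι, C ⊆ A' → ∀ p ∈ T A', ∃ a : ι → ℝ, (∀ l, l ∉ C → 0 ≤ a l) ∧
      (∀ l, l ∉ A' → a l = 0) ∧ p = comb v a := by
    rintro A' _ p ⟨⟨hp, _⟩, _⟩
    obtain ⟨_, rfl, _, a, ha, ha', hpa⟩ := mem_fanSet_star.1 hp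
    exact ⟨a, ha, ha', by simpa [sub_eq_zero] using hpa⟩
  have hTc : ∀ A' : Set ι, C ⊆ A' → (∃ X ∈ 𝒳, A' ⊆ X) → IsCompact (T A') := by
    rintro A' hCA ⟨X, hX, hAX⟩
    refine (isCompact_sphere 0 1).inter_left (IsClosed.inter ?_ ?_)
    · exact ((h.face hX hAX).star (mem_singleton A') hCA).isClosed_fanSet
    · simp only [ofPred_forall]
      exact isClosed_iInter fun g => isClosed_iInter fun _ => isClosed_le (by fun_prop)
        continuous_const
  have hcomp : IsCompact (T A ×ˢ T B) :=
    (hTc A inter_subset_left ⟨X, hX, hAX⟩).prod (hTc B inter_subset_right ⟨X', hX', hBX⟩)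
  have hself : ∀ p : Euc d, (∀ g ∈ C, inner ℝ p (v g) = 0) → ∀ a : ι → ℝ,
      (∀ l, l ∉ C → a l = 0) → p = comb v a → p = 0 := by
    intro p hp a ha hpa
    rw [← inner_self_eq_zero (𝕜 := ℝ)]
    nth_rewrite 2 [hpa]
    rw [Fintype.linearCombination_apply, inner_sum]
    refine Finset.sum_eq_zero fun l _ => ?_
    rw [inner_smul_right]
    by_cases hl : l ∈ C
    · rw [hp l hl, mul_zero]
    · rw [ha l hl, zero_mul]
  have hlt : ∀ p ∈ T A, ∀ q ∈ T B, angle p q < Real.pi := by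
    intro p hp q hq
    refine lt_of_le_of_ne (angle_le_pi p q) fun hpi => ?_
    obtain ⟨hp0, r, hr, hqr⟩ := angle_eq_pi_iff.1 hpi
    have hq0 : q ≠ 0 := by
      have := hq.2
      rintro rfl
      simp at this
    -- Opposite vectors have inner products of opposite sign with `v g`, and both are nonpositive.
    have hperp : ∀ g ∈ C, inner ℝ p (v g) = 0 := by
      intro g hg
      have h1 := hp.1.2 g hg
      have h2 := hq.1.2 g hg
      rw [hqr, real_inner_smul_left] at h2
      exact le_antisymm h1 (by nlinarith)
    have hperp' : ∀ g ∈ C, inner ℝ q (v g) = 0 := by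
      intro g hg
      rw [hqr, real_inner_smul_left, hperp g hg, mul_zero]
    obtain ⟨a, ha, ha', hpa⟩ := hmemT A inter_subset_left p hp
    obtain ⟨b, hb, hb', hqb⟩ := hmemT B inter_subset_right q hq
    have hoffA : ∀ l, l ∉ C → l ≠ i → a l = 0 := fun l hl hli => ha' l (by
      rw [hAi]; simp [hl, hli])
    have hoffB : ∀ l, l ∉ C → l ≠ j → b l = 0 := fun l hl hlj => hb' l (by
      rw [hBj]; simp [hl, hlj])
    have hai : 0 < a i := by
      refine lt_of_le_of_ne (ha i hiC) fun h0 => hp0 (hself p hperp a (fun l hl => ?_) hpa)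
      by_cases hli : l = i
      · rw [hli, ← h0]
      · exact hoffA l hl hli
    have hbj : 0 < b j := by
      refine lt_of_le_of_ne (hb j hjC) fun h0 => hq0 (hself q hperp' b (fun l hl => ?_) hqb)
      by_cases hlj : l = j
      · rw [hlj, ← h0]
      · exact hoffB l hl hlj
    refine h.nonflat X hX X' hX' C (inter_subset_left.trans hAX) (inter_subset_right.trans hBX)
      i (hAX hiA) j (hBX hjB) hiC hjC hij (b - r • a) (fun l hl hli hlj => ?_) ?_ ?_ ?_
    · simp [hoffA l hl hli, hoffB l hl hlj]
    · have : b i = 0 := hoffB i hiC hij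
      simp only [Pi.sub_apply, Pi.smul_apply, this, smul_eq_mul]
      nlinarith
    · have : a j = 0 := hoffA j hjC hij.symm
      simpa [this] using hbj
    · rw [map_sub, map_smul, ← hpa, ← hqb, hqr, sub_self]
      exact Submodule.zero_mem _
  -- `0 ≤ M` covers an empty set of angles, whose `sSup` is `0`.
  obtain ⟨M, hM0, hM, hMT⟩ : ∃ M : ℝ, 0 ≤ M ∧ M < Real.pi ∧
      ∀ p ∈ T A, ∀ q ∈ T B, angle p q ≤ M := by
    rcases (T A ×ˢ T B).eq_empty_or_nonempty with he | hne
    · refine ⟨0, le_rfl, Real.pi_pos, fun p hp q hq => ?_⟩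
      have : (p, q) ∈ T A ×ˢ T B := ⟨hp, hq⟩
      rw [he] at this
      exact this.elim
    · obtain ⟨⟨p, q⟩, ⟨hp, hq⟩, hmax⟩ := hcomp.exists_isMaxOn hne
        (f := fun x : Euc d × Euc d => angle x.1 x.2) (by
          rintro ⟨p, q⟩ ⟨hp, hq⟩
          refine (continuousAt_angle ?_ ?_).continuousWithinAt
          · have := hp.2
            rintro rfl
            simp at this
          · have := hq.2
            rintro rfl
            simp at this)
      refine ⟨angle p q, angle_nonneg p q, hlt p hp q hq, fun p' hp' q' hq' => ?_⟩
      have hle := isMaxOn_iff.1 hmax (p', q') (mk_mem_prod hp' hq')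
      exact hle
  refine lt_of_le_of_lt (Real.sSup_le ?_ hM0) hM
  rintro θ ⟨z, hz, f₁, hf₁, f₂, hf₂, hd₁, hd₂, rfl⟩
  obtain ⟨c, hc, hc', hzc⟩ := mem_coneOver_image.1 hz
  have key : ∀ A' : Set ι, C ⊆ A' → ∀ f ∈ coneOver (v '' A') \ coneOver (v '' C),
      infDist f (coneOver (v '' C)) = dist f z →
      0 < ‖f - z‖ ∧ ‖f - z‖⁻¹ • (f - z) ∈ T A' := by
    rintro A' hCA f ⟨hf, hfC⟩ hd
    obtain ⟨a, ha, ha', hfa⟩ := mem_coneOver_image.1 hf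
    have hpos : 0 < ‖f - z‖ := by
      rw [norm_pos_iff, sub_ne_zero]
      rintro rfl
      exact hfC hz
    have hinv : 0 ≤ ‖f - z‖⁻¹ := by positivity
    refine ⟨hpos, ⟨fanSet_smul_mem hinv (mem_fanSet_star.2 ⟨A', rfl, hCA, a - c, ?_, ?_, ?_⟩), ?_⟩,
      ?_⟩
    · intro l hl
      simpa [hc' l hl] using ha l
    · intro l hl
      simp [ha' l hl, hc' l fun h => hl (hCA h)]
    · rw [map_sub, ← hfa, ← hzc, sub_self]
      exact Submodule.zero_mem _
    · intro g hg
      rw [real_inner_smul_left]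
      refine mul_nonpos_of_nonneg_of_nonpos hinv ?_
      exact inner_sub_nonpos hz hd hg
    · rw [mem_sphere_zero_iff_norm, norm_smul, norm_inv, norm_norm, inv_mul_cancel₀ hpos.ne']
  obtain ⟨hp1, hT1⟩ := key A inter_subset_left f₁ hf₁ hd₁
  obtain ⟨hp2, hT2⟩ := key B inter_subset_right f₂ hf₂ hd₂
  have := hMT _ hT1 _ hT2
  rw [angle_smul_left_of_pos _ _ (inv_pos.2 hp1), angle_smul_right_of_pos _ _ (inv_pos.2 hp2)]
    at this
  exact this

end IsFan

theorem infDist_eq_norm_of_orthogonal {v : ι → Euc d} {Z : Set ι} {z w : Euc d}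
    (hz : z ∈ coneOver (v '' Z)) (hw : w ∈ (Submodule.span ℝ (v '' Z))ᗮ) :
    infDist (z + w) (coneOver (v '' Z)) = dist (z + w) z := by
  refine le_antisymm (infDist_le_dist_of_mem hz) ?_
  refine (le_infDist ⟨z, hz⟩).2 fun y hy => ?_
  have h1 : inner ℝ (z - y) w = 0 :=
    Submodule.inner_right_of_mem_orthogonal
      (Submodule.sub_mem _ (coneOver_subset_span hz) (coneOver_subset_span hy)) hw
  rw [dist_eq_norm, dist_eq_norm, add_sub_cancel_left, add_sub_right_comm]
  refine le_of_sq_le_sq ?_ (norm_nonneg _)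
  rw [norm_add_sq_real, h1]
  nlinarith [sq_nonneg ‖z - y‖]

/-- The positive and negative parts of a relation represent one point of two cones, which the
intersection axiom puts in the common face. A flat relation gives two points at angle exactly `π`,
built from the component of `a i • v i` orthogonal to the span of `Z`. -/
theorem IsComplexCone.isFan {v : ι → Euc d} (hv : Injective v) {𝒳 : Set (Set ι)} {k : ℕ}
    (h : IsComplexCone k (image v '' 𝒳)) (hnf : NonFlat k (image v '' 𝒳)) :
    IsFan ⊥ v 𝒳 k := by
  classical
  obtain ⟨-, hne, hgen, hint⟩ := h
  have hgen' := fun (X : Set ι) (hX : X ∈ 𝒳) => (isSimpleGen_image hv.injOn).1 (hgen _ (mem_image_of_mem (image v) hX))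
  have hface : ∀ X ∈ 𝒳, ∀ Z ⊆ X, v '' Z ∈ faces (image v '' 𝒳) := fun X hX Z hZ =>
    ⟨_, mem_image_of_mem _ hX, image_mono hZ⟩
  have hind : ∀ X ∈ 𝒳, ∀ a : ι → ℝ, (∀ i, i ∉ X → a i = 0) → comb v a = 0 → a = 0 :=
    fun X hX => (hgen' X hX).2.2
  refine ⟨by simpa using hne, fun X hX => (hgen' X hX).2.1, ?_, ?_⟩
  · intro X hX X' hX' a ha ha' h0
    rw [Submodule.mem_bot] at h0
    have hsplit : comb v (fun i => max (a i) 0) = comb v (fun i => max (-a i) 0) := by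
      rw [← sub_eq_zero, ← map_sub, ← h0]
      congr 1
      ext i
      rcases le_total 0 (a i) with h | h <;> simp [h]
    have hp0 : ∀ i, i ∉ X → max (a i) 0 = 0 := fun i hi => max_eq_right (ha' i hi)
    have hm0 : ∀ i, i ∉ X' → max (-a i) 0 = 0 := fun i hi =>
      max_eq_right (neg_nonpos.2 (ha i hi))
    have hmem : comb v (fun i => max (a i) 0) ∈ coneOver (v '' X) ∩ coneOver (v '' X') :=
      ⟨mem_coneOver_image.2 ⟨_, fun i => le_max_right _ _, hp0, rfl⟩,
        mem_coneOver_image.2 ⟨_, fun i => le_max_right _ _, hm0, hsplit⟩⟩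
    rw [hint _ (hface X hX X subset_rfl) _ (hface X' hX' X' subset_rfl), ← image_inter hv] at hmem
    obtain ⟨c, _, hc, hac⟩ := mem_coneOver_image.1 hmem
    have h1 : (fun i => max (a i) 0) = c := sub_eq_zero.1 (hind X hX _ (fun i hi => by
      simp only [Pi.sub_apply]
      rw [hp0 i hi, hc i fun h => hi h.1, sub_zero]) (by rw [map_sub, hac, sub_self]))
    have h2 : (fun i => max (-a i) 0) = c := sub_eq_zero.1 (hind X' hX' _ (fun i hi => by
      simp only [Pi.sub_apply]
      rw [hm0 i hi, hc i fun h => hi h.2, sub_zero]) (by rw [map_sub, ← hsplit, hac, sub_self]))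
    ext i
    have h3 := congrFun (h1.trans h2.symm) i
    rcases le_total 0 (a i) with h | h <;> simp [h] at h3 <;> simpa using h3
  · intro X hX X' hX' Z hZ hZ' i hi j hj hiZ hjZ hij a ha hai haj h0
    rw [Submodule.mem_bot] at h0
    have hZ12 : v '' insert i Z ∩ v '' insert j Z = v '' Z := by
      rw [← image_inter hv]
      congr 1
      ext l
      simp only [mem_inter_iff, mem_insert_iff]
      constructor
      · rintro ⟨rfl | h, rfl | h'⟩
        · exact absurd rfl hij
        · exact h'
        · exact h
        · exact h
      · exact fun h => ⟨Or.inr h, Or.inr h⟩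
    have hcard : ∀ l, l ∉ Z → (v '' insert l Z).encard = ((Z.ncard + 1 : ℕ) : ℕ∞) := fun l hl => by
      rw [hv.encard_image, ← (toFinite _).cast_ncard_eq, ncard_insert_of_notMem hl]
    have hiX := insert_subset hi hZ
    have hjX := insert_subset hj hZ'
    have hk : Z.ncard < k := by
      rw [← (hgen' X hX).2.1]
      exact ncard_lt_ncard ⟨hZ, fun h => hiZ (h hi)⟩
    have hlt := hnf Z.ncard hk _ (hface X hX _ hiX) _ (hface X' hX' _ hjX)
      (by rw [hZ12, hv.encard_image, (toFinite _).cast_ncard_eq]) (hcard i hiZ) (hcard j hjZ)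
    refine hlt.not_ge (le_csSup ⟨Real.pi, ?_⟩ ?_)
    · rintro θ ⟨z, _, f₁, _, f₂, _, _, _, rfl⟩
      exact EuclideanGeometry.angle_le_pi _ _ _
    set S := Submodule.span ℝ (v '' Z) with hS
    obtain ⟨p, hp, w, hw, hpw⟩ := S.exists_add_mem_mem_orthogonal (a i • v i)
    have hsum : a i • v i + a j • v j + comb v (fun l => if l ∈ Z then a l else 0) = 0 := by
      rw [← h0]
      have : a = Pi.single i (a i) + Pi.single j (a j) + fun l => if l ∈ Z then a l else 0 := by
        ext l
        by_cases hl : l ∈ Z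
        · have h1 : l ≠ i := by rintro rfl; exact hiZ hl
          have h2 : l ≠ j := by rintro rfl; exact hjZ hl
          simp [hl, h1, h2]
        · by_cases h1 : l = i
          · subst h1; simp [hl, hij]
          · by_cases h2 : l = j
            · subst h2; simp [hl, h1]
            · simp [hl, h1, h2, ha l hl h1 h2]
      conv_rhs => rw [this]
      simp only [map_add, Fintype.linearCombination_apply_single]
    have hpj : a j • v j + w ∈ S := by
      have : a j • v j + w = -p - comb v (fun l => if l ∈ Z then a l else 0) := by
        rw [eq_sub_iff_add_eq, eq_neg_iff_add_eq_zero, ← hsum, hpw]; abel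
      rw [this]
      exact S.sub_mem (S.neg_mem hp) (mem_span_image_iff_comb.2 ⟨_, fun l hl => by simp [hl], rfl⟩)
    obtain ⟨b, hb, hbp⟩ := mem_span_image_iff_comb.1 hp
    obtain ⟨c, hc, hcp⟩ := mem_span_image_iff_comb.1 hpj
    -- Deep enough in the face that `z + w` and `z - w` keep nonnegative coefficients on `Z`.
    set z := comb v (fun l => |b l| + |c l|) with hz
    have hzC : z ∈ coneOver (v '' Z) := mem_coneOver_image.2
      ⟨_, fun l => by positivity, fun l hl => by simp [hb l hl, hc l hl], rfl⟩
    have hw0 : w ≠ 0 := by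
      rintro rfl
      rw [add_zero, ← hbp] at hpw
      have h1 := hind X hX (Pi.single i (a i) - b) (fun l hl => by
        have : l ≠ i := by rintro rfl; exact hl hi
        simp [this, hb l fun h => hl (hZ h)]) (by
        rw [map_sub, ← hpw, Fintype.linearCombination_apply_single, sub_self])
      have := congrFun h1 i
      simp [hb i hiZ] at this
      exact hai.ne' this
    have hwS : ∀ y : Euc d, y ∈ S → y + w ∉ S ∧ y - w ∉ S := by
      intro y hy
      have : w ∉ S := fun h => hw0 (inner_self_eq_zero (𝕜 := ℝ).1
        (Submodule.inner_right_of_mem_orthogonal h hw))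
      exact ⟨fun h => this ((S.add_mem_iff_right hy).1 h), fun h => this ((S.sub_mem_iff_right hy).1 h)⟩
    have hzS := coneOver_subset_span hzC
    rw [angleSet, hZ12]
    refine ⟨z, hzC, z + w, ⟨?_, fun h => (hwS z hzS).1 (coneOver_subset_span h)⟩, z - w,
      ⟨?_, fun h => (hwS z hzS).2 (coneOver_subset_span h)⟩,
      infDist_eq_norm_of_orthogonal hzC hw, ?_, ?_⟩
    · refine mem_coneOver_image.2 ⟨(fun l => |b l| + |c l|) + Pi.single i (a i) - b, ?_, ?_, ?_⟩
      · intro l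
        have h1 : 0 ≤ (Pi.single i (a i) : ι → ℝ) l := by
          by_cases h : l = i
          · subst h; simpa using hai.le
          · simp [h]
        have := le_abs_self (b l)
        have := abs_nonneg (c l)
        simp only [Pi.sub_apply, Pi.add_apply]
        linarith
      · intro l hl
        rw [mem_insert_iff, not_or] at hl
        simp [hb l hl.2, hc l hl.2, hl.1]
      · rw [map_sub, map_add, ← hz, Fintype.linearCombination_apply_single, hpw, hbp]
        abel
    · refine mem_coneOver_image.2 ⟨(fun l => |b l| + |c l|) + Pi.single j (a j) - c, ?_, ?_, ?_⟩
      · intro l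
        have h1 : 0 ≤ (Pi.single j (a j) : ι → ℝ) l := by
          by_cases h : l = j
          · subst h; simpa using haj.le
          · simp [h]
        have := le_abs_self (c l)
        have := abs_nonneg (b l)
        simp only [Pi.sub_apply, Pi.add_apply]
        linarith
      · intro l hl
        rw [mem_insert_iff, not_or] at hl
        simp [hb l hl.2, hc l hl.2, hl.1]
      · rw [map_sub, map_add, ← hz, Fintype.linearCombination_apply_single, hcp]
        abel
    · rw [sub_eq_add_neg]
      exact infDist_eq_norm_of_orthogonal hzC (Submodule.neg_mem _ hw)
    · rw [EuclideanGeometry.angle, vsub_eq_sub, vsub_eq_sub, add_sub_cancel_left,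
        sub_sub_cancel_left, InnerProductGeometry.angle_self_neg_of_nonzero hw0]

end Bridge

/-! ### Sets of type `m` as isometric images of fans -/

section Types

/-- The coordinate embedding `ℝ^{N'} → ℝ^N`. -/
def coordEmb (N' N : ℕ) : Euc N' →ₗ[ℝ] Euc N where
  toFun x := WithLp.toLp 2 fun i => if h : i.1 < N' then x ⟨i.1, h⟩ else 0
  map_add' x y := by
    ext i
    by_cases h : i.1 < N' <;> simp [h]
  map_smul' c x := by
    ext i
    by_cases h : i.1 < N' <;> simp [h]

theorem coordEmb_apply {N' N : ℕ} (x : Euc N') (i : Fin N) :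
    coordEmb N' N x i = if h : i.1 < N' then x ⟨i.1, h⟩ else 0 := rfl

/-- The coordinate subspace `{0} × ℝ^m × {0}` of `ℝ^N`. -/
def midSpace (N' N m : ℕ) : Submodule ℝ (Euc N) where
  carrier := {x | ∀ i : Fin N, (i.1 < N' ∨ N' + m ≤ i.1) → x i = 0}
  add_mem' := fun {x y} hx hy i hi => by simp [hx i hi, hy i hi]
  zero_mem' := fun i _ => by simp
  smul_mem' := fun c x hx i hi => by simp [hx i hi]

theorem mem_midSpace {N' N m : ℕ} {x : Euc N} :
    x ∈ midSpace N' N m ↔ ∀ i : Fin N, (i.1 < N' ∨ N' + m ≤ i.1) → x i = 0 := Iff.rfl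

theorem mem_cylinder {N' N m : ℕ} {S : Set (Euc N')} {x : Euc N} :
    x ∈ cylinder N m S ↔ ∃ y ∈ S, x - coordEmb N' N y ∈ midSpace N' N m := by
  refine exists_congr fun y => and_congr_right fun _ => ?_
  rw [mem_midSpace]
  constructor
  · rintro ⟨h1, h2⟩ i (hi | hi)
    · simp [coordEmb_apply, h1 i hi, hi]
    · have : ¬ i.1 < N' := by omega
      simp [coordEmb_apply, h2 i hi, this]
  · intro h
    refine ⟨fun i hi => ?_, fun i hi => ?_⟩
    · have := h i (Or.inl hi)
      simpa [coordEmb_apply, hi, sub_eq_zero] using this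
    · have h1 : ¬ i.1 < N' := by omega
      have := h i (Or.inr hi)
      simpa [coordEmb_apply, h1] using this

theorem eq_zero_of_coordEmb_mem {N' N m : ℕ} (hN : N' ≤ N) {y : Euc N'}
    (h : coordEmb N' N y ∈ midSpace N' N m) : y = 0 := by
  ext i
  have := h ⟨i.1, i.2.trans_le hN⟩ (Or.inl i.2)
  simpa [coordEmb_apply] using this

theorem finrank_midSpace {N' N m : ℕ} (hN : N' + m ≤ N) :
    Module.finrank ℝ (midSpace N' N m) = m := by
  let e : midSpace N' N m ≃ₗ[ℝ] (Fin m → ℝ) :=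
    { toFun := fun x j => x.1 ⟨N' + j.1, by omega⟩
      map_add' := fun x y => by ext j; simp
      map_smul' := fun c x => by ext j; simp
      invFun := fun f => ⟨WithLp.toLp 2 fun i => if h : N' ≤ i.1 ∧ i.1 < N' + m then
          f ⟨i.1 - N', by omega⟩ else 0, fun i hi => by
            have : ¬ (N' ≤ i.1 ∧ i.1 < N' + m) := by omega
            simp [this]⟩
      left_inv := fun x => by
        ext i
        by_cases h : N' ≤ i.1 ∧ i.1 < N' + m
        · have h2 : N' + (i.1 - N') = i.1 := by omega
          simp [h, h2]
        · have := x.2 i (by omega)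
          simp [h, this]
      right_inv := fun f => by
        ext j
        simp }
  rw [e.finrank_eq]
  simp

theorem comb_comp {ι F F' : Type*} [Fintype ι] [NormedAddCommGroup F] [InnerProductSpace ℝ F]
    [NormedAddCommGroup F'] [InnerProductSpace ℝ F'] (f : F →ₗ[ℝ] F') (u : ι → F) (a : ι → ℝ) :
    comb (f ∘ u) a = f (comb u a) := by
  simp [Fintype.linearCombination_apply, map_sum]

/-- A set of type `m` is an isometric image of a non-flat fan. -/
theorem Presents.exists_fan {n m N' N : ℕ} (hN : N' + n ≤ N) {𝒳₀ : Set (Set (Euc N'))}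
    {R : Euc N ≃ᵢ Euc N} {W : Set (Euc N)} (h : Presents n m 𝒳₀ R W) :
    ∃ (ι : Type) (_ : Fintype ι) (P : Submodule ℝ (Euc N)) (u : ι → Euc N) (𝒳 : Set (Set ι)),
      IsFan P u 𝒳 (n - m) ∧ Module.finrank ℝ P = m ∧
      Module.finrank ℝ (starSpace P u (⋃₀ 𝒳)) ≤ N' + m ∧ W = R '' fanSet P u 𝒳 ∧
      ∀ t ≤ n - m, R '' cylinder N m (skeleton 𝒳₀ t) = {x ∈ W | localRank W x ≤ m + t} := by
  classical
  obtain ⟨hm, hcone, hnf, rfl⟩ := h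
  have hfin : (⋃₀ 𝒳₀).Finite := hcone.1.sUnion fun X hX =>
    finite_of_encard_eq_coe (hcone.2.2.1 X hX).2.1
  have hft := hfin.fintype
  let v : (⋃₀ 𝒳₀ : Set (Euc N')) → Euc N' := Subtype.val
  let 𝒳 : Set (Set (⋃₀ 𝒳₀ : Set (Euc N'))) := preimage v '' 𝒳₀
  have hvX : ∀ X ∈ 𝒳₀, v '' (v ⁻¹' X) = X := fun X hX => by
    rw [image_preimage_eq_iff]
    intro x hx
    exact ⟨⟨x, X, hX, hx⟩, rfl⟩
  have himg : image v '' 𝒳 = 𝒳₀ := by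
    rw [image_image]
    conv_rhs => rw [← image_id 𝒳₀]
    exact image_congr hvX
  have hfan0 : IsFan ⊥ v 𝒳 (n - m) := IsComplexCone.isFan Subtype.val_injective
    (by rw [himg]; exact hcone) (by rw [himg]; exact hnf)
  let u := coordEmb N' N ∘ v
  have hfan : IsFan (midSpace N' N m) u 𝒳 (n - m) := by
    refine hfan0.transfer 1 (fun _ => one_pos) fun a _ hP => ?_
    rw [comb_comp] at hP
    rw [one_mul, eq_zero_of_coordEmb_mem (by omega) hP]
    exact Submodule.zero_mem _
  have hrank := finrank_midSpace (N' := N') (N := N) (m := m) (by omega)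
  have hW : cylinder N m (⋃ X ∈ 𝒳₀, coneOver X) = fanSet (midSpace N' N m) u 𝒳 := by
    ext x
    rw [mem_cylinder]
    constructor
    · rintro ⟨y, hy, hyx⟩
      simp only [mem_iUnion] at hy
      obtain ⟨X, hX, hy⟩ := hy
      rw [← hvX X hX] at hy
      obtain ⟨a, ha, ha', rfl⟩ := mem_coneOver_image.1 hy
      exact ⟨_, mem_image_of_mem _ hX, a, ha, ha', by rwa [comb_comp]⟩
    · rintro ⟨_, ⟨X, hX, rfl⟩, a, ha, ha', hx⟩
      rw [comb_comp] at hx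
      refine ⟨_, ?_, hx⟩
      simp only [mem_iUnion]
      refine ⟨X, hX, ?_⟩
      rw [← hvX X hX]
      exact mem_coneOver_image.2 ⟨a, ha, ha', rfl⟩
  refine ⟨_, hft, midSpace N' N m, u, 𝒳, hfan, hrank, ?_, by rw [hW], fun t ht => ?_⟩
  · rw [starSpace]
    refine (Submodule.finrank_add_le_finrank_add_finrank _ _).trans ?_
    rw [hrank, add_comm]
    refine Nat.add_le_add_right ?_ _
    have hle : Submodule.span ℝ (u '' ⋃₀ 𝒳) ≤ LinearMap.range (coordEmb N' N) := by
      rw [Submodule.span_le]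
      rintro _ ⟨i, _, rfl⟩
      exact ⟨v i, rfl⟩
    refine (Submodule.finrank_mono hle).trans ((LinearMap.finrank_range_le _).trans ?_)
    simp
  · rw [hW]
    ext x
    obtain ⟨x, rfl⟩ := R.surjective x
    simp only [R.injective.mem_set_image, mem_ofPred_eq, localRank_image]
    rw [mem_cylinder]
    constructor
    · rintro ⟨y, ⟨Y, ⟨X, hX, hYX⟩, hYc, hy⟩, hx⟩
      rw [← hvX X hX] at hYX
      obtain ⟨Z, hZ, rfl⟩ := subset_image_iff.1 hYX
      obtain ⟨a, ha, ha', rfl⟩ := mem_coneOver_image.1 hy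
      rw [Subtype.val_injective.encard_image, ← (toFinite _).cast_ncard_eq, Nat.cast_inj] at hYc
      rw [← comb_comp] at hx
      have ha'' : ∀ i, i ∉ v ⁻¹' X → a i = 0 := fun i hi => ha' i fun h => hi (hZ h)
      refine ⟨⟨_, mem_image_of_mem _ hX, a, ha, ha'', hx⟩, ?_⟩
      rw [hfan.localRank_eq (mem_image_of_mem _ hX) ha ha'' hx, hrank, ← hYc]
      refine Nat.add_le_add_left (ncard_le_ncard (fun i hi => ?_) (toFinite _)) _
      by_contra hi'
      exact (ha' i hi').not_gt hi
    · rintro ⟨⟨_, ⟨X, hX, rfl⟩, a, ha, ha', hx⟩, hle⟩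
      rw [hfan.localRank_eq (mem_image_of_mem _ hX) ha ha' hx, hrank] at hle
      have hsub : {i | 0 < a i} ⊆ v ⁻¹' X := fun i hi => by
        by_contra hi'
        exact (ha' i hi').not_gt hi
      -- The carrier has at most `t` elements; it is enlarged within the cone to a face with exactly
      -- `t`.
      obtain ⟨Z, h1, h2, h3⟩ := exists_subsuperset_card_eq hsub (Nat.le_of_add_le_add_left hle)
        (by rw [hfan.card _ (mem_image_of_mem _ hX)]; exact ht)
      rw [comb_comp] at hx
      refine ⟨_, ⟨v '' Z, ⟨X, hX, ?_⟩, ?_, mem_coneOver_image.2 ⟨a, ha, fun i hi => ?_, rfl⟩⟩, hx⟩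
      · rw [← hvX X hX]; exact image_mono h2
      · rw [Subtype.val_injective.encard_image, ← (toFinite _).cast_ncard_eq, h3]
      · exact le_antisymm (not_lt.1 fun h => hi (h1 h)) (ha i)

/-- Orthonormal bases of `Pᗮ ⊓ Q` and of `P` are placed at indices starting from `0` and from `N'`,
then completed; `Φ` is the coordinate map of the resulting basis. -/
theorem exists_rotation {N' N m : ℕ} (hN : N' + m ≤ N) {P Q : Submodule ℝ (Euc N)} (hPQ : P ≤ Q)
    (hP : Module.finrank ℝ P = m) (hQ : Module.finrank ℝ Q ≤ N' + m) :
    ∃ Φ : Euc N ≃ₗᵢ[ℝ] Euc N, (∀ x, Φ x ∈ midSpace N' N m ↔ x ∈ P) ∧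
      ∀ x ∈ Q, ∀ i : Fin N, N' + m ≤ i.1 → Φ x i = 0 := by
  classical
  set S := Pᗮ ⊓ Q with hS
  have hSrank : Module.finrank ℝ S ≤ N' := by
    have := Submodule.finrank_add_inf_finrank_orthogonal hPQ
    rw [← hS] at this
    omega
  let bS := stdOrthonormalBasis ℝ S
  let bP := (stdOrthonormalBasis ℝ P).reindex (finCongr hP)
  let v : Fin N → Euc N := fun i =>
    if h : i.1 < Module.finrank ℝ S then (bS ⟨i.1, h⟩ : Euc N) else
    if h : N' ≤ i.1 ∧ i.1 < N' + m then (bP ⟨i.1 - N', by omega⟩ : Euc N) else 0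
  let s : Set (Fin N) := {i | i.1 < Module.finrank ℝ S ∨ N' ≤ i.1 ∧ i.1 < N' + m}
  have hv1 : ∀ (i : Fin N) (h : i.1 < Module.finrank ℝ S), v i = bS ⟨i.1, h⟩ := fun i h => by
    simp [v, h]
  have hv2 : ∀ (i : Fin N) (h : N' ≤ i.1 ∧ i.1 < N' + m), v i = bP ⟨i.1 - N', by omega⟩ :=
    fun i h => by
      have : ¬ i.1 < Module.finrank ℝ S := by omega
      simp [v, h, this]
  have hSP : ∀ (x : S) (y : P), inner ℝ (x : Euc N) (y : Euc N) = 0 := fun x y =>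
    Submodule.inner_left_of_mem_orthogonal y.2 x.2.1
  have hv : Orthonormal ℝ (s.domRestrict v) := by
    constructor
    · rintro ⟨i, hi | hi⟩
      · rw [domRestrict_apply, hv1 i hi]
        exact bS.orthonormal.1 _
      · rw [domRestrict_apply, hv2 i hi]
        exact bP.orthonormal.1 _
    · rintro ⟨i, hi | hi⟩ ⟨j, hj | hj⟩ hij
      all_goals
        rw [ne_eq, Subtype.mk.injEq, Fin.ext_iff] at hij
        simp only [domRestrict_apply]
      · rw [hv1 i hi, hv1 j hj]
        exact bS.orthonormal.2 (by simpa using hij)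
      · rw [hv1 i hi, hv2 j hj]
        exact hSP _ _
      · rw [hv2 i hi, hv1 j hj, real_inner_comm]
        exact hSP _ _
      · rw [hv2 i hi, hv2 j hj]
        refine bP.orthonormal.2 ?_
        rw [ne_eq, Fin.mk.injEq]
        omega
  obtain ⟨b, hb⟩ := hv.exists_orthonormalBasis_extension_of_card_eq (by simp)
  have horth : ∀ i j : Fin N, i ≠ j → inner ℝ (b i) (b j) = 0 := fun i j h => b.orthonormal.2 h
  have hinP : ∀ x ∈ P, ∀ i : Fin N, (i.1 < N' ∨ N' + m ≤ i.1) → inner ℝ (b i) x = 0 := by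
    intro x hx i hi
    have hsum : x = ∑ j, bP.repr ⟨x, hx⟩ j • (bP j : Euc N) := by
      have := congrArg (Subtype.val) (bP.sum_repr ⟨x, hx⟩)
      simpa using this.symm
    rw [hsum, inner_sum]
    refine Finset.sum_eq_zero fun j _ => ?_
    have hj := hv2 ⟨N' + j.1, by omega⟩ ⟨by simp, by simp⟩
    rw [← hb _ (Or.inr ⟨by simp, by simp⟩)] at hj
    have hj' : (⟨N' + j.1 - N', by omega⟩ : Fin m) = j := by ext; simp
    simp only [hj'] at hj
    rw [← hj, inner_smul_right, horth, mul_zero]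
    rw [ne_eq, Fin.ext_iff]
    simp only
    omega
  have hinS : ∀ x ∈ S, ∀ i : Fin N, N' + m ≤ i.1 → inner ℝ (b i) x = 0 := by
    intro x hx i hi
    have hsum : x = ∑ j, bS.repr ⟨x, hx⟩ j • (bS j : Euc N) := by
      have := congrArg (Subtype.val) (bS.sum_repr ⟨x, hx⟩)
      simpa using this.symm
    rw [hsum, inner_sum]
    refine Finset.sum_eq_zero fun j _ => ?_
    have hj := hv1 ⟨j.1, by omega⟩ j.2
    rw [← hb _ (Or.inl j.2)] at hj
    simp only [Fin.eta] at hj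
    rw [← hj, inner_smul_right, horth, mul_zero]
    rw [ne_eq, Fin.ext_iff]
    simp only
    omega
  refine ⟨b.repr, fun x => ⟨fun hx => ?_, fun hx i hi => ?_⟩, fun x hx i hi => ?_⟩
  · rw [← b.sum_repr x]
    refine P.sum_mem fun i _ => ?_
    by_cases hi : N' ≤ i.1 ∧ i.1 < N' + m
    · rw [hb i (Or.inr hi), hv2 i hi]
      exact P.smul_mem _ (SetLike.coe_mem _)
    · rw [hx i (by omega), zero_smul]
      exact P.zero_mem
  · rw [b.repr_apply_apply]
    exact hinP x hx i hi
  · rw [b.repr_apply_apply]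
    rw [← Submodule.sup_orthogonal_inf_of_hasOrthogonalProjection hPQ, Submodule.mem_sup] at hx
    obtain ⟨p, hp, q, hq, rfl⟩ := hx
    rw [inner_add_right, hinP p hp i (Or.inr hi), hinS q hq i hi, add_zero]

/-- After a rotation the generators are projected to the first `N'` coordinates, which discards only
components along `P`, and normalized. The image of the fan is then literally of the form `T × ℝ^m ×
{0}`. -/
theorem IsFan.isType {ι : Type*} [Fintype ι] {n m N' N k : ℕ} (hN : N' + m ≤ N)
    {P : Submodule ℝ (Euc N)} {u : ι → Euc N} {𝒳 : Set (Set ι)} (h : IsFan P u 𝒳 k)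
    (hk : k + m = n) (hP : Module.finrank ℝ P = m)
    (hQ : Module.finrank ℝ (starSpace P u (⋃₀ 𝒳)) ≤ N' + m) (R : Euc N ≃ᵢ Euc N) :
    IsType n N' m (R '' fanSet P u 𝒳) := by
  classical
  obtain ⟨Φ, hΦP, hΦQ⟩ := exists_rotation hN subset_starSpace hP hQ
  let ψ : Euc N →ₗ[ℝ] Euc N' :=
    { toFun := fun x => WithLp.toLp 2 fun i => Φ x ⟨i.1, by omega⟩
      map_add' := fun x y => by ext i; simp
      map_smul' := fun c x => by ext i; simp }
  have hQmem : ∀ a : ι → ℝ, (∀ i, i ∉ ⋃₀ 𝒳 → a i = 0) →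
      comb u a ∈ starSpace P u (⋃₀ 𝒳) := fun a ha => by
    refine mem_starSpace.2 ⟨a, ha, by simp⟩
  have hψ : ∀ x ∈ starSpace P u (⋃₀ 𝒳), Φ x - coordEmb N' N (ψ x) ∈ midSpace N' N m := by
    intro x hx i hi
    have h1 : coordEmb N' N (ψ x) i = if i.1 < N' then Φ x i else 0 := by
      rw [coordEmb_apply]
      rfl
    simp only [PiLp.sub_apply, h1]
    rcases hi with hi | hi
    · simp [hi]
    · have : ¬ i.1 < N' := by omega
      simp [this, hΦQ x hx i hi]
  have hψ0 : ∀ x ∈ starSpace P u (⋃₀ 𝒳), ψ x = 0 → x ∈ P := by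
    intro x hx h0
    have := hψ x hx
    rw [h0, map_zero, sub_zero] at this
    exact (hΦP x).1 this
  have hne : ∀ i ∈ ⋃₀ 𝒳, ψ (u i) ≠ 0 := by
    rintro i ⟨X, hX, hi⟩ h0
    have hmem := hψ0 (u i) (vec_mem_starSpace ⟨X, hX, hi⟩) h0
    have := h.coeff_zero hX (a := Pi.single i 1) (fun j hj => by
      have : j ≠ i := by rintro rfl; exact hj hi
      simp [this]) (by simpa using hmem)
    have := congrFun this i
    simp at this
  let c : ι → ℝ := fun i => if i ∈ ⋃₀ 𝒳 then ‖ψ (u i)‖⁻¹ else 1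
  have hc : ∀ i, 0 < c i := by
    intro i
    by_cases hi : i ∈ ⋃₀ 𝒳
    · simp only [c, hi, if_true]
      exact inv_pos.2 (norm_pos_iff.2 (hne i hi))
    · simp only [c, hi, if_false]
      exact one_pos
  let v : ι → Euc N' := fun i => c i • ψ (u i)
  have hvc : ∀ a, comb v a = ψ (comb u (c * a)) := by
    intro a
    simp only [Fintype.linearCombination_apply, map_sum, map_smul, v, Pi.mul_apply]
    exact Finset.sum_congr rfl fun i _ => by rw [smul_smul, mul_comm]
  have hsupp : ∀ a : ι → ℝ, (∀ i, i ∉ ⋃₀ 𝒳 → a i = 0) → ∀ i, i ∉ ⋃₀ 𝒳 → (c * a) i = 0 :=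
    fun a ha i hi => by simp [ha i hi]
  have hfan : IsFan ⊥ v 𝒳 k := by
    refine h.transfer c hc fun a ha hP => ?_
    rw [hvc, Submodule.mem_bot] at hP
    exact hψ0 _ (hQmem _ (hsupp a ha)) hP
  have hnorm : ∀ i ∈ ⋃₀ 𝒳, ‖v i‖ = 1 := by
    intro i hi
    have := norm_pos_iff.2 (hne i hi)
    simp only [v, c, hi, if_true, norm_smul, norm_inv, norm_norm]
    exact inv_mul_cancel₀ this.ne'
  have hnm : n - m = k := by omega
  refine ⟨image v '' 𝒳, Φ.symm.toIsometryEquiv.trans R, by omega, ?_, ?_, ?_⟩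
  · rw [hnm]; exact hfan.isComplexCone hnorm
  · rw [hnm]; exact hfan.nonFlat
  have hmem : ∀ x, Φ x ∈ cylinder N m (⋃ X ∈ image v '' 𝒳, coneOver X) ↔ x ∈ fanSet P u 𝒳 := by
    intro x
    have hkey : ∀ X ∈ 𝒳, ∀ a : ι → ℝ, (∀ i, i ∉ X → a i = 0) →
        (Φ x - coordEmb N' N (comb v a) ∈ midSpace N' N m ↔ x - comb u (c * a) ∈ P) := by
      intro X hX a ha
      have h1 := hψ _ (hQmem (c * a) (hsupp a fun i hi => ha i fun h => hi ⟨X, hX, h⟩))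
      rw [hvc, ← hΦP, map_sub, ← (midSpace N' N m).sub_mem_iff_left h1]
      congr! 1
      abel
    rw [mem_cylinder]
    constructor
    · rintro ⟨y, hy, hyx⟩
      simp only [mem_iUnion] at hy
      obtain ⟨_, ⟨X, hX, rfl⟩, hy⟩ := hy
      obtain ⟨a, ha, ha', rfl⟩ := mem_coneOver_image.1 hy
      exact ⟨X, hX, c * a, fun i => mul_nonneg (hc i).le (ha i), fun i hi => by simp [ha' i hi],
        (hkey X hX a ha').1 hyx⟩
    · rintro ⟨X, hX, a, ha, ha', hx⟩
      have hca : c * (c⁻¹ * a) = a := by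
        ext i
        simp [(hc i).ne']
      have ha'' : ∀ i, i ∉ X → (c⁻¹ * a) i = 0 := fun i hi => by simp [ha' i hi]
      refine ⟨comb v (c⁻¹ * a), ?_, (hkey X hX _ ha'').2 (by rwa [hca])⟩
      simp only [mem_iUnion]
      exact ⟨_, ⟨X, hX, rfl⟩, mem_coneOver_image.2 ⟨_, fun i =>
        mul_nonneg (inv_nonneg.2 (hc i).le) (ha i), ha'', rfl⟩⟩
  ext y
  constructor
  · rintro ⟨x, hx, rfl⟩
    exact ⟨Φ x, (hmem x).2 hx, by simp⟩
  · rintro ⟨z, hz, rfl⟩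
    refine ⟨Φ.symm z, (hmem _).1 (by simpa using hz), by simp⟩

end Types

/-! ### Type and spines expressed by the local rank -/

section Types
variable {n N' N : ℕ}

theorem IsType.localRank_spec (hN : N' + n ≤ N) {m : ℕ} {W : Set (Euc N)}
    (h : IsType n N' m W) : (∃ x ∈ W, localRank W x = m) ∧ ∀ x ∈ W, m ≤ localRank W x := by
  obtain ⟨𝒳₀, R, h⟩ := h
  obtain ⟨ι, _, P, u, 𝒳, hfan, rfl, -, rfl, -⟩ := h.exists_fan hN
  refine ⟨⟨R 0, mem_image_of_mem _ (zero_mem_fanSet hfan.nonempty), ?_⟩, ?_⟩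
  · rw [localRank_image, hfan.localRank_zero]
  · rintro _ ⟨x, hx, rfl⟩
    rw [localRank_image]
    exact hfan.le_localRank hx

theorem IsType.unique (hN : N' + n ≤ N) {m m' : ℕ} {W : Set (Euc N)}
    (h : IsType n N' m W) (h' : IsType n N' m' W) : m = m' := by
  obtain ⟨⟨x, hx, hxm⟩, hle⟩ := h.localRank_spec hN
  obtain ⟨⟨x', hx', hxm'⟩, hle'⟩ := h'.localRank_spec hN
  have := hle _ hx'
  have := hle' _ hx
  omega

/-- Every presentation gives the same description of the spine through `Presents.exists_fan`, and
the local rank depends on `W` alone. -/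
theorem mem_spine (hN : N' + n ≤ N) {m s : ℕ} (hs : s ≤ n) {W : Set (Euc N)}
    (h : IsType n N' m W) {x : Euc N} :
    x ∈ spine n N' s W ↔ x ∈ W ∧ localRank W x ≤ s := by
  constructor
  · rintro ⟨m', t, 𝒳₀, R, hp, rfl, hx⟩
    obtain ⟨ι, _, P, u, 𝒳, -, -, -, -, hsk⟩ := hp.exists_fan hN
    rw [hsk t (by omega)] at hx
    exact hx
  · rintro ⟨hx, hle⟩
    have hms := ((h.localRank_spec hN).2 x hx).trans hle
    obtain ⟨𝒳₀, R, hp⟩ := h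
    obtain ⟨ι, _, P, u, 𝒳, -, -, -, -, hsk⟩ := hp.exists_fan hN
    refine ⟨m, s - m, 𝒳₀, R, hp, by omega, ?_⟩
    rw [hsk (s - m) (by omega)]
    exact ⟨hx, by omega⟩

end Types

/-! ### Blow-ups of fans are stars -/

section BlowUp
variable {ι : Type*} [Fintype ι] {N : ℕ} {P : Submodule ℝ (Euc N)} {u : ι → Euc N}
  {𝒳 : Set (Set ι)} {k : ℕ}

theorem localCone_image (R : Euc N ≃ᵢ Euc N) (A : Set (Euc N)) (x : Euc N) (r : ℝ) :
    localCone (R '' A) (R x) r = linPart R '' localCone A x r := by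
  ext v
  constructor
  · rintro ⟨c, hc, _, ⟨⟨y, hy, rfl⟩, hyr⟩, rfl⟩
    rw [mem_ball, R.dist_eq] at hyr
    exact ⟨c • (y - x), ⟨c, hc, y, ⟨hy, hyr⟩, rfl⟩, by rw [map_smul, isometry_sub]⟩
  · rintro ⟨_, ⟨c, hc, y, ⟨hy, hyr⟩, rfl⟩, rfl⟩
    refine ⟨c, hc, R y, ⟨mem_image_of_mem _ hy, ?_⟩, by rw [map_smul, isometry_sub]⟩
    rw [mem_ball, R.dist_eq]
    exact hyr

/-- Near `x` the fan is the star of `Y`, which is a cone with apex `x` too, since `x` lies in its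
lineality space. -/
theorem IsFan.exists_localCone_eq (h : IsFan P u 𝒳 k) {X Y : Set ι} (hX : X ∈ 𝒳) (hY : Y ⊆ X)
    {a : ι → ℝ} (ha : ∀ i, 0 ≤ a i) (ha' : ∀ i, i ∉ Y → a i = 0) (haY : ∀ i ∈ Y, 0 < a i)
    {x : Euc N} (hx : x - comb u a ∈ P) : ∃ r₁ : ℝ, 0 < r₁ ∧ ∀ r, 0 < r → r < r₁ →
      localCone (fanSet P u 𝒳) x r =
        fanSet (starSpace P u Y) u (ConeStrata.star 𝒳 Y) := by
  obtain ⟨r₁, hr₁, hball⟩ := h.exists_ball hX hY ha (fun i hi => ha' i fun h => hi (hY h)) haY hx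
  have hxS : x ∈ starSpace P u Y := mem_starSpace.2 ⟨a, ha', hx⟩
  refine ⟨r₁, hr₁, fun r hr hrr => ?_⟩
  ext v
  constructor
  · rintro ⟨c, hc, y, ⟨hy, hyr⟩, rfl⟩
    have h1 := (hball.subset ⟨hy, ball_subset_ball hrr.le hyr⟩).1
    rw [sub_eq_add_neg]
    exact fanSet_smul_mem hc (fanSet_add_mem h1 (Submodule.neg_mem _ hxS))
  · intro hv
    set t : ℝ := r / (1 + ‖v‖) with ht
    have ht0 : 0 < t := by positivity
    have hyr : t • v + x ∈ ball x r := by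
      rw [mem_ball, dist_eq_norm, add_sub_cancel_right, norm_smul, Real.norm_of_nonneg ht0.le, ht,
        div_mul_eq_mul_div, div_lt_iff₀ (by positivity)]
      nlinarith
    refine ⟨t⁻¹, by positivity, t • v + x, ⟨?_, hyr⟩, ?_⟩
    · exact (hball.symm.subset ⟨fanSet_add_mem (fanSet_smul_mem ht0.le hv) hxS,
        ball_subset_ball hrr.le hyr⟩).1
    · rw [add_sub_cancel_right, smul_smul, inv_mul_cancel₀ ht0.ne', one_smul]

/-- The star of `Y` is the blow-up at the point with coefficients `1` on `Y` and `0` elsewhere; the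
linear part of `S` is undone by the final isometry. -/
theorem IsFan.image_mem_blowUps (h : IsFan P u 𝒳 k) {ℬ : Set (Set (Euc N))} {S : Euc N ≃ᵢ Euc N}
    (hW : S '' fanSet P u 𝒳 ∈ ℬ) {X Y : Set ι} (hX : X ∈ 𝒳) (hY : Y ⊆ X) (R : Euc N ≃ᵢ Euc N) :
    R '' fanSet (starSpace P u Y) u (ConeStrata.star 𝒳 Y) ∈ blowUps ℬ := by
  classical
  let a : ι → ℝ := fun i => if i ∈ Y then 1 else 0
  have ha : ∀ i, 0 ≤ a i := fun i => by simp only [a]; split_ifs <;> norm_num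
  have ha' : ∀ i, i ∉ Y → a i = 0 := fun i hi => by simp [a, hi]
  obtain ⟨r₁, hr₁, heq⟩ := h.exists_localCone_eq hX hY ha ha' (fun i hi => by simp [a, hi])
    (x := comb u a) (by simp)
  refine ⟨_, hW, S (comb u a), mem_image_of_mem _ ⟨X, hX, a, ha,
    fun i hi => ha' i fun h => hi (hY h), by simp⟩, (linPart S).symm.toIsometryEquiv.trans R,
    r₁, hr₁, fun r hr hrr => ?_⟩
  rw [localCone_image, heq r hr hrr, image_image]
  simp

theorem IsFan.exists_of_blowUp (h : IsFan P u 𝒳 k) {S : Euc N ≃ᵢ Euc N} {W V : Set (Euc N)}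
    (hW : W = S '' fanSet P u 𝒳) (hV : V ∈ blowUps {W}) :
    ∃ X ∈ 𝒳, ∃ Y ⊆ X, ∃ R : Euc N ≃ᵢ Euc N,
      V = R '' fanSet (starSpace P u Y) u (ConeStrata.star 𝒳 Y) := by
  obtain ⟨_, rfl, x, hx, R, r₀, hr₀, hV⟩ := hV
  subst hW
  obtain ⟨x, hx, rfl⟩ := hx
  obtain ⟨X, hX, a, ha, ha', hxa⟩ := hx
  have hY : {i | 0 < a i} ⊆ X := fun i hi => by
    by_contra hi'
    exact (ha' i hi').not_gt hi
  obtain ⟨r₁, hr₁, heq⟩ := h.exists_localCone_eq hX hY ha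
    (fun i hi => le_antisymm (not_lt.1 hi) (ha i)) (fun i hi => hi) hxa
  refine ⟨X, hX, _, hY, (linPart S).toIsometryEquiv.trans R, ?_⟩
  have h1 : min r₀ r₁ / 2 < min r₀ r₁ := half_lt_self (by positivity)
  rw [hV (min r₀ r₁ / 2) (by positivity) (h1.trans_le (min_le_left _ _)), localCone_image,
    heq _ (by positivity) (h1.trans_le (min_le_right _ _)), image_image]
  rfl

end BlowUp

/-! ### Fans whose stars are all blow-ups, and uniformity of constants -/

section Good
variable {n N' N : ℕ}

/-- A fan all of whose stars are members of the family of blow-ups of `ℬ`. -/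
structure IsGood {ι : Type*} [Fintype ι] (n N' : ℕ) (ℬ : Set (Set (Euc N)))
    (P : Submodule ℝ (Euc N)) (u : ι → Euc N) (𝒳 : Set (Set ι)) : Prop where
  fan : IsFan P u 𝒳 (n - Module.finrank ℝ P)
  le : Module.finrank ℝ P ≤ n
  -- Room for the fan in `ℝ^{N'} × ℝ^m`. Stars inherit it: the span does not grow, whereas the
  -- lineality space does not shrink.
  dim : Module.finrank ℝ (starSpace P u (⋃₀ 𝒳)) ≤ N' + Module.finrank ℝ P
  mem : ∀ X ∈ 𝒳, ∀ Y ⊆ X, ∀ R : Euc N ≃ᵢ Euc N,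
    R '' fanSet (starSpace P u Y) u (star 𝒳 Y) ∈ blowUps ℬ

theorem star_empty {ι : Type*} (𝒳 : Set (Set ι)) : star 𝒳 ∅ = 𝒳 := by
  ext Z
  constructor
  · rintro ⟨X, hX, -, rfl⟩
    rwa [sdiff_empty]
  · exact fun hZ => ⟨Z, hZ, empty_subset _, sdiff_empty.symm⟩

theorem starSpace_empty {ι F : Type*} [NormedAddCommGroup F] [InnerProductSpace ℝ F]
    (P : Submodule ℝ F) (u : ι → F) : starSpace P u ∅ = P := by
  simp [starSpace]

namespace IsGood
variable {ι : Type*} [Fintype ι] {ℬ : Set (Set (Euc N))} {P : Submodule ℝ (Euc N)}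
  {u : ι → Euc N} {𝒳 : Set (Set ι)}

theorem image_mem (h : IsGood n N' ℬ P u 𝒳) (R : Euc N ≃ᵢ Euc N) :
    R '' fanSet P u 𝒳 ∈ blowUps ℬ := by
  obtain ⟨X, hX⟩ := h.fan.nonempty
  simpa [star_empty, starSpace_empty] using h.mem X hX ∅ (empty_subset _) R

theorem finrank_star (h : IsGood n N' ℬ P u 𝒳) {X Y : Set ι} (hX : X ∈ 𝒳) (hY : Y ⊆ X) :
    Module.finrank ℝ (starSpace P u Y) = Module.finrank ℝ P + Y.ncard ∧
      Module.finrank ℝ P + Y.ncard ≤ n := by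
  refine ⟨h.fan.finrank_starSpace hX hY, ?_⟩
  have h1 := ncard_le_ncard hY (toFinite _)
  rw [h.fan.card X hX] at h1
  have := h.le
  omega

theorem star (h : IsGood n N' ℬ P u 𝒳) {X Y : Set ι} (hX : X ∈ 𝒳) (hY : Y ⊆ X) :
    IsGood n N' ℬ (starSpace P u Y) u (ConeStrata.star 𝒳 Y) := by
  obtain ⟨h1, h2⟩ := h.finrank_star hX hY
  refine ⟨?_, by rw [h1]; exact h2, ?_, ?_⟩
  · rw [h1, ← Nat.sub_sub]
    exact h.fan.star hX hY
  · rw [starSpace_starSpace, h1]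
    have hsub : Y ∪ ⋃₀ ConeStrata.star 𝒳 Y ⊆ ⋃₀ 𝒳 := by
      refine union_subset (hY.trans (subset_sUnion_of_mem hX)) (sUnion_subset ?_)
      rintro _ ⟨Z, hZ, -, rfl⟩
      exact sdiff_subset.trans (subset_sUnion_of_mem hZ)
    refine (Submodule.finrank_mono (?_ : _ ≤ starSpace P u (⋃₀ 𝒳))).trans (h.dim.trans ?_)
    · exact sup_le_sup_left (Submodule.span_mono (image_mono hsub)) _
    · omega
  · rintro _ ⟨Z, hZ, hYZ, rfl⟩ Y' hY' R
    obtain ⟨h3, h4⟩ := subset_sdiff.1 hY'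
    rw [starSpace_starSpace, star_star _ h4]
    exact h.mem Z hZ _ (union_subset hYZ h3) R

theorem isType (hN : N' + n ≤ N) (h : IsGood n N' ℬ P u 𝒳) (R : Euc N ≃ᵢ Euc N) :
    IsType n N' (Module.finrank ℝ P) (R '' fanSet P u 𝒳) := by
  have := h.le
  exact h.fan.isType (by omega) (by omega) rfl h.dim R

theorem image_mem_type (hN : N' + n ≤ N) (h : IsGood n N' ℬ P u 𝒳) (R : Euc N ≃ᵢ Euc N) :
    R '' fanSet P u 𝒳 ∈ blowUpsOfType n N' ℬ (Module.finrank ℝ P) :=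
  ⟨h.image_mem R, h.isType hN R⟩

theorem star_mem_type (hN : N' + n ≤ N) (h : IsGood n N' ℬ P u 𝒳) {X Y : Set ι} (hX : X ∈ 𝒳)
    (hY : Y ⊆ X) (R : Euc N ≃ᵢ Euc N) :
    R '' fanSet (starSpace P u Y) u (ConeStrata.star 𝒳 Y) ∈
      blowUpsOfType n N' ℬ (Module.finrank ℝ P + Y.ncard) := by
  rw [← (h.finrank_star hX hY).1]
  exact (h.star hX hY).image_mem_type hN R

end IsGood

theorem exists_fan_of_mem (hN : N' + n ≤ N) {ℬ : Set (Set (Euc N))}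
    (hℬ : ℬ ⊆ allTypes n N' N) {G : Set (Euc N)} (hG : G ∈ ℬ) :
    ∃ (ι : Type) (_ : Fintype ι) (P : Submodule ℝ (Euc N)) (u : ι → Euc N) (𝒳 : Set (Set ι)),
      IsFan P u 𝒳 (n - Module.finrank ℝ P) ∧
      (∃ S : Euc N ≃ᵢ Euc N, G = S '' fanSet P u 𝒳) ∧
      ∀ X ∈ 𝒳, ∀ Y ⊆ X, IsGood n N' ℬ (starSpace P u Y) u (star 𝒳 Y) := by
  obtain ⟨m, hm, 𝒳₀, S, hp⟩ := hℬ hG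
  obtain ⟨ι, hι, P, u, 𝒳, hfan, rfl, hdim, rfl, -⟩ := hp.exists_fan hN
  have hgood : IsGood n N' ℬ P u 𝒳 :=
    ⟨hfan, hm, hdim, fun X hX Y hY R => hfan.image_mem_blowUps hG hX hY R⟩
  exact ⟨ι, hι, P, u, 𝒳, hfan, ⟨S, rfl⟩, fun X hX Y hY => hgood.star hX hY⟩

theorem exists_good (hN : N' + n ≤ N) {ℬ : Set (Set (Euc N))} (hℬ : ℬ ⊆ allTypes n N' N)
    {V : Set (Euc N)} (hV : V ∈ blowUps ℬ) :
    ∃ (ι : Type) (_ : Fintype ι) (P : Submodule ℝ (Euc N)) (u : ι → Euc N) (𝒳 : Set (Set ι))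
      (R : Euc N ≃ᵢ Euc N), IsGood n N' ℬ P u 𝒳 ∧ V = R '' fanSet P u 𝒳 := by
  obtain ⟨W, hW, hV⟩ := hV
  obtain ⟨ι, hι, P, u, 𝒳, hfan, ⟨S, hS⟩, hgood⟩ := exists_fan_of_mem hN hℬ hW
  obtain ⟨X, hX, Y, hY, R, rfl⟩ := hfan.exists_of_blowUp hS ⟨W, rfl, hV⟩
  exact ⟨ι, hι, _, u, _, R, hgood X hX Y hY, rfl⟩

theorem exists_isType (hN : N' + n ≤ N) {ℬ : Set (Set (Euc N))} (hℬ : ℬ ⊆ allTypes n N' N)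
    {V : Set (Euc N)} (hV : V ∈ blowUps ℬ) : ∃ m ≤ n, V ∈ blowUpsOfType n N' ℬ m := by
  obtain ⟨ι, hι, P, u, 𝒳, R, hgood, rfl⟩ := exists_good hN hℬ hV
  exact ⟨_, hgood.le, hgood.image_mem_type hN R⟩

theorem exists_forall_of_finite {α : Type*} {s : Set α} (hs : s.Finite) {p : α → ℝ → Prop}
    (hmono : ∀ a c c', c ≤ c' → p a c → p a c') (h : ∀ a ∈ s, ∃ c, p a c) :
    ∃ c, ∀ a ∈ s, p a c := by
  induction s, hs using Set.Finite.induction_on with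
  | empty => exact ⟨0, by simp⟩
  | @insert a s _ _ ih =>
    obtain ⟨c, hc⟩ := ih fun b hb => h b (mem_insert_of_mem _ hb)
    obtain ⟨c', hc'⟩ := h a (mem_insert _ _)
    refine ⟨max c c', ?_⟩
    rintro b (rfl | hb)
    · exact hmono _ _ _ (le_max_right _ _) hc'
    · exact hmono _ _ _ (le_max_left _ _) (hc b hb)

/-- A bound that holds for the isometric images of each fan holds uniformly on the blow-ups of a
family that is finite modulo isometries. -/
theorem exists_uniform (hN : N' + n ≤ N) {ℬ : Set (Set (Euc N))} (hℬ : ℬ ⊆ allTypes n N' N)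
    (hfin : ((Quotient.mk (isometrySetoid N)) '' ℬ).Finite) {p : Set (Euc N) → ℝ → Prop}
    (hmono : ∀ V c c', c ≤ c' → p V c → p V c')
    (h : ∀ (ι : Type) [Fintype ι] (P : Submodule ℝ (Euc N)) (u : ι → Euc N) (𝒳 : Set (Set ι)),
      IsGood n N' ℬ P u 𝒳 → ∃ c, ∀ R : Euc N ≃ᵢ Euc N, p (R '' fanSet P u 𝒳) c) :
    ∃ c, ∀ V ∈ blowUps ℬ, p V c := by
  -- Isometric members of `ℬ` have the same blow-ups up to isometry, so one fan per class suffices,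
  -- and each fan has finitely many faces `Y`.
  obtain ⟨c, hc⟩ := exists_forall_of_finite hfin
    (p := fun q c => ∀ W ∈ ℬ, Quotient.mk (isometrySetoid N) W = q → ∀ V ∈ blowUps {W}, p V c)
    (fun q c c' hcc hq W hW hWq V hV => hmono V c c' hcc (hq W hW hWq V hV)) (by
      rintro _ ⟨G, hG, rfl⟩
      obtain ⟨ι, hι, P, u, 𝒳, hfan, ⟨S, hS⟩, hgood⟩ := exists_fan_of_mem hN hℬ hG
      obtain ⟨c, hc⟩ := exists_forall_of_finite (s := {Y : Set ι | ∃ X ∈ 𝒳, Y ⊆ X}) (toFinite _)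
        (p := fun Y c => ∀ R : Euc N ≃ᵢ Euc N,
          p (R '' fanSet (starSpace P u Y) u (star 𝒳 Y)) c)
        (fun Y c c' hcc hq R => hmono _ c c' hcc (hq R)) (by
          rintro Y ⟨X, hX, hY⟩
          exact h ι _ u _ (hgood X hX Y hY))
      refine ⟨c, fun W hW hWG V hV => ?_⟩
      obtain ⟨T, hT⟩ : ∃ T : Euc N ≃ᵢ Euc N, W = T '' G := Quotient.exact hWG
      have hW2 : W = (S.trans T) '' fanSet P u 𝒳 := by
        rw [hT, hS, image_image]; rfl
      obtain ⟨X, hX, Y, hY, R, rfl⟩ := hfan.exists_of_blowUp hW2 hV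
      exact hc Y ⟨X, hX, hY⟩ R)
  refine ⟨c, ?_⟩
  rintro V ⟨W, hW, hV⟩
  exact hc _ (mem_image_of_mem _ hW) W hW rfl V ⟨W, rfl, hV⟩

end Good

/-! ### Truncation of coefficients and estimates for the local distance -/

section Estimates
variable {N : ℕ}

theorem norm_comb_le {ι F : Type*} [Fintype ι] [NormedAddCommGroup F] [InnerProductSpace ℝ F]
    (u : ι → F) {d : ι → ℝ} {τ : ℝ} (hd : ∀ i, |d i| ≤ τ) : ‖comb u d‖ ≤ τ * ∑ i, ‖u i‖ := by
  rw [Fintype.linearCombination_apply, Finset.mul_sum]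
  refine (norm_sum_le _ _).trans (Finset.sum_le_sum fun i _ => ?_)
  rw [norm_smul]
  exact mul_le_mul_of_nonneg_right (hd i) (norm_nonneg _)

/-- Discarding the small coefficients of a point of a fan moves the point by a small amount to
the face spanned by the large coefficients. -/
theorem exists_truncation {ι F : Type*} [Fintype ι] [NormedAddCommGroup F] [InnerProductSpace ℝ F]
    {P : Submodule ℝ F} {u : ι → F} {a : ι → ℝ} (ha : ∀ i, 0 ≤ a i) {x : F}
    (hx : x - comb u a ∈ P) {τ : ℝ} (hτ : 0 < τ) : ∃ (b : ι → ℝ) (x' : F),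
      (∀ i, 0 ≤ b i) ∧ (∀ i, a i < τ → b i = 0) ∧ (∀ i, τ ≤ a i → b i = a i) ∧
      x' - comb u b ∈ P ∧ dist x x' ≤ τ * ∑ i, ‖u i‖ := by
  classical
  refine ⟨fun i => if τ ≤ a i then a i else 0, x - comb u (fun i => if τ ≤ a i then 0 else a i),
    fun i => ?_, fun i hi => by simp [not_le.2 hi], fun i hi => by simp [hi], ?_, ?_⟩
  · simp only; split_ifs
    exacts [ha i, le_rfl]
  · rw [sub_sub, ← map_add]
    convert hx using 3
    ext i
    by_cases hi : τ ≤ a i <;> simp [hi]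
  · rw [dist_eq_norm, sub_sub_cancel]
    refine norm_comb_le u fun i => ?_
    split_ifs with hi
    · simpa using hτ.le
    · rw [abs_of_nonneg (ha i)]; exact (not_le.1 hi).le

theorem bddAbove_infDist (x : Euc N) (r : ℝ) {A : Set (Euc N)} (hA : A.Nonempty)
    (B : Set (Euc N)) : BddAbove ((fun z => infDist z A) '' (B ∩ ball x r)) := by
  obtain ⟨a, ha⟩ := hA
  refine ⟨r + dist x a, ?_⟩
  rintro _ ⟨z, ⟨_, hz⟩, rfl⟩
  have h1 := infDist_le_dist_of_mem (x := z) ha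
  have h2 := dist_triangle z x a
  have h3 := mem_ball.1 hz
  simp only
  linarith

theorem infDist_le_of_relDist {x : Euc N} {r δ : ℝ} (hr : 0 < r) {A B : Set (Euc N)}
    (hA : A.Nonempty) (hB : B.Nonempty) (h : relDist x r A B ≤ δ) :
    (∀ z ∈ B ∩ ball x r, infDist z A ≤ δ * r) ∧ ∀ z ∈ A ∩ ball x r, infDist z B ≤ δ * r := by
  rw [relDist, one_div, inv_mul_eq_div, div_le_iff₀ hr] at h
  refine ⟨fun z hz => ?_, fun z hz => ?_⟩
  · exact (le_csSup (bddAbove_infDist x r hA B) (mem_image_of_mem _ hz)).trans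
      ((le_max_left _ _).trans h)
  · exact (le_csSup (bddAbove_infDist x r hB A) (mem_image_of_mem _ hz)).trans
      ((le_max_right _ _).trans h)

theorem relDist_le {x : Euc N} {r δ : ℝ} (hr : 0 < r) (hδ : 0 ≤ δ) {A B : Set (Euc N)}
    (h1 : ∀ z ∈ B ∩ ball x r, infDist z A ≤ δ * r)
    (h2 : ∀ z ∈ A ∩ ball x r, infDist z B ≤ δ * r) : relDist x r A B ≤ δ := by
  rw [relDist, one_div, inv_mul_eq_div, div_le_iff₀ hr]
  have h0 : 0 ≤ δ * r := by positivity
  refine max_le (Real.sSup_le ?_ h0) (Real.sSup_le ?_ h0)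
  · rintro _ ⟨z, hz, rfl⟩; exact h1 z hz
  · rintro _ ⟨z, hz, rfl⟩; exact h2 z hz

theorem image_inter_ball (R : Euc N ≃ᵢ Euc N) (A : Set (Euc N)) (x : Euc N) (r : ℝ) :
    R '' A ∩ ball (R x) r = R '' (A ∩ ball x r) := by
  rw [← R.image_ball, image_inter R.injective]

theorem relDist_image (R : Euc N ≃ᵢ Euc N) (x : Euc N) (r : ℝ) (A B : Set (Euc N)) :
    relDist (R x) r (R '' A) (R '' B) = relDist x r A B := by
  simp only [relDist, image_inter_ball, image_image, infDist_image R.isometry]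

theorem finrank_lineality_image (R : Euc N ≃ᵢ Euc N) (A : Set (Euc N)) :
    Module.finrank ℝ (lineality A) ≤ Module.finrank ℝ (lineality (R '' A)) := by
  rw [← LinearEquiv.finrank_map_eq (linPart R).toLinearEquiv (lineality A)]
  refine Submodule.finrank_mono ?_
  rintro _ ⟨v, hv, rfl⟩ _ ⟨x, hx, rfl⟩ s
  exact ⟨x + s • v, hv x hx s, by rw [isometry_add, map_smul]; rfl⟩

/-- The orthogonal projection of `Q` to the smaller space `S` has a nontrivial kernel. -/
theorem exists_unit_orthogonal {S Q : Submodule ℝ (Euc N)}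
    (h : Module.finrank ℝ S < Module.finrank ℝ Q) : ∃ v ∈ Q, v ∈ Sᗮ ∧ ‖v‖ = 1 := by
  have hker := LinearMap.ker_ne_bot_of_finrank_lt
    (f := S.orthogonalProjectionOnto.toLinearMap.comp Q.subtype) h
  obtain ⟨⟨v, hv⟩, hvk, hv0⟩ := (Submodule.ne_bot_iff _).1 hker
  have hvk' : v ∈ Sᗮ := by
    rw [← Submodule.orthogonalProjectionOnto_eq_zero_iff]
    exact hvk
  have hvne : v ≠ 0 := fun h => hv0 (Subtype.ext h)
  refine ⟨‖v‖⁻¹ • v, Submodule.smul_mem _ _ hv, Submodule.smul_mem _ _ hvk', ?_⟩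
  rw [norm_smul, norm_inv, norm_norm, inv_mul_cancel₀ (norm_ne_zero_iff.2 hvne)]

end Estimates

/-! ### Separation and replacement for a single fan -/

namespace IsFan
variable {ι : Type*} [Fintype ι] {N : ℕ} {P : Submodule ℝ (Euc N)} {u : ι → Euc N}
  {𝒳 : Set (Set ι)} {k : ℕ}

/-- A fan is quantitatively not invariant in directions orthogonal to its lineality space. -/
theorem exists_displacement (h : IsFan P u 𝒳 k) : ∃ η : ℝ, 0 < η ∧ ∀ v ∈ Pᗮ, ‖v‖ = 1 →
    ∃ y ∈ fanSet P u 𝒳, ‖y‖ < 1 ∧ ∃ s : ℝ, |s| ≤ 1 ∧ η < infDist (y + s • v) (fanSet P u 𝒳) := by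
  have hcomp : IsCompact ((Pᗮ : Set (Euc N)) ∩ sphere 0 1) :=
    (isCompact_sphere 0 1).inter_left (Submodule.closed_of_finiteDimensional _)
  have key : ∃ η : ℝ, 0 < η ∧ ∀ v ∈ (Pᗮ : Set (Euc N)) ∩ sphere 0 1,
      ∃ y ∈ fanSet P u 𝒳, ‖y‖ < 1 ∧ ∃ s : ℝ, |s| ≤ 1 ∧
        η < infDist (y + s • v) (fanSet P u 𝒳) := by
    refine hcomp.induction_on (p := fun S => ∃ η : ℝ, 0 < η ∧ ∀ v ∈ S,
      ∃ y ∈ fanSet P u 𝒳, ‖y‖ < 1 ∧ ∃ s : ℝ, |s| ≤ 1 ∧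
        η < infDist (y + s • v) (fanSet P u 𝒳)) ⟨1, one_pos, by simp⟩ ?_ ?_ ?_
    · rintro S T hST ⟨η, hη, hT⟩
      exact ⟨η, hη, fun v hv => hT v (hST hv)⟩
    · rintro S T ⟨η, hη, hS⟩ ⟨η', hη', hT⟩
      refine ⟨min η η', lt_min hη hη', ?_⟩
      rintro v (hv | hv)
      · obtain ⟨y, hy, hy1, s, hs, hlt⟩ := hS v hv
        exact ⟨y, hy, hy1, s, hs, (min_le_left _ _).trans_lt hlt⟩
      · obtain ⟨y, hy, hy1, s, hs, hlt⟩ := hT v hv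
        exact ⟨y, hy, hy1, s, hs, (min_le_right _ _).trans_lt hlt⟩
    · rintro v ⟨hvP, hv1⟩
      have hvL : v ∉ lineality (fanSet P u 𝒳) := by
        rw [h.lineality_eq]
        intro hv
        have : v = 0 := inner_self_eq_zero (𝕜 := ℝ).1 (Submodule.inner_right_of_mem_orthogonal hv hvP)
        simp [this] at hv1
      obtain ⟨y, hy, s, hys⟩ : ∃ y ∈ fanSet P u 𝒳, ∃ s : ℝ, y + s • v ∉ fanSet P u 𝒳 := by
        by_contra! hcon
        exact hvL hcon
      -- Dilation brings the point into the unit ball and the step below `1`; half the gap persists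
      -- for nearby directions.
      set t : ℝ := (1 + ‖y‖ + |s|)⁻¹ with ht
      have ht0 : 0 < t := by positivity
      have htr : t * (1 + ‖y‖ + |s|) = 1 := by rw [ht]; field_simp
      have hmem : t • y + (t * s) • v ∉ fanSet P u 𝒳 := by
        intro hmem
        have h4 := fanSet_smul_mem (inv_nonneg.2 ht0.le) hmem
        rw [mul_smul, ← smul_add, smul_smul, inv_mul_cancel₀ ht0.ne', one_smul] at h4
        exact hys h4
      have hpos : 0 < infDist (t • y + (t * s) • v) (fanSet P u 𝒳) :=
        (h.isClosed_fanSet.notMem_iff_infDist_pos ⟨y, hy⟩).1 hmem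
      have hcont : Continuous fun w : Euc N => infDist (t • y + (t * s) • w) (fanSet P u 𝒳) :=
        (continuous_infDist_pt _).comp (by fun_prop)
      refine ⟨_, mem_nhdsWithin_of_mem_nhds (hcont.continuousAt.eventually_const_lt
        (half_lt_self hpos)), _, half_pos hpos, fun w hw => ⟨t • y, fanSet_smul_mem ht0.le hy, ?_,
        t * s, ?_, hw⟩⟩
      · rw [norm_smul, Real.norm_of_nonneg ht0.le]
        nlinarith [abs_nonneg s, norm_nonneg y]
      · rw [abs_mul, abs_of_pos ht0]
        nlinarith [abs_nonneg s, norm_nonneg y]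
  obtain ⟨η, hη, hk⟩ := key
  exact ⟨η, hη, fun v hv hv1 => hk v ⟨hv, by simpa using hv1⟩⟩

-- Dropping the coefficients that are small at scale `r` moves `x` to a nearby `x'` around which the
-- fan is the star of the remaining face `Y`. The space of this star has dimension at most the local
-- rank at `x`, so `W` is invariant along a unit vector orthogonal to it. Passing from the fan to
-- `W`, along this vector, and back contradicts `exists_displacement`.
set_option maxHeartbeats 1000000 in
theorem exists_separation (h : IsFan P u 𝒳 k) : ∃ δ : ℝ, 0 < δ ∧ ∀ x ∈ fanSet P u 𝒳,
    ∀ W : Set (Euc N), W.Nonempty →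
      localRank (fanSet P u 𝒳) x < Module.finrank ℝ (lineality W) →
      ∀ r : ℝ, 0 < r → δ < relDist x r (fanSet P u 𝒳) W := by
  obtain ⟨K, hK0, hK⟩ := h.exists_bound
  -- Lower bounds are written as `c⁻¹` so that they persist when `c` grows.
  obtain ⟨c, hc⟩ := exists_forall_of_finite (s := {Y : Set ι | ∃ X ∈ 𝒳, Y ⊆ X}) (toFinite _)
    (p := fun Y c => 0 < c ∧ ∀ v ∈ (starSpace P u Y)ᗮ, ‖v‖ = 1 →
      ∃ y ∈ fanSet (starSpace P u Y) u (ConeStrata.star 𝒳 Y), ‖y‖ < 1 ∧ ∃ s : ℝ, |s| ≤ 1 ∧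
        c⁻¹ < infDist (y + s • v) (fanSet (starSpace P u Y) u (ConeStrata.star 𝒳 Y)))
    (by
      rintro Y c c' hcc ⟨hc, hY⟩
      refine ⟨hc.trans_le hcc, fun v hv hv1 => ?_⟩
      obtain ⟨y, hy, hy1, s, hs, hlt⟩ := hY v hv hv1
      exact ⟨y, hy, hy1, s, hs, (inv_anti₀ hc hcc).trans_lt hlt⟩) (by
      rintro Y ⟨X, hX, hY⟩
      obtain ⟨η, hη, hv⟩ := (h.star hX hY).exists_displacement
      exact ⟨η⁻¹, inv_pos.2 hη, by simpa using hv⟩)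
  have hc0 : 0 < c := by
    obtain ⟨X, hX⟩ := h.nonempty
    exact (hc X ⟨X, hX, subset_rfl⟩).1
  set U : ℝ := 1 + ∑ i, ‖u i‖ with hU
  have hU0 : 0 ≤ ∑ i, ‖u i‖ := Finset.sum_nonneg fun i _ => norm_nonneg _
  have hUpos : 0 < U := by positivity
  -- Gives `K * (κ * r) ≤ τ`, as `inter_ball_eq` requires on the ball of radius `κ * r`.
  set κ : ℝ := min (1 / (4 * U * K)) (1 / 4) with hκ
  have hκ0 : 0 < κ := by positivity
  have hκ4 : κ ≤ 1 / 4 := min_le_right _ _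
  have hκK : κ ≤ 1 / (4 * U * K) := min_le_left _ _
  clear_value κ
  -- The three bounds keep the displaced point of `W` in `ball x r`, keep `q` in the ball where the
  -- fan is the star, and ensure `4 * (δ * r) ≤ c⁻¹ * σ`.
  set δ : ℝ := min (1 / 16) (min (κ / 8) (c⁻¹ * κ / 16)) with hδ
  have hδ0 : 0 < δ := by positivity
  have hδ1 : δ ≤ 1 / 16 := min_le_left _ _
  have hδ2 : δ ≤ κ / 8 := (min_le_right _ _).trans (min_le_left _ _)
  have hδ3 : δ ≤ c⁻¹ * κ / 16 := (min_le_right _ _).trans (min_le_right _ _)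
  clear_value δ
  refine ⟨δ, hδ0, fun x hx W hW hrank r hr => ?_⟩
  by_contra! hle
  obtain ⟨hd1, hd2⟩ := infDist_le_of_relDist hr ⟨x, hx⟩ hW hle
  obtain ⟨X, hX, a, ha, ha', hxa⟩ := hx
  set τ : ℝ := r / (4 * U) with hτ
  have hτ0 : 0 < τ := by positivity
  obtain ⟨b, x', hb, hb1, hb2, hxb, hdist⟩ := exists_truncation ha hxa hτ0
  have hdist' : dist x x' ≤ r / 4 := by
    refine hdist.trans ?_
    rw [hτ, div_mul_eq_mul_div, div_le_div_iff₀ (by positivity) (by norm_num)]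
    nlinarith
  set Y : Set ι := {i | τ ≤ a i} with hY
  have hYX : Y ⊆ X := fun i hi => by
    by_contra hi'
    have : τ ≤ a i := hi
    rw [ha' i hi'] at this
    linarith
  have hbX : ∀ i, i ∉ X → b i = 0 := fun i hi => hb1 i (by rw [ha' i hi]; exact hτ0)
  have hρτ : K * (κ * r) ≤ τ := by
    rw [le_div_iff₀ (by positivity)] at hκK
    rw [hτ, le_div_iff₀ (by positivity)]
    nlinarith
  have hball := inter_ball_eq hK hK0 hX hYX hb hbX hxb (ρ := κ * r)
    (fun i hi => by rw [hb2 i hi]; exact hρτ.trans hi)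
  have hx'S : x' ∈ starSpace P u Y := mem_starSpace.2 ⟨b, fun i hi => hb1 i (not_le.1 hi), hxb⟩
  have hfr : Module.finrank ℝ (starSpace P u Y) < Module.finrank ℝ (lineality W) := by
    refine lt_of_le_of_lt ?_ hrank
    rw [h.finrank_starSpace hX hYX, h.localRank_eq hX ha ha' hxa]
    exact Nat.add_le_add_left (ncard_le_ncard (fun i hi => hτ0.trans_le hi) (toFinite _)) _
  obtain ⟨v, hvW, hvS, hv1⟩ := exists_unit_orthogonal hfr
  obtain ⟨-, hcv⟩ := hc Y ⟨X, hX, hYX⟩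
  obtain ⟨y, hy, hy1, s, hs, hlt⟩ := hcv v hvS hv1
  set σ : ℝ := κ * r / 4 with hσ
  have hσ0 : 0 < σ := div_pos (mul_pos hκ0 hr) (by norm_num)
  have hσr : σ ≤ r / 16 := by rw [hσ]; nlinarith
  set z := σ • y + x' with hz
  have hzS : z ∈ fanSet (starSpace P u Y) u (ConeStrata.star 𝒳 Y) :=
    fanSet_add_mem (fanSet_smul_mem hσ0.le hy) hx'S
  have hzx' : dist z x' < σ := by
    rw [hz, dist_eq_norm, add_sub_cancel_right, norm_smul, Real.norm_of_nonneg hσ0.le]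
    nlinarith
  have hzV : z ∈ fanSet P u 𝒳 := (hball.symm.subset ⟨hzS, by rw [mem_ball]; linarith⟩).1
  have hzx : dist z x < r := by
    have := dist_triangle z x' x
    rw [dist_comm x' x] at this
    linarith
  have hδr : 0 < δ * r := mul_pos hδ0 hr
  obtain ⟨w, hw, hzw⟩ := (infDist_lt_iff hW).1
    ((hd2 z ⟨hzV, hzx⟩).trans_lt (lt_two_mul_self hδr))
  have hσv : ‖(σ * s) • v‖ ≤ σ := by
    rw [norm_smul, hv1, mul_one, Real.norm_eq_abs, abs_mul, abs_of_pos hσ0]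
    nlinarith
  have hδ1r : δ * r ≤ r / 16 := by nlinarith
  have hwx : dist (w + (σ * s) • v) x < r := by
    have h1 := dist_triangle (w + (σ * s) • v) w x
    have h2 := dist_triangle w z x
    have h3 := dist_triangle z x' x
    rw [dist_self_add_left] at h1
    rw [dist_comm x' x] at h3
    rw [dist_comm] at hzw
    linarith
  obtain ⟨q, hq, hwq⟩ := (infDist_lt_iff ⟨z, hzV⟩).1
    ((hd1 _ ⟨hvW w hw (σ * s), hwx⟩).trans_lt (lt_two_mul_self hδr))
  have hqz : dist (z + (σ * s) • v) q < 4 * (δ * r) := by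
    have h1 := dist_triangle (z + (σ * s) • v) (w + (σ * s) • v) q
    rw [dist_add_right] at h1
    linarith
  have hδ2r : δ * r ≤ κ * r / 8 := by nlinarith
  have hqx' : dist q x' < κ * r := by
    have h1 := dist_triangle q (z + (σ * s) • v) x'
    have h2 := dist_triangle (z + (σ * s) • v) z x'
    rw [dist_self_add_left] at h2
    rw [dist_comm q (z + (σ * s) • v)] at h1
    linarith
  have hqS := (hball.subset ⟨hq, hqx'⟩).1
  have hq' : σ⁻¹ • (q - x') ∈ fanSet (starSpace P u Y) u (ConeStrata.star 𝒳 Y) := by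
    rw [sub_eq_add_neg]
    exact fanSet_smul_mem (inv_nonneg.2 hσ0.le) (fanSet_add_mem hqS (Submodule.neg_mem _ hx'S))
  have hfinal := hlt.trans_le (infDist_le_dist_of_mem hq')
  have heq : y + s • v = σ⁻¹ • (z + (σ * s) • v - x') := by
    have h1 : z + (σ * s) • v - x' = σ • (y + s • v) := by
      rw [hz, smul_add, smul_smul]; abel
    rw [h1, smul_smul, inv_mul_cancel₀ hσ0.ne', one_smul]
  rw [heq, dist_smul₀, dist_sub_right, Real.norm_of_nonneg (inv_nonneg.2 hσ0.le), inv_mul_eq_div,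
    lt_div_iff₀ hσ0] at hfinal
  have hδ3r : δ * r ≤ c⁻¹ * κ / 16 * r := by nlinarith
  have : c⁻¹ * σ = c⁻¹ * κ / 16 * r * 4 := by rw [hσ]; ring
  linarith

/-- A ball in which a fan comes far from the faces of small dimension sees a star only. -/
theorem exists_star_eq (h : IsFan P u 𝒳 k) : ∃ C : ℝ, ∀ (c : Euc N) (ρ : ℝ), 0 < ρ → ∀ t : ℕ,
    (fanSet P u 𝒳 ∩ ball c ρ).Nonempty →
    (∀ x ∈ fanSet P u 𝒳, dist x c < C * ρ → t < localRank (fanSet P u 𝒳) x) →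
    ∃ X ∈ 𝒳, ∃ Y ⊆ X, t < Module.finrank ℝ P + Y.ncard ∧ ∀ Y' ⊆ Y,
      fanSet P u 𝒳 ∩ ball c ρ =
        fanSet (starSpace P u Y') u (ConeStrata.star 𝒳 Y') ∩ ball c ρ := by
  obtain ⟨K, hK0, hK⟩ := h.exists_bound
  -- Dropping coefficients below `K * (2 * ρ)` moves a point of the ball by at most `2 * K * ρ * ∑
  -- ‖u i‖`, so the truncated point is within `C * ρ` of the centre.
  refine ⟨1 + 2 * K * ∑ i, ‖u i‖, fun c ρ hρ t hne hrank => ?_⟩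
  obtain ⟨x, ⟨X, hX, a, ha, ha', hxa⟩, hxc⟩ := hne
  have hτ0 : 0 < K * (2 * ρ) := by positivity
  have hYX : {i | K * (2 * ρ) ≤ a i} ⊆ X := fun i hi => by
    by_contra hi'
    have : K * (2 * ρ) ≤ a i := hi
    rw [ha' i hi'] at this
    linarith
  refine ⟨X, hX, {i | K * (2 * ρ) ≤ a i}, hYX, ?_, fun Y' hY' => ?_⟩
  · obtain ⟨b, x', hb, hb1, hb2, hxb, hdist⟩ := exists_truncation ha hxa hτ0
    have hbX : ∀ i, i ∉ X → b i = 0 := fun i hi => hb1 i (by rw [ha' i hi]; exact hτ0)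
    have hlt := hrank x' ⟨X, hX, b, hb, hbX, hxb⟩ (by
      have h1 := dist_triangle x' x c
      rw [dist_comm x' x] at h1
      have h2 := mem_ball.1 hxc
      nlinarith)
    rw [h.localRank_eq hX hb hbX hxb] at hlt
    refine hlt.trans_le (Nat.add_le_add_left (ncard_le_ncard (fun i hi => ?_) (toFinite _)) _)
    by_contra hi'
    have h3 : 0 < b i := hi
    rw [hb1 i (not_le.1 hi')] at h3
    exact h3.false
  · have hball := inter_ball_eq hK hK0 hX (hY'.trans hYX) ha ha' hxa (ρ := 2 * ρ)
      (fun i hi => hY' hi)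
    have hsub : ball c ρ ⊆ ball x (2 * ρ) := ball_subset_ball' (by
      have := mem_ball.1 hxc
      rw [dist_comm] at this
      linarith)
    rw [← inter_eq_self_of_subset_right hsub, ← inter_assoc, hball, inter_assoc]

/-- The complement is open, nonempty and invariant under dilations, so it contains balls of every
radius; one is translated onto the given ball. -/
theorem exists_image_disjoint (h : IsFan P u 𝒳 k) (hP : P ≠ ⊤) (c : Euc N) {ρ : ℝ} (hρ : 0 < ρ) :
    ∃ R : Euc N ≃ᵢ Euc N, R '' fanSet P u 𝒳 ∩ ball c ρ = ∅ := by
  obtain ⟨z, hz⟩ : ∃ z, z ∉ fanSet P u 𝒳 := by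
    by_contra! hcon
    refine hP (eq_top_iff.2 fun v _ => ?_)
    rw [← h.lineality_eq]
    exact fun x _ s => hcon _
  obtain ⟨r, hr, hball⟩ := Metric.isOpen_iff.1 h.isClosed_fanSet.isOpen_compl z hz
  refine ⟨IsometryEquiv.addRight (c - (ρ / r) • z), ?_⟩
  rw [eq_empty_iff_forall_notMem]
  rintro _ ⟨⟨y, hy, rfl⟩, hyc⟩
  have hρr : 0 < ρ / r := by positivity
  refine hball (a := (ρ / r)⁻¹ • y) ?_ (fanSet_smul_mem (inv_nonneg.2 hρr.le) hy)
  have h1 : y = (ρ / r) • ((ρ / r)⁻¹ • y) := by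
    rw [smul_smul, mul_inv_cancel₀ hρr.ne', one_smul]
  have h2 : y + (c - (ρ / r) • z) - c = (ρ / r) • ((ρ / r)⁻¹ • y - z) := by
    rw [smul_sub, ← h1]; abel
  rw [mem_ball, IsometryEquiv.addRight_apply, dist_eq_norm, h2, norm_smul,
    Real.norm_of_nonneg hρr.le, div_mul_eq_mul_div, div_lt_iff₀ hr, mul_lt_mul_iff_right₀ hρ] at hyc
  rwa [mem_ball, dist_eq_norm]

end IsFan

/-! ### Existence of admissible constants -/

section Constants
variable {n N' N : ℕ} {ℬ : Set (Set (Euc N))}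

theorem exists_isSeparationConstant (hN : N' + n ≤ N) (hℬ : ℬ ⊆ allTypes n N' N)
    (hfin : ((Quotient.mk (isometrySetoid N)) '' ℬ).Finite) :
    ∃ δ₀ : ℝ, IsSeparationConstant n N' ℬ δ₀ := by
  obtain ⟨c, hc⟩ := exists_uniform hN hℬ hfin (p := fun V c => 0 < c ∧ ∀ m t : ℕ, m ≤ t → t < n →
      V ∈ blowUpsOfType n N' ℬ m → ∀ x ∈ spine n N' t V, ∀ k : ℕ, t < k → k ≤ n →
      ∀ W ∈ blowUpsOfType n N' ℬ k, ∀ r : ℝ, 0 < r → (W ∩ ball x r).Nonempty →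
      c⁻¹ < relDist x r V W) (by
    rintro V c c' hcc ⟨hc, h⟩
    refine ⟨hc.trans_le hcc, fun m t hmt htn hV x hx k htk hkn W hW r hr hne => ?_⟩
    exact (inv_anti₀ hc hcc).trans_lt (h m t hmt htn hV x hx k htk hkn W hW r hr hne)) (by
    intro ι _ P u 𝒳 hgood
    obtain ⟨δ, hδ, hsep⟩ := hgood.fan.exists_separation
    refine ⟨δ⁻¹, fun R => ⟨inv_pos.2 hδ, fun m t hmt htn hV x hx k htk hkn W hW r hr hne => ?_⟩⟩
    obtain ⟨hxV, hrank⟩ := (mem_spine hN htn.le hV.2).1 hx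
    obtain ⟨x, hx', rfl⟩ := hxV
    rw [localRank_image] at hrank
    obtain ⟨W, rfl⟩ : ∃ W', W = R '' W' := ⟨R.symm '' W, by simp [image_image]⟩
    rw [relDist_image, inv_inv]
    refine hsep x hx' W (image_nonempty.1 hne.left) (hrank.trans_lt ?_) r hr
    -- The type `k` of `W` enters only as the dimension of its lineality space.
    obtain ⟨𝒳₀, S, hp⟩ := hW.2
    obtain ⟨ι', _, P', u', 𝒳', hfan, hrk, -, hWS, -⟩ := hp.exists_fan hN
    have hW' : W = (S.trans R.symm) '' fanSet P' u' 𝒳' := by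
      have := congrArg (image R.symm) hWS
      rw [image_image, image_image] at this
      simp only [IsometryEquiv.symm_apply_apply, image_id'] at this
      exact this
    rw [hW']
    refine lt_of_lt_of_le ?_ (finrank_lineality_image _ _)
    rw [hfan.lineality_eq, hrk]
    exact htk)
  -- The maximum with `11` gives `δ₀ < 1 / 10`, and positivity even when there are no blow-ups.
  have hpos : 0 < max c 11 := by positivity
  have hinv : (max c 11)⁻¹ ≤ 11⁻¹ := inv_anti₀ (by norm_num) (le_max_right _ _)
  refine ⟨(max c 11)⁻¹, inv_pos.2 hpos, hinv.trans_lt (by norm_num),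
    fun m t hmt htn V hV x hx k htk hkn W hW r hr hne => ?_⟩
  obtain ⟨hc0, h⟩ := hc V hV.1
  exact (inv_anti₀ hc0 (le_max_left _ _)).trans_lt (h m t hmt htn hV x hx k htk hkn W hW r hr hne)

theorem exists_isReplacementConstant (hN' : n < N') (hN : N' + n ≤ N) (hℬ : ℬ ⊆ allTypes n N' N)
    (hfin : ((Quotient.mk (isometrySetoid N)) '' ℬ).Finite) :
    ∃ n₀ : ℝ, IsReplacementConstant n N' ℬ n₀ := by
  obtain ⟨C, hC⟩ := exists_uniform hN hℬ hfin (p := fun W C => ∀ m t : ℕ, m ≤ t → t < n →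
      W ∈ blowUpsOfType n N' ℬ m → ∀ (c : Euc N) (ρ : ℝ), 0 < ρ →
      ((W ∩ ball c ρ).Nonempty → ball c (C * ρ) ∩ spine n N' t W = ∅ →
        ∃ u : ℕ, t < u ∧ u ≤ n ∧ ∃ Y ∈ blowUpsOfType n N' ℬ u, W ∩ ball c ρ = Y ∩ ball c ρ) ∧
      ((∀ Y ∈ blowUpsOfType n N' ℬ (t + 1), W ∩ ball c ρ ≠ Y ∩ ball c ρ) →
        (ball c (C * ρ) ∩ spine n N' t W).Nonempty)) (by
    intro W C C' hCC h m t hmt htn hW c ρ hρ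
    have hsub : ball c (C * ρ) ∩ spine n N' t W ⊆ ball c (C' * ρ) ∩ spine n N' t W :=
      inter_subset_inter_left _ (ball_subset_ball (mul_le_mul_of_nonneg_right hCC hρ.le))
    obtain ⟨h1, h2⟩ := h m t hmt htn hW c ρ hρ
    exact ⟨fun hne he => h1 hne (subset_empty_iff.1 (hsub.trans he.subset)),
      fun hY => (h2 hY).mono hsub⟩) (by
    intro ι _ P u 𝒳 hgood
    obtain ⟨C, hC⟩ := hgood.fan.exists_star_eq
    refine ⟨C, fun R m t hmt htn hV c ρ hρ => ?_⟩
    obtain rfl := hV.2.unique hN (hgood.isType hN R)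
    obtain ⟨c, rfl⟩ := R.surjective c
    have core : (R '' fanSet P u 𝒳 ∩ ball (R c) ρ).Nonempty →
        ball (R c) (C * ρ) ∩ spine n N' t (R '' fanSet P u 𝒳) = ∅ →
        ∃ X ∈ 𝒳, ∃ Y ⊆ X, t < Module.finrank ℝ P + Y.ncard ∧ ∀ Y' ⊆ Y,
          R '' fanSet P u 𝒳 ∩ ball (R c) ρ =
            R '' fanSet (starSpace P u Y') u (star 𝒳 Y') ∩ ball (R c) ρ := by
      intro hne he
      rw [image_inter_ball, image_nonempty] at hne
      obtain ⟨X, hX, Y, hY, htY, heq⟩ := hC c ρ hρ t hne (fun x hx hxc => by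
        by_contra! hle
        have : R x ∈ ball (R c) (C * ρ) ∩ spine n N' t (R '' fanSet P u 𝒳) := by
          refine ⟨by rwa [mem_ball, R.dist_eq], (mem_spine hN htn.le hV.2).2
            ⟨mem_image_of_mem _ hx, ?_⟩⟩
          rwa [localRank_image]
        rw [he] at this
        exact this)
      refine ⟨X, hX, Y, hY, htY, fun Y' hY' => ?_⟩
      rw [image_inter_ball, image_inter_ball, heq Y' hY']
    constructor
    · intro hne he
      obtain ⟨X, hX, Y, hY, htY, heq⟩ := core hne he
      exact ⟨_, htY, (hgood.finrank_star hX hY).2, _, hgood.star_mem_type hN hX hY R,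
        heq Y subset_rfl⟩
    · intro hno
      by_contra hemp
      rw [not_nonempty_iff_eq_empty] at hemp
      rcases (R '' fanSet P u 𝒳 ∩ ball (R c) ρ).eq_empty_or_nonempty with he | hne
      -- The ball misses the set, so a member of type `t + 1` missing it is needed. A star of that
      -- type is not the whole space because `t + 1 ≤ n < N`.
      · obtain ⟨X, hX⟩ := hgood.fan.nonempty
        obtain ⟨Y, -, hYX, hY⟩ := exists_subsuperset_card_eq (empty_subset X)
          (n := t + 1 - Module.finrank ℝ P) (by simp)
          (by rw [hgood.fan.card X hX]; omega)
        have hstar := (hgood.finrank_star hX hYX).1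
        obtain ⟨S, hS⟩ := ((hgood.star hX hYX).fan).exists_image_disjoint (by
          intro htop
          rw [htop, finrank_top, finrank_euclideanSpace_fin] at hstar
          omega) (R c) hρ
        refine hno (S '' fanSet (starSpace P u Y) u (star 𝒳 Y)) ?_ (he.trans hS.symm)
        have := hgood.star_mem_type hN hX hYX S
        rwa [hY, show Module.finrank ℝ P + (t + 1 - Module.finrank ℝ P) = t + 1 by omega] at this
      · obtain ⟨X, hX, Y, hY, htY, heq⟩ := core hne hemp
        -- Condition (ii) asks for type exactly `t + 1`, so `Y` is cut down to a face of the right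
        -- size.
        obtain ⟨Y', -, hYY, hY'⟩ := exists_subsuperset_card_eq (empty_subset Y)
          (n := t + 1 - Module.finrank ℝ P) (by simp) (by omega)
        refine hno _ ?_ (heq Y' hYY)
        have := hgood.star_mem_type hN hX (hYY.trans hY) R
        rwa [hY', show Module.finrank ℝ P + (t + 1 - Module.finrank ℝ P) = t + 1 by omega] at this)
  refine ⟨max C 11, lt_of_lt_of_le (by norm_num) (le_max_right _ _), ?_⟩
  intro m t hmt htn W hW c ρ hρ
  have hsub : ball c (C * ρ) ∩ spine n N' t W ⊆ ball c (max C 11 * ρ) ∩ spine n N' t W :=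
    inter_subset_inter_left _ (ball_subset_ball
      (mul_le_mul_of_nonneg_right (le_max_left _ _) hρ.le))
  obtain ⟨h1, h2⟩ := hC W hW.1 m t hmt htn hW c ρ hρ
  exact ⟨fun hne he => h1 hne (subset_empty_iff.1 (hsub.trans he.subset)),
    fun hY => (h2 hY).mono hsub⟩

theorem blowUpsOfType_image {m : ℕ} {V : Set (Euc N)} (hV : V ∈ blowUpsOfType n N' ℬ m)
    (S : Euc N ≃ᵢ Euc N) : S '' V ∈ blowUpsOfType n N' ℬ m := by
  obtain ⟨⟨W, hW, x, hx, R, r₀, hr₀, hV1⟩, 𝒳, T, hm, hc, hnf, hV2⟩ := hV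
  refine ⟨⟨W, hW, x, hx, R.trans S, r₀, hr₀, fun r hr hrr => ?_⟩, 𝒳, T.trans S, hm, hc, hnf, ?_⟩
  · rw [hV1 r hr hrr, image_image]; rfl
  · rw [hV2, image_image]; rfl

theorem localRank_le (hN : N' + n ≤ N) (hℬ : ℬ ⊆ allTypes n N' N) {V : Set (Euc N)}
    (hV : V ∈ blowUps ℬ) {x : Euc N} (hx : x ∈ V) : localRank V x ≤ n := by
  obtain ⟨ι, _, P, u, 𝒳, R, hgood, rfl⟩ := exists_good hN hℬ hV
  obtain ⟨x, ⟨X, hX, a, ha, ha', hxa⟩, rfl⟩ := hx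
  rw [localRank_image, hgood.fan.localRank_eq hX ha ha' hxa]
  refine (hgood.finrank_star hX fun i hi => ?_).2
  by_contra hi'
  exact (ha' i hi').not_gt hi

end Constants

/-! ### Two-sided closeness in a ball -/

section Near
variable {N : ℕ}

/-- In the ball `B(x, r)` each of the sets is within distance `d` of the other one. -/
def Near (x : Euc N) (r d : ℝ) (A B : Set (Euc N)) : Prop :=
  (∀ z ∈ A ∩ ball x r, ∃ w ∈ B, dist z w < d) ∧ ∀ z ∈ B ∩ ball x r, ∃ w ∈ A, dist z w < d

theorem Near.symm {x : Euc N} {r d : ℝ} {A B : Set (Euc N)} (h : Near x r d A B) :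
    Near x r d B A := ⟨h.2, h.1⟩

theorem Near.mono {x x' : Euc N} {r r' d d' : ℝ} {A B : Set (Euc N)} (h : Near x r d A B)
    (hr : r' + dist x' x ≤ r) (hd : d ≤ d') : Near x' r' d' A B := by
  have hsub : ball x' r' ⊆ ball x r := ball_subset_ball' hr
  refine ⟨fun z hz => ?_, fun z hz => ?_⟩
  · obtain ⟨w, hw, hlt⟩ := h.1 z ⟨hz.1, hsub hz.2⟩
    exact ⟨w, hw, hlt.trans_le hd⟩
  · obtain ⟨w, hw, hlt⟩ := h.2 z ⟨hz.1, hsub hz.2⟩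
    exact ⟨w, hw, hlt.trans_le hd⟩

theorem Near.shrink {x : Euc N} {r r' d d' : ℝ} {A B : Set (Euc N)} (h : Near x r d A B)
    (hr : r' ≤ r) (hd : d ≤ d') : Near x r' d' A B :=
  h.mono (by simpa using hr) hd

theorem Near.trans {x : Euc N} {r r' d e : ℝ} {A B C : Set (Euc N)} (h : Near x r d A B)
    (h' : Near x r e B C) (hd : r' + d ≤ r) (he : r' + e ≤ r) (hd0 : 0 ≤ d) :
    Near x r' (d + e) A C := by
  refine ⟨fun z hz => ?_, fun z hz => ?_⟩
  · have hz2 := mem_ball.1 hz.2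
    obtain ⟨w, hw, hlt⟩ := h.1 z ⟨hz.1, by rw [mem_ball]; linarith⟩
    have h1 := dist_triangle w z x
    rw [dist_comm w z] at h1
    obtain ⟨y, hy, hlt'⟩ := h'.1 w ⟨hw, by rw [mem_ball]; linarith⟩
    exact ⟨y, hy, (dist_triangle z w y).trans_lt (by linarith)⟩
  · have hz2 := mem_ball.1 hz.2
    obtain ⟨w, hw, hlt⟩ := h'.2 z ⟨hz.1, by rw [mem_ball]; linarith⟩
    have h1 := dist_triangle w z x
    rw [dist_comm w z] at h1
    obtain ⟨y, hy, hlt'⟩ := h.2 w ⟨hw, by rw [mem_ball]; linarith⟩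
    exact ⟨y, hy, (dist_triangle z w y).trans_lt (by linarith)⟩

theorem Near.congr {x : Euc N} {r s d : ℝ} {A B C : Set (Euc N)} (h : Near x s d A B)
    (hBC : B ∩ ball x r = C ∩ ball x r) (hs : s + d ≤ r) (hd : 0 ≤ d) : Near x s d A C := by
  refine ⟨fun z hz => ?_, fun z hz => ?_⟩
  · obtain ⟨w, hw, hlt⟩ := h.1 z hz
    have h1 := dist_triangle w z x
    rw [dist_comm w z] at h1
    have hz2 := mem_ball.1 hz.2
    exact ⟨w, (hBC.subset ⟨hw, by rw [mem_ball]; linarith⟩).1, hlt⟩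
  · exact h.2 z ⟨(hBC.symm.subset ⟨hz.1, ball_subset_ball (by linarith) hz.2⟩).1, hz.2⟩

theorem Near.relDist_le {x : Euc N} {r d δ : ℝ} {A B : Set (Euc N)} (h : Near x r d A B)
    (hr : 0 < r) (hδ : 0 ≤ δ) (hd : d ≤ δ * r) : relDist x r A B ≤ δ := by
  refine ConeStrata.relDist_le hr hδ (fun z hz => ?_) (fun z hz => ?_)
  · obtain ⟨w, hw, hlt⟩ := h.2 z hz
    exact (infDist_le_dist_of_mem hw).trans (hlt.le.trans hd)
  · obtain ⟨w, hw, hlt⟩ := h.1 z hz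
    exact (infDist_le_dist_of_mem hw).trans (hlt.le.trans hd)

theorem near_of_relDist_lt {x : Euc N} {r δ : ℝ} (hr : 0 < r) {A B : Set (Euc N)}
    (hA : A.Nonempty) (hB : B.Nonempty) (h : relDist x r A B < δ) : Near x r (δ * r) A B := by
  obtain ⟨h1, h2⟩ := infDist_le_of_relDist hr hA hB le_rfl
  have hlt := mul_lt_mul_of_pos_right h hr
  exact ⟨fun z hz => (infDist_lt_iff hB).1 ((h2 z hz).trans_lt hlt),
    fun z hz => (infDist_lt_iff hA).1 ((h1 z hz).trans_lt hlt)⟩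

theorem relDist_nonneg {x : Euc N} {r : ℝ} (hr : 0 < r) (A B : Set (Euc N)) :
    0 ≤ relDist x r A B := by
  refine mul_nonneg (by positivity) (le_max_of_le_left (Real.sSup_nonneg ?_))
  rintro _ ⟨z, _, rfl⟩
  exact infDist_nonneg

theorem near_addRight (x v : Euc N) (r : ℝ) {d : ℝ} (A : Set (Euc N)) (hd : ‖v‖ < d) :
    Near x r d A (IsometryEquiv.addRight v '' A) := by
  refine ⟨fun z hz => ⟨z + v, mem_image_of_mem _ hz.1, by simpa using hd⟩, ?_⟩
  rintro _ ⟨⟨z, hz, rfl⟩, _⟩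
  exact ⟨z, hz, by simpa using hd⟩

end Near

/-! ### Propagation through scales and the strata -/

section Strata
variable {n N' N : ℕ} {ℬ : Set (Set (Euc N))} {δ₀ n₀ ε : ℝ} {E : Set (Euc N)} {x : Euc N}

/-- At the point `x` and scale `r` the set `E` is close to a member of the family of blow-ups
whose type is at least `t`. -/
def CloseToType (n N' : ℕ) (ℬ : Set (Set (Euc N))) (E : Set (Euc N)) (x : Euc N) (δ : ℝ) (t : ℕ)
    (r : ℝ) : Prop :=
  ∃ u : ℕ, t ≤ u ∧ u ≤ n ∧ ∃ Y ∈ blowUpsOfType n N' ℬ u, Near x r (δ * r) E Y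

/-- The requirement that `W` meet the ball is automatic: `x` itself has a point of `W` within `δ₀ *
r < r`. -/
theorem IsSeparationConstant.not_near (hδ : IsSeparationConstant n N' ℬ δ₀) {m t k : ℕ}
    (hmt : m ≤ t) (htk : t < k) (hkn : k ≤ n) {V W : Set (Euc N)}
    (hV : V ∈ blowUpsOfType n N' ℬ m) (hx : x ∈ spine n N' t V) (hxV : x ∈ V)
    (hW : W ∈ blowUpsOfType n N' ℬ k) {r : ℝ} (hr : 0 < r) : ¬ Near x r (δ₀ * r) V W := by
  intro h
  obtain ⟨hδ0, hδ1, hsep⟩ := hδ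
  obtain ⟨w, hw, hlt⟩ := h.1 x ⟨hxV, mem_ball_self hr⟩
  refine (hsep m t hmt (htk.trans_le hkn) V hV x hx k htk hkn W hW r hr ⟨w, hw, ?_⟩).not_ge
    (h.relDist_le hr hδ0.le le_rfl)
  rw [mem_ball, dist_comm]
  nlinarith

/-- If `E` is close to a member of type at least `t`, then its approximation agrees in a smaller
ball with a member of type at least `t`. -/
theorem exists_eq_of_closeToType (hN : N' + n ≤ N) (hℬ : ℬ ⊆ allTypes n N' N)
    (hδ : IsSeparationConstant n N' ℬ δ₀) (hn₀ : IsReplacementConstant n N' ℬ n₀)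
    (hε : 0 < ε) (hε1 : ε ≤ δ₀ / 8) {t : ℕ} {r : ℝ} (hr : 0 < r)
    (ht : CloseToType n N' ℬ E x (δ₀ / 8) t r) {Z : Set (Euc N)} (hZ : Z ∈ blowUps ℬ)
    (hxZ : x ∈ Z) (hEZ : Near x r (ε * r) E Z) :
    ∃ u : ℕ, t ≤ u ∧ u ≤ n ∧ ∃ Y ∈ blowUpsOfType n N' ℬ u,
      Z ∩ ball x (r / (4 * n₀)) = Y ∩ ball x (r / (4 * n₀)) := by
  obtain ⟨m, hm, hZm⟩ := exists_isType hN hℬ hZ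
  rcases le_or_gt t m with htm | hmt
  · exact ⟨m, htm, hm, Z, hZm, rfl⟩
  obtain ⟨k, htk, hkn, Y, hY, hEY⟩ := ht
  have hn0 : 0 < n₀ := lt_trans (by norm_num) hn₀.1
  have hδ0 := hδ.1
  have hδ1 := hδ.2.1
  have hρ : 0 < r / (4 * n₀) := by positivity
  -- Here `t > m`, so `t - 1` is not truncated. A point of the `(t - 1)`-spine of `Z` in `ball x (r
  -- / 4)` would contradict separation from `Y` at scale `r / 4`.
  obtain ⟨u, hu, hun, Y', hY', heq⟩ := (hn₀.2 m (t - 1) (by omega) (by omega) Z hZm x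
    (r / (4 * n₀)) hρ).1 ⟨x, hxZ, mem_ball_self hρ⟩ (by
      rw [eq_empty_iff_forall_notMem]
      rintro y ⟨hyx, hy⟩
      have hyZ := ((mem_spine hN (by omega) hZm.2).1 hy).1
      have hrr : n₀ * (r / (4 * n₀)) = r / 4 := by field_simp
      rw [hrr, mem_ball] at hyx
      refine hδ.not_near (show m ≤ t - 1 by omega) (by omega) hkn hZm hy hyZ hY
        (r := r / 4) (by positivity) ?_
      have hεr : ε * r ≤ δ₀ / 8 * r := mul_le_mul_of_nonneg_right hε1 hr.le
      have hδr : δ₀ / 8 * r ≤ r / 2 := by nlinarith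
      have htr := hEZ.symm.trans hEY (r' := r / 2) (by linarith) (by linarith) (by positivity)
      exact htr.mono (by linarith) (by linarith))
  exact ⟨u, by omega, hun, Y', hY', heq⟩

/-- After the replacement the error is again `ε * r`, not an accumulation of `δ₀ / 8`. With `q = 1 /
(8 * n₀)` it stays below `δ₀ / 8 * r'` down to `r' = q ^ 2 * r`, whence the constant `512 = 8 * 8 ^
2`. -/
theorem closeToType_step (hN : N' + n ≤ N) (hℬ : ℬ ⊆ allTypes n N' N)
    (hδ : IsSeparationConstant n N' ℬ δ₀) (hn₀ : IsReplacementConstant n N' ℬ n₀)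
    (hε : 0 < ε) (hε1 : ε * (512 * n₀ ^ 2) ≤ δ₀)
    (hE : ∀ r : ℝ, 0 < r → ∃ Z ∈ blowUps ℬ, x ∈ Z ∧ Near x r (ε * r) E Z) {t : ℕ} {r r' : ℝ}
    (hr : 0 < r) (ht : CloseToType n N' ℬ E x (δ₀ / 8) t r) (hr1 : (1 / (8 * n₀)) ^ 2 * r ≤ r')
    (hr2 : r' ≤ 1 / (8 * n₀) * r) : CloseToType n N' ℬ E x (δ₀ / 8) t r' := by
  have hn10 := hn₀.1
  have hn0 : 0 < n₀ := lt_trans (by norm_num) hn₀.1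
  have hδ0 := hδ.1
  have hδ1 := hδ.2.1
  have hn1 : 100 ≤ n₀ ^ 2 := by nlinarith
  have hε2 : ε ≤ δ₀ / 8 := by nlinarith
  have hε3 : ε * (8 * n₀) ≤ 1 := by nlinarith
  obtain ⟨Z, hZ, hxZ, hEZ⟩ := hE r hr
  obtain ⟨u, htu, hun, Y, hY, heq⟩ := exists_eq_of_closeToType hN hℬ hδ hn₀ hε hε2 hr ht hZ hxZ hEZ
  refine ⟨u, htu, hun, Y, hY, ?_⟩
  have h1 : 1 / (8 * n₀) * r + ε * r ≤ r / (4 * n₀) := by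
    rw [le_div_iff₀ (by positivity)]
    have : (1 / (8 * n₀) * r + ε * r) * (4 * n₀) = r / 2 + (ε * (8 * n₀)) * r / 2 := by
      field_simp; ring
    rw [this]
    nlinarith
  have h2 : Near x (1 / (8 * n₀) * r) (ε * r) E Y :=
    (hEZ.shrink (by
      have : 0 < ε * r := by positivity
      have : r / (4 * n₀) ≤ r := div_le_self hr.le (by linarith)
      linarith) le_rfl).congr heq h1 (by positivity)
  refine h2.shrink hr2 ?_
  have h3 : ε ≤ δ₀ / 8 * (1 / (8 * n₀)) ^ 2 := by
    rw [div_pow, one_pow, ← div_eq_mul_one_div, le_div_iff₀ (by positivity)]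
    linarith
  calc ε * r ≤ δ₀ / 8 * (1 / (8 * n₀)) ^ 2 * r := mul_le_mul_of_nonneg_right h3 hr.le
    _ = δ₀ / 8 * ((1 / (8 * n₀)) ^ 2 * r) := by ring
    _ ≤ δ₀ / 8 * r' := mul_le_mul_of_nonneg_left hr1 (by positivity)

/-- Iteration along `q ^ j * r` loses nothing, and each step reaches all scales between `q ^ 2` and
`q` times the current one; together these cover everything below `q * r`. -/
theorem closeToType_of_le (hN : N' + n ≤ N) (hℬ : ℬ ⊆ allTypes n N' N)
    (hδ : IsSeparationConstant n N' ℬ δ₀) (hn₀ : IsReplacementConstant n N' ℬ n₀)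
    (hε : 0 < ε) (hε1 : ε * (512 * n₀ ^ 2) ≤ δ₀)
    (hE : ∀ r : ℝ, 0 < r → ∃ Z ∈ blowUps ℬ, x ∈ Z ∧ Near x r (ε * r) E Z) {t : ℕ} {r r' : ℝ}
    (hr : 0 < r) (ht : CloseToType n N' ℬ E x (δ₀ / 8) t r) (hr0 : 0 < r')
    (hr2 : r' ≤ 1 / (8 * n₀) * r) : CloseToType n N' ℬ E x (δ₀ / 8) t r' := by
  have hn10 := hn₀.1
  have hn0 : 0 < n₀ := lt_trans (by norm_num) hn₀.1
  set q : ℝ := 1 / (8 * n₀) with hq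
  have hq0 : 0 < q := by positivity
  have hq1 : q < 1 := by
    rw [hq, div_lt_one (by positivity)]
    linarith
  have hpow : ∀ j : ℕ, CloseToType n N' ℬ E x (δ₀ / 8) t (q ^ j * r) := by
    intro j
    induction j with
    | zero => simpa using ht
    | succ j ih =>
      have hpos : 0 < q ^ j * r := by positivity
      refine closeToType_step hN hℬ hδ hn₀ hε hε1 hE hpos ih ?_ ?_
      · rw [← hq]
        calc q ^ 2 * (q ^ j * r) = q * (q ^ j * r) * q := by ring
          _ ≤ q * (q ^ j * r) * 1 := mul_le_mul_of_nonneg_left hq1.le (by positivity)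
          _ = q ^ (j + 1) * r := by ring
      · rw [← hq]
        exact le_of_eq (by ring)
  have hqr : 0 < q * r := by positivity
  obtain ⟨j, hj1, hj2⟩ := exists_nat_pow_near_of_lt_one (x := r' / (q * r)) (y := q)
    (by positivity) ((div_le_one hqr).2 hr2) hq0 hq1
  rw [lt_div_iff₀ hqr] at hj1
  rw [div_le_iff₀ hqr] at hj2
  refine closeToType_step hN hℬ hδ hn₀ hε hε1 hE (by positivity) (hpow j) ?_ ?_
  · rw [← hq]
    refine le_trans (le_of_eq ?_) hj1.le
    ring
  · rw [← hq]
    exact hj2.trans (le_of_eq (by ring))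

/-- Maximality of `t` acts twice. The member that agrees with `Z` near `x` has type exactly `t`; and
`Z` has a point of rank at most `t` very close to `x`, since otherwise it could be replaced by a
larger type on a small ball. Translating that point to `x` adds only a comparable error. -/
theorem exists_near_spine (hN : N' + n ≤ N) (hℬ : ℬ ⊆ allTypes n N' N)
    (hδ : IsSeparationConstant n N' ℬ δ₀) (hn₀ : IsReplacementConstant n N' ℬ n₀)
    (hε : 0 < ε) (hε1 : ε * (512 * n₀ ^ 2) ≤ δ₀)
    (hE : ∀ r : ℝ, 0 < r → ∃ Z ∈ blowUps ℬ, x ∈ Z ∧ Near x r (ε * r) E Z) {t : ℕ} (htn : t ≤ n)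
    (hmax : ∀ r, 0 < r → ¬ CloseToType n N' ℬ E x (δ₀ / 8) (t + 1) r) {R : ℝ} (hR : 0 < R)
    (ht : CloseToType n N' ℬ E x (δ₀ / 8) t R) :
    ∃ W ∈ blowUpsOfType n N' ℬ t, x ∈ spine n N' t W ∧
      Near x (R / (16 * n₀)) ((1 + 16 * n₀ / δ₀) * (ε * R)) E W := by
  have hn10 := hn₀.1
  have hn0 : 0 < n₀ := lt_trans (by norm_num) hn₀.1
  have hδ0 := hδ.1
  have hδ1 := hδ.2.1
  have hn1 : 100 ≤ n₀ ^ 2 := by nlinarith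
  have hε2 : ε ≤ δ₀ / 8 := by nlinarith
  have hεR : 0 < ε * R := by positivity
  -- With `ρ = A * (ε * R) / n₀`, the error `ε * R` is exactly the threshold `δ₀ / 8 * (ρ / 2)` at
  -- scale `ρ / 2`.
  set A : ℝ := 16 * n₀ / δ₀ with hA
  have hA0 : 0 < A := by positivity
  have hA1 : 2 * n₀ ≤ A := by
    rw [hA, le_div_iff₀ hδ0]
    nlinarith
  have hA2 : A * (ε * R) ≤ R / (32 * n₀) := by
    rw [hA, div_mul_eq_mul_div, div_le_div_iff₀ hδ0 (by positivity)]
    calc 16 * n₀ * (ε * R) * (32 * n₀) = ε * (512 * n₀ ^ 2) * R := by ring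
      _ ≤ δ₀ * R := mul_le_mul_of_nonneg_right hε1 hR.le
      _ = R * δ₀ := mul_comm _ _
  have hA3 : ε * R ≤ A * (ε * R) := by nlinarith
  obtain ⟨Z, hZ, hxZ, hEZ⟩ := hE R hR
  obtain ⟨u, htu, hun, Y, hY, heq⟩ := exists_eq_of_closeToType hN hℬ hδ hn₀ hε hε2 hR ht hZ hxZ hEZ
  have hR1 : R / (32 * n₀) + R / (32 * n₀) = R / (16 * n₀) := by field_simp; norm_num
  have hR2 : R / (16 * n₀) + R / (16 * n₀) = R / (8 * n₀) := by field_simp; norm_num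
  have hR3 : R / (8 * n₀) + R / (8 * n₀) = R / (4 * n₀) := by field_simp; norm_num
  have hR0 : 0 < R / (32 * n₀) := by positivity
  have hR4 : R / (4 * n₀) ≤ R := div_le_self hR.le (by linarith)
  have hEY : Near x (R / (8 * n₀)) (ε * R) E Y :=
    (hEZ.shrink (by linarith) le_rfl).congr heq (by linarith) hεR.le
  obtain rfl : t = u := by
    refine htu.eq_or_lt.resolve_right fun hlt => hmax (R / (8 * n₀)) (by linarith)
      ⟨u, hlt, hun, Y, hY, hEY.shrink le_rfl ?_⟩
    rw [← mul_div_assoc, le_div_iff₀ (by positivity)]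
    have h1 : ε * (8 * n₀) ≤ δ₀ / 8 := by nlinarith
    calc ε * R * (8 * n₀) = ε * (8 * n₀) * R := by ring
      _ ≤ δ₀ / 8 * R := mul_le_mul_of_nonneg_right h1 hR.le
  obtain ⟨m, hmn, hZm⟩ := exists_isType hN hℬ hZ
  obtain ⟨y, hyZ, hyx, hyrank⟩ : ∃ y ∈ Z, dist y x < A * (ε * R) ∧ localRank Z y ≤ t := by
    -- For `t = n` replacement is not available, but every point has rank at most `n`.
    rcases htn.eq_or_lt with rfl | htn
    · exact ⟨x, hxZ, by rw [dist_self]; positivity, localRank_le hN hℬ hZ hxZ⟩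
    have hmt : m ≤ t := by
      by_contra! hlt
      exact hmax R hR ⟨m, hlt, hmn, Z, hZm, hEZ.shrink le_rfl
        (mul_le_mul_of_nonneg_right hε2 hR.le)⟩
    by_contra! hcon
    set ρ : ℝ := A * (ε * R) / n₀ with hρ
    have hρ0 : 0 < ρ := by positivity
    have hnρ : n₀ * ρ = A * (ε * R) := by rw [hρ]; field_simp
    obtain ⟨k, htk, hkn, Y', hY', heq'⟩ := (hn₀.2 m t hmt htn Z hZm x ρ hρ0).1
      ⟨x, hxZ, mem_ball_self hρ0⟩ (by
        rw [eq_empty_iff_forall_notMem]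
        rintro y ⟨hyx, hy⟩
        obtain ⟨hyZ, hyr⟩ := (mem_spine hN htn.le hZm.2).1 hy
        rw [hnρ, mem_ball] at hyx
        exact (hcon y hyZ hyx).not_ge hyr)
    have h1 : 2 * (ε * R) ≤ ρ := by
      rw [hρ, le_div_iff₀ hn0]
      nlinarith
    have h2 : ρ ≤ A * (ε * R) := div_le_self (by positivity) (by linarith)
    refine hmax (ρ / 2) (by positivity) ⟨k, htk, hkn, Y', hY',
      ((hEZ.shrink (by linarith) le_rfl).congr heq' (by linarith) hεR.le).shrink le_rfl ?_⟩
    have h3 : δ₀ / 8 * (ρ / 2) = ε * R := by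
      rw [hρ, hA]; field_simp; norm_num
    exact h3.ge
  have hyball : y ∈ ball x (R / (4 * n₀)) := by rw [mem_ball]; linarith
  have hyY : y ∈ Y := (heq.subset ⟨hyZ, hyball⟩).1
  have hyrankY : localRank Y y ≤ t := by
    obtain ⟨s, hs, hsub⟩ := Metric.isOpen_iff.1 isOpen_ball y hyball
    rw [← localRank_congr hs (A := Z) (B := Y)]
    · exact hyrank
    · rw [← inter_eq_self_of_subset_right hsub, ← inter_assoc, heq, inter_assoc]
  refine ⟨_, blowUpsOfType_image hY (IsometryEquiv.addRight (x - y)), ?_, ?_⟩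
  · rw [mem_spine hN hun (blowUpsOfType_image hY _).2]
    have hxy : x = IsometryEquiv.addRight (x - y) y := by simp
    refine ⟨⟨y, hyY, hxy.symm⟩, ?_⟩
    have := localRank_image (IsometryEquiv.addRight (x - y)) Y y
    rw [← hxy] at this
    rw [this]
    exact hyrankY
  · have h1 : Near x (R / (8 * n₀)) (A * (ε * R)) Y (IsometryEquiv.addRight (x - y) '' Y) :=
      near_addRight x (x - y) _ Y (by rw [← dist_eq_norm, dist_comm]; exact hyx)
    have h2 := hEY.trans h1 (r' := R / (16 * n₀)) (by linarith) (by linarith) hεR.le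
    refine h2.shrink le_rfl (le_of_eq ?_)
    ring

theorem approxNumber_lt_iff {m : ℕ} {r κ : ℝ} : approxNumber n N' ℬ E m x r < (κ : EReal) ↔
    ∃ W ∈ blowUpsOfType n N' ℬ m, x ∈ spine n N' m W ∧ relDist x r E W < κ := by
  rw [approxNumber, sInf_lt_iff]
  constructor
  · rintro ⟨_, ⟨W, ⟨hW, hx⟩, rfl⟩, hlt⟩
    exact ⟨W, hW, hx, EReal.coe_lt_coe_iff.1 hlt⟩
  · rintro ⟨W, hW, hx, hlt⟩
    exact ⟨_, ⟨W, ⟨hW, hx⟩, rfl⟩, EReal.coe_lt_coe_iff.2 hlt⟩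

/-- A single factor `n₀` from the power is enough for the estimates; it is present because `n > 0`.
-/
theorem constC_ge (hn : 0 < n) (hδ0 : 0 < δ₀) (hn0 : 10 < n₀) :
    10 ^ 8 * n₀ * (n₀ / δ₀) ≤ constC n n₀ δ₀ := by
  rw [constC]
  refine mul_le_mul_of_nonneg_right (mul_le_mul_of_nonneg_left ?_ (by positivity)) (by positivity)
  have h1 : (0 : ℝ) ≤ n := Nat.cast_nonneg n
  calc n₀ ≤ n₀ + n := by linarith
    _ ≤ (n₀ + n) ^ (3 * n) := le_self_pow₀ (by linarith) (by omega)

theorem exists_mem_stratum (hn : 0 < n) (hN : N' + n ≤ N) (hℬ : ℬ ⊆ allTypes n N' N)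
    (hδ : IsSeparationConstant n N' ℬ δ₀) (hn₀ : IsReplacementConstant n N' ℬ n₀)
    (hε : 0 < ε) (hε1 : ε * (512 * n₀ ^ 2) ≤ δ₀) (hx : x ∈ E ∩ ball 0 2)
    (hE : ∀ r : ℝ, 0 < r → ∃ Z ∈ blowUps ℬ, x ∈ Z ∧ Near x r (ε * r) E Z) :
    ∃ m ≤ n, x ∈ stratum n N' ℬ E (constC n n₀ δ₀ * ε) m := by
  have hn10 := hn₀.1
  have hn0 : 0 < n₀ := lt_trans (by norm_num) hn₀.1
  have hδ0 := hδ.1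
  have hδ1 := hδ.2.1
  have hn1 : 100 ≤ n₀ ^ 2 := by nlinarith
  have hε2 : ε ≤ δ₀ / 8 := by nlinarith
  let p : ℕ → Prop := fun t => ∃ r : ℝ, 0 < r ∧ CloseToType n N' ℬ E x (δ₀ / 8) t r
  have hp0 : p 0 := by
    obtain ⟨Z, hZ, hxZ, hEZ⟩ := hE 1 one_pos
    obtain ⟨m, hm, hZm⟩ := exists_isType hN hℬ hZ
    exact ⟨1, one_pos, m, Nat.zero_le _, hm, Z, hZm, hEZ.shrink le_rfl (by linarith)⟩
  have hpn : ∀ t, p t → t ≤ n := by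
    rintro t ⟨r, _, u, htu, hun, _⟩
    exact htu.trans hun
  obtain ⟨t, ⟨r₁, hr₁, ht⟩, hmax⟩ : ∃ t, p t ∧ ¬ p (t + 1) := by
    by_contra! hcon
    have hall : ∀ t, p t := fun t => Nat.rec hp0 (fun t ih => hcon t ih) t
    have := hpn _ (hall (n + 1))
    omega
  have htn : t ≤ n := hpn t ⟨r₁, hr₁, ht⟩
  -- `exists_near_spine` passes from scale `R` to `R / (16 * n₀)`, so it is applied with `R = r *
  -- (16 * n₀)`, which must not exceed `r₁ / (8 * n₀)`.
  refine ⟨t, htn, hx, 1 / (8 * n₀) * r₁ / (16 * n₀), by positivity, fun r hr hrr => ?_⟩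
  rw [lt_div_iff₀ (by positivity)] at hrr
  have hR : 0 < r * (16 * n₀) := by positivity
  obtain ⟨W, hW, hxW, hnear⟩ := exists_near_spine hN hℬ hδ hn₀ hε hε1 hE htn
    (fun r hr h => hmax ⟨r, hr, h⟩) hR
    (closeToType_of_le hN hℬ hδ hn₀ hε hε1 hE hr₁ ht hR hrr.le)
  rw [mul_div_cancel_right₀ _ (by positivity)] at hnear
  refine approxNumber_lt_iff.2 ⟨W, hW, hxW, ?_⟩
  have hq : 1 ≤ n₀ / δ₀ := by rw [le_div_iff₀ hδ0]; linarith
  have hC := constC_ge hn hδ0 hn10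
  refine lt_of_le_of_lt (hnear.relDist_le hr (δ := 512 * n₀ * (n₀ / δ₀) * ε) (by positivity) ?_)
    (lt_of_lt_of_le ?_ (mul_le_mul_of_nonneg_right hC hε.le))
  · have h1 : 1 + 16 * n₀ / δ₀ ≤ 32 * (n₀ / δ₀) := by
      rw [mul_div_assoc]; linarith
    calc (1 + 16 * n₀ / δ₀) * (ε * (r * (16 * n₀)))
        ≤ 32 * (n₀ / δ₀) * (ε * (r * (16 * n₀))) :=
          mul_le_mul_of_nonneg_right h1 (by positivity)
      _ = 512 * n₀ * (n₀ / δ₀) * ε * r := by ring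
  · refine mul_lt_mul_of_pos_right (mul_lt_mul_of_pos_right (mul_lt_mul_of_pos_right ?_ hn0)
      (by positivity)) hε
    norm_num

/-- At a common scale `r` the two approximations are within `2 * κ * r` of each other in `ball x (r
/ 2)`. As `x` lies on the `m`-spine of the first, separation at scale `r / 2` is violated when `4 *
κ ≤ δ₀`. -/
theorem disjoint_stratum (hN : N' + n ≤ N) (hδ : IsSeparationConstant n N' ℬ δ₀) {κ : ℝ}
    (hκ : 4 * κ ≤ δ₀) {m m' : ℕ} (hmm : m < m') (hm' : m' ≤ n) :
    Disjoint (stratum n N' ℬ E κ m) (stratum n N' ℬ E κ m') := by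
  rw [Set.disjoint_left]
  rintro x ⟨⟨hxE, -⟩, r₁, hr₁, h₁⟩ ⟨-, r₂, hr₂, h₂⟩
  have hδ0 := hδ.1
  have hδ1 := hδ.2.1
  set r : ℝ := min r₁ r₂ / 2 with hr
  have hr0 : 0 < r := by positivity
  have hlt : r < min r₁ r₂ := half_lt_self (by positivity)
  obtain ⟨V, hV, hxV, hdV⟩ := approxNumber_lt_iff.1 (h₁ r hr0 (hlt.trans_le (min_le_left _ _)))
  obtain ⟨W, hW, hxW, hdW⟩ := approxNumber_lt_iff.1 (h₂ r hr0 (hlt.trans_le (min_le_right _ _)))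
  have hxV' := ((mem_spine hN (hmm.le.trans hm') hV.2).1 hxV).1
  have hxW' := ((mem_spine hN hm' hW.2).1 hxW).1
  have hκ0 : 0 ≤ κ := (relDist_nonneg hr0 E V).trans hdV.le
  have hV' := near_of_relDist_lt hr0 ⟨x, hxE⟩ ⟨x, hxV'⟩ hdV
  have hW' := near_of_relDist_lt hr0 ⟨x, hxE⟩ ⟨x, hxW'⟩ hdW
  have hκr : κ * r ≤ r / 2 := by nlinarith
  have hVW := hV'.symm.trans hW' (r' := r / 2) (by linarith) (by linarith) (by positivity)
  exact hδ.not_near le_rfl hmm hm' hV hxV hxV' hW (half_pos hr0)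
    (hVW.shrink le_rfl (by nlinarith))

end Strata
end ConeStrata

/-! ### The proposition -/

theorem mainTheorem5 (n N' N : ℕ) (hn : 0 < n) (hN' : n < N') (hN : N' + n ≤ N)
    (ℬ : Set (Set (ConeStrata.Euc N)))
    (hℬ : ℬ ⊆ ConeStrata.allTypes n N' N)
    (hfin : ((Quotient.mk (ConeStrata.isometrySetoid N)) '' ℬ).Finite) :
    (∃ δ₀ : ℝ, ConeStrata.IsSeparationConstant n N' ℬ δ₀) ∧
    (∃ n₀ : ℝ, ConeStrata.IsReplacementConstant n N' ℬ n₀) ∧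
    ∀ δ₀ n₀ : ℝ, ConeStrata.IsSeparationConstant n N' ℬ δ₀ →
      ConeStrata.IsReplacementConstant n N' ℬ n₀ →
      ∃ ε₀ : ℝ, 0 < ε₀ ∧
        ∀ (ε : ℝ) (E : Set (ConeStrata.Euc N)), ε < ε₀ → IsClosed E → (0 : ConeStrata.Euc N) ∈ E →
          (∀ x ∈ E, ∀ r : ℝ, 0 < r →
            ∃ Z ∈ ConeStrata.blowUps ℬ, x ∈ Z ∧ ConeStrata.relDist x r E Z < ε) →
          E ∩ Metric.ball (0 : ConeStrata.Euc N) 1.99 =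
              (⋃ m ∈ Set.Iic n,
                ConeStrata.stratum n N' ℬ E (ConeStrata.constC n n₀ δ₀ * ε) m) ∩
                Metric.ball (0 : ConeStrata.Euc N) 1.99 ∧
            (Set.Iic n).PairwiseDisjoint
              (ConeStrata.stratum n N' ℬ E (ConeStrata.constC n n₀ δ₀ * ε)) := by
  refine ⟨ConeStrata.exists_isSeparationConstant hN hℬ hfin,
    ConeStrata.exists_isReplacementConstant hN' hN hℬ hfin, fun δ₀ n₀ hδ hn₀ => ?_⟩
  have hn10 := hn₀.1
  have hδ0 := hδ.1
  have hC : 0 < ConeStrata.constC n n₀ δ₀ :=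
    lt_of_lt_of_le (by positivity) (ConeStrata.constC_ge hn hδ0 hn10)
  -- The first bound serves the propagation through scales, the second the disjointness of the
  -- strata.
  refine ⟨min (δ₀ / (512 * n₀ ^ 2)) (δ₀ / (4 * ConeStrata.constC n n₀ δ₀)), by positivity,
    fun ε E hε _ h0E hE => ?_⟩
  have hε1 : ε * (512 * n₀ ^ 2) ≤ δ₀ :=
    (le_div_iff₀ (by positivity)).1 (hε.le.trans (min_le_left _ _))
  have hε2 : ε * (4 * ConeStrata.constC n n₀ δ₀) ≤ δ₀ :=
    (le_div_iff₀ (by positivity)).1 (hε.le.trans (min_le_right _ _))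
  -- The approximation at the point `0` forces `ε > 0`, since distances are nonnegative.
  have hε0 : 0 < ε := by
    obtain ⟨Z, -, -, hlt⟩ := hE 0 h0E 1 one_pos
    exact (ConeStrata.relDist_nonneg one_pos E Z).trans_lt hlt
  constructor
  · ext x
    simp only [Set.mem_inter_iff, Set.mem_iUnion, exists_prop, Set.mem_Iic]
    refine and_congr_left fun hx => ⟨fun hxE => ?_, ?_⟩
    · refine ConeStrata.exists_mem_stratum hn hN hℬ hδ hn₀ hε0 hε1
        ⟨hxE, Metric.ball_subset_ball (by norm_num) hx⟩ fun r hr => ?_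
      obtain ⟨Z, hZ, hxZ, hlt⟩ := hE x hxE r hr
      exact ⟨Z, hZ, hxZ, ConeStrata.near_of_relDist_lt hr ⟨x, hxE⟩ ⟨x, hxZ⟩ hlt⟩
    · rintro ⟨m, -, hm⟩
      exact hm.1.1
  · intro m hm m' hm' hne
    rcases lt_or_gt_of_ne hne with hlt | hlt
    · exact ConeStrata.disjoint_stratum hN hδ (by linarith) hlt hm'
    · exact (ConeStrata.disjoint_stratum hN hδ (by linarith) hlt hm).symm
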